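/- Let $r,h>0$ and let $C=\{(x,y,z)\in\mathbb R^3 : x^2+y^2\le r^2,\ 0\le z\le h\}$, with side surface $S=\{(x,y,z) : x^2+y^2=r^2,\ 0\le z\le h\}$ and axis $\ell=\{(0,0,z) : 0\le z\le h\}$. Let $d_1=\{(s\cos\varphi_1,s\sin\varphi_1,h) : |s|\le r\}$ and $d_2=\{(s\cos\varphi_2,s\sin\varphi_2,0) : |s|\le r\}$ be diameters of the top and the bottom disk of $C$ that are not parallel, i.e. $\varphi_1-\varphi_2\notin\pi\mathbb Z$. Let $\theta$ be an angle with $|\theta|\le\pi/2$ and $\varphi_1-\varphi_2\in\theta+\pi\mathbb Z$ (it is unique, except that both signs are possible when $|\theta|=\pi/2$), and let $$H_C=\{(s\cos(\varphi_2+\theta z/h),\ s\sin(\varphi_2+\theta z/h),\ z) : |s|\le r,\ 0\le z\le h\}$$ be the corresponding compact piece of a helicoid, which contains $d_1$ and $d_2$. Let $\Sigma$ be an immersed disk-type surface, i.e. $\Sigma$ is given by a map $f$ that is of class $C^1$ on a neighbourhood of a closed topological disk $K\subset\mathbb R^2$ (whose boundary may have corners) and has injective differential at every point of $K$; its boundary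 is $\partial\Sigma=f(\partial K)$, its area $\operatorname{Area}(\Sigma)=\int_K|\partial_1f\times\partial_2f|$ is counted with multiplicity, and $\Sigma$ is called congruent to $H_C$ if for some isometry $g$ of $\mathbb R^3$ the map $g\circ f$ is a bijection from $K$ onto $H_C$. Suppose that * $f(K)\subset C$ and $\partial\Sigma\subset d_1\cup d_2\cup S$; * $\Sigma$ contains the axis: $\ell\subset f(K)$; * for every $0<t\le r$, $\Sigma$ is transversal to the cylinder $\partial C_t=\{x^2+y^2=t^2\}$: at every $p\in K$ with $f(p)\in\partial C_t$, the image of $df_p$ and the tangent plane of $\partial C_t$ at $f(p)$ together span $\mathbb R^3$. Then $\operatorname{Area}(\Sigma)\ge\operatorname{Area}(H_C)$, and equality holds if and only if $\Sigma$ is congruent to $H_C$. -/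

import Mathlib

open Set MeasureTheory Metric
open scoped ENNReal

noncomputable section

namespace HelicoidCylinder

/-- The parameter plane. -/
abbrev Plane := EuclideanSpace ℝ (Fin 2)

/-- Euclidean three-space. -/
abbrev Space := EuclideanSpace ℝ (Fin 3)

/-! ### The cylinder -/

/-- The solid cylinder `C` of radius `r` and height `h` about the `z`-axis. -/
def solidCylinder (r h : ℝ) : Set Space :=
  {p | p 0 ^ 2 + p 1 ^ 2 ≤ r ^ 2 ∧ 0 ≤ p 2 ∧ p 2 ≤ h}

/-- The side surface `S` of the solid cylinder. -/
def sideSurface (r h : ℝ) : Set Space :=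
  {p | p 0 ^ 2 + p 1 ^ 2 = r ^ 2 ∧ 0 ≤ p 2 ∧ p 2 ≤ h}

/-- The axis of the solid cylinder, a segment of length `h`. -/
def axis (h : ℝ) : Set Space :=
  {p | p 0 = 0 ∧ p 1 = 0 ∧ 0 ≤ p 2 ∧ p 2 ≤ h}

/-- The diameter with direction `(cos φ, sin φ, 0)` of the horizontal disk of radius `r`
at height `z`. -/
def diameter (r z φ : ℝ) : Set Space :=
  {p | ∃ s ∈ Icc (-r) r, p = !₂[s * Real.cos φ, s * Real.sin φ, z]}

/-- The coaxial cylindrical surface `∂C_t`. -/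
def coaxialCylinder (t : ℝ) : Set Space :=
  {p | p 0 ^ 2 + p 1 ^ 2 = t ^ 2}

/-- The tangent plane at `p` of the coaxial cylindrical surface through `p`
(for `p` off the axis): the plane orthogonal to the radial direction. -/
def coaxialTangent (p : Space) : Submodule ℝ Space :=
  (Submodule.span ℝ {(!₂[p 0, p 1, 0] : Space)})ᗮ

/-! ### Immersed disks -/

/-- `f` restricted to `K` is an immersed surface of disk type: `K` is a closed topological disk in
the plane (its boundary, which may have corners, corresponding to the unit circle), and `f` is a
`C¹` immersion up to the boundary. -/
structure IsImmersedDisk (f : Plane → Space) (K : Set Plane) : Prop where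
  disk : ∃ e : closedBall (0 : Plane) 1 ≃ₜ K,
    ∀ x, (e x : Plane) ∈ frontier K ↔ (x : Plane) ∈ sphere (0 : Plane) 1
  contDiff : ∃ U : Set Plane, IsOpen U ∧ K ⊆ U ∧ ContDiffOn ℝ 1 f U
  immersion : ∀ x ∈ K, Function.Injective (fderiv ℝ f x)

/-- The surface `f|K` is transversal to `∂C_t` for every `0 < t ≤ r`. -/
def TransversalToCylinders (r : ℝ) (f : Plane → Space) (K : Set Plane) : Prop :=
  ∀ t, 0 < t → t ≤ r → ∀ x ∈ K, f x ∈ coaxialCylinder t →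
    LinearMap.range (fderiv ℝ f x).toLinearMap ⊔ coaxialTangent (f x) = ⊤

/-- The area element `√(|∂₁f|²|∂₂f|² - ⟨∂₁f, ∂₂f⟩²)` of a parametrized surface. -/
def areaElement (f : Plane → Space) (x : Plane) : ℝ :=
  let a := fderiv ℝ f x (EuclideanSpace.single 0 1)
  let b := fderiv ℝ f x (EuclideanSpace.single 1 1)
  √(‖a‖ ^ 2 * ‖b‖ ^ 2 - inner ℝ a b ^ 2)

/-- The area of the parametrized surface `f|K` (the two-dimensional Hausdorff measure of the
image, counted with multiplicity). -/
def area (f : Plane → Space) (K : Set Plane) : ℝ≥0∞ :=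
  ∫⁻ x in K, ENNReal.ofReal (areaElement f x)

/-! ### The helicoid -/

/-- The parametrization of the helicoid ruled by horizontal lines through the `z`-axis; the ruling
at height `z` has direction `(cos (φ + ω z), sin (φ + ω z), 0)`. -/
def helicoidMap (φ ω : ℝ) (x : Plane) : Space :=
  !₂[x 0 * Real.cos (φ + ω * x 1), x 0 * Real.sin (φ + ω * x 1), x 1]

/-- The helicoid `H`. -/
def helicoid (φ ω : ℝ) : Set Space := range (helicoidMap φ ω)

/-- The compact helicoid `H_C = H ∩ C` that starts at height `0` in direction `φ` and turns by
the angle `θ` up to height `h`. -/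
def compactHelicoid (r h φ θ : ℝ) : Set Space :=
  helicoid φ (θ / h) ∩ solidCylinder r h

/-- The parameter rectangle `[-r, r] × [0, h]` of the compact helicoid. -/
def parameterRectangle (r h : ℝ) : Set Plane :=
  {x | x 0 ∈ Icc (-r) r ∧ x 1 ∈ Icc 0 h}

/-- The rectangle parametrizes `H_C` bijectively. -/
theorem helicoidMap_bijOn {r : ℝ} (hr : 0 < r) (h φ θ : ℝ) :
    BijOn (helicoidMap φ (θ / h)) (parameterRectangle r h) (compactHelicoid r h φ θ) := by
  have key : ∀ x : Plane, (helicoidMap φ (θ / h) x) 0 ^ 2 + (helicoidMap φ (θ / h) x) 1 ^ 2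
      = x 0 ^ 2 := by
    intro x
    have := Real.sin_sq_add_cos_sq (φ + θ / h * x 1)
    simp only [helicoidMap, PiLp.toLp_apply, Matrix.cons_val_zero, Matrix.cons_val_one]
    linear_combination x 0 ^ 2 * this
  have key2 : ∀ x : Plane, (helicoidMap φ (θ / h) x) 2 = x 1 := fun x => by simp [helicoidMap]
  refine ⟨fun x hx => ⟨⟨x, rfl⟩, ?_⟩, ?_, ?_⟩
  · refine ⟨?_, ?_⟩
    · rw [key]; exact sq_le_sq' hx.1.1 hx.1.2
    · rw [key2]; exact hx.2
  · intro x _ y _ hxy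
    have h1 : x 1 = y 1 := by rw [← key2, ← key2, hxy]
    have hx0 : (helicoidMap φ (θ / h) x) 0 = (helicoidMap φ (θ / h) y) 0 := by rw [hxy]
    have hx1 : (helicoidMap φ (θ / h) x) 1 = (helicoidMap φ (θ / h) y) 1 := by rw [hxy]
    simp only [helicoidMap, PiLp.toLp_apply, Matrix.cons_val_zero, Matrix.cons_val_one, h1]
      at hx0 hx1
    have := Real.sin_sq_add_cos_sq (φ + θ / h * y 1)
    have h0 : x 0 = y 0 := by
      linear_combination Real.cos (φ + θ / h * y 1) * hx0 + Real.sin (φ + θ / h * y 1) * hx1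
        - (x 0 - y 0) * this
    ext i
    fin_cases i
    · exact h0
    · exact h1
  · rintro _ ⟨⟨x, rfl⟩, hx⟩
    refine ⟨x, ⟨?_, ?_⟩, rfl⟩
    · have := hx.1
      rw [key] at this
      exact abs_le_of_sq_le_sq' this hr.le
    · have := hx.2
      rwa [key2] at this

/-- The area of `H_C`. -/
def helicoidArea (r h φ θ : ℝ) : ℝ≥0∞ :=
  area (helicoidMap φ (θ / h)) (parameterRectangle r h)

/-- The parametrized surface `f|K` is congruent to the embedded surface `H`: some isometry of
space carries it onto `H`, up to reparametrization (so `H` is covered exactly once). -/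
def CongruentTo (f : Plane → Space) (K : Set Plane) (H : Set Space) : Prop :=
  ∃ g : Space ≃ᵢ Space, BijOn (g ∘ f) K H

end HelicoidCylinder

end

open HelicoidCylinder

/-! The inequality is a calibration argument in signed polar coordinates f = (σ cos ψ, σ sin ψ, z).
If σ and ψ exist as continuous functions on K, then ψ takes constant values ψ₁ ∈ φ₁ + πℤ and ψ₂ ∈ φ₂
+ πℤ over the two diameters, and α = ψ₁ - ψ₂ lies in θ + πℤ, so |θ| ≤ |α|. Put L(s) = √(h² + s²α²)
and G = (σ, (σ²αψ + hz)/L(σ)). The Jacobian of G is the pairing of the area bivector of f with the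
unit bivector of the helicoid of turn α, because terms in dσ drop out of the determinant; by
Cauchy-Schwarz it is at most the area element (`abs_calibration_det_le`). The slice of the image of
G over a radius s ≠ 0 contains an open interval of length L(s) (`calibratedRegion_subset`,
`helixBound_sub`). Hence the area is at least ∫ L(s) ds over |s| < r, which is the area of the
helicoid of turn α and increases with |α|.

The topology lies in constructing σ and ψ (`exists_signed_polar`). Transversality leaves the squared
distance to the axis without critical points off the axis, also along the boundary inside the open
cylinder, since the boundary is radial there. With neither minima nor saddles between the levels 0
and r², its zero set, the preimage of the axis, is connected (`isPreconnected_zero_level`). On this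
continuum the height is locally injective because f is an immersion, hence injective
(`injective_of_locally_injective`): the surface passes through each axis point once. The horizontal
direction is defined only up to sign there, but its square extends continuously over the axis. As K
is simply connected, the square has a continuous argument, and half of it is ψ. The covering
property follows because each line σ = s, |s| < r, meets the boundary of the disk exactly twice,
once over each diameter; a winding argument (`exists_eq_of_boundary_crossing`) fills the segment
between.

If the areas agree, then |α| = |θ| and equality holds in Cauchy-Schwarz everywhere off the axis.
This means dψ = (α/h) dz, so ψ is affine in z and f is the helicoid parametrization composed with
(σ, z). That map is injective inside K, since a doubly covered piece could be discarded at a saving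
of area, and injectivity extends to the boundary by local injectivity of f. The case α = -θ is a
mirror image. Conversely, a surface congruent to H_C has the same area by change of variables
(`area_eq_of_congruentTo`). -/

namespace HelicoidCylinder

open Filter Topology

/-! ### Sublevel sets of a function without local minima -/

/-- `B` is one half of a partition of `{u ≤ t}` into two closed sets, and it meets `{u ≤ 0}`
in `A`. -/
def IsSublevelPart {X : Type*} [TopologicalSpace X] (u : X → ℝ) (A : Set X) (t : ℝ)
    (B : Set X) : Prop :=
  IsClosed B ∧ IsClosed ({x | u x ≤ t} \ B) ∧ B ⊆ {x | u x ≤ t} ∧ B ∩ {x | u x ≤ 0} = A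

section Sublevel

variable {X : Type*} [TopologicalSpace X] {u : X → ℝ} {A : Set X} {R : ℝ}

theorem IsSublevelPart.restrict (hu : Continuous u) {s t : ℝ} (hs : 0 ≤ s) (hst : s ≤ t)
    {B : Set X} (hB : IsSublevelPart u A t B) :
    IsSublevelPart u A s (B ∩ {x | u x ≤ s}) := by
  have hc : IsClosed {x | u x ≤ s} := isClosed_le hu continuous_const
  refine ⟨hB.1.inter hc, ?_, inter_subset_right, ?_⟩
  · have : {x | u x ≤ s} \ (B ∩ {x | u x ≤ s}) = ({x | u x ≤ t} \ B) ∩ {x | u x ≤ s} := by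
      ext x
      simp only [Set.mem_sdiff, mem_inter_iff, mem_ofPred_eq]
      constructor
      · rintro ⟨h1, h2⟩
        exact ⟨⟨h1.trans hst, fun h => h2 ⟨h, h1⟩⟩, h1⟩
      · rintro ⟨⟨h1, h2⟩, h3⟩
        exact ⟨h3, fun h => h2 h.1⟩
    rw [this]
    exact hB.2.1.inter hc
  · rw [← hB.2.2.2]
    ext x
    simp only [mem_inter_iff, mem_ofPred_eq]
    constructor
    · rintro ⟨⟨h1, h2⟩, h3⟩
      exact ⟨h1, h3⟩
    · rintro ⟨h1, h3⟩
      exact ⟨⟨h1, h3.trans hs⟩, h3⟩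

/-- A part is determined by its trace A on the zero level. If B were not inside B', a minimum point
of u on B \ B' would have positive value, as the traces agree; B \ B' being relatively open in {u ≤
t}, it would be a local minimum of u. -/
theorem IsSublevelPart.subset [CompactSpace X] (hu : Continuous u)
    (hmin : ∀ x, 0 < u x → u x < R → x ∈ closure {y | u y < u x}) {t : ℝ} (ht : t < R)
    {B B' : Set X} (hB : IsSublevelPart u A t B) (hB' : IsSublevelPart u A t B') : B ⊆ B' := by
  by_contra hne
  set D := B ∩ ({x | u x ≤ t} \ B') with hD
  have hDc : IsCompact D := (hB.1.inter hB'.2.1).isCompact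
  have hDn : D.Nonempty := by
    obtain ⟨x, hx, hx'⟩ := not_subset.1 hne
    exact ⟨x, hx, hB.2.2.1 hx, hx'⟩
  obtain ⟨x, hxD, hxmin⟩ := hDc.exists_isMinOn hDn hu.continuousOn
  have hxt : u x ≤ t := hxD.2.1
  have hx0 : 0 < u x := by
    by_contra h0
    have : x ∈ A := by rw [← hB.2.2.2]; exact ⟨hxD.1, not_lt.1 h0⟩
    rw [← hB'.2.2.2] at this
    exact hxD.2.2 this.1
  have hE : IsClosed (({y | u y ≤ t} \ B) ∪ B') := hB.2.1.union hB'.1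
  have hxE : x ∈ (({y | u y ≤ t} \ B) ∪ B')ᶜ := by
    rintro (h | h)
    · exact h.2 hxD.1
    · exact hxD.2.2 h
  obtain ⟨y, hy1, hy2⟩ := mem_closure_iff.1 (hmin x hx0 (hxt.trans_lt ht)) _ hE.isOpen_compl hxE
  have hyt : u y ≤ t := (le_of_lt hy2).trans hxt
  have hyD : y ∈ D := by
    refine ⟨?_, hyt, fun h => hy1 (Or.inr h)⟩
    by_contra h
    exact hy1 (Or.inl ⟨hyt, h⟩)
  have h1 : u x ≤ u y := hxmin hyD
  exact absurd hy2 (not_lt.2 h1)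

/-- By uniqueness the parts at the levels s < t are restrictions of one another, so they glue.
Openness comes from looking at a level strictly between u x and t. -/
theorem exists_open_partition_of_forall_isSublevelPart [CompactSpace X] (hu : Continuous u)
    (hmin : ∀ x, 0 < u x → u x < R → x ∈ closure {y | u y < u x}) {t : ℝ} (ht0 : 0 < t)
    (htR : t ≤ R) (h : ∀ s, 0 ≤ s → s < t → ∃ B, IsSublevelPart u A s B) :
    ∃ V W : Set X, IsOpen V ∧ IsOpen W ∧ Disjoint V W ∧ V ∪ W = {x | u x < t} ∧
      V ∩ {x | u x ≤ 0} = A := by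
  choose! B hB using h
  have huniq : ∀ s s', 0 ≤ s → s ≤ s' → s' < t → ∀ x, u x ≤ s → (x ∈ B s ↔ x ∈ B s') := by
    intro s s' h0 hs hs' x hx
    have h1 := (hB s' (h0.trans hs) hs').restrict hu h0 hs
    have h2 := hB s h0 (hs.trans_lt hs')
    constructor
    · intro hxB
      exact (h2.subset hu hmin ((hs.trans_lt hs').trans_le htR) h1 hxB).1
    · intro hxB
      exact h1.subset hu hmin ((hs.trans_lt hs').trans_le htR) h2 ⟨hxB, hx⟩
  have huniq' : ∀ s s', 0 ≤ s → 0 ≤ s' → s < t → s' < t → ∀ x, u x ≤ s → u x ≤ s' →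
      (x ∈ B s ↔ x ∈ B s') := by
    intro s s' h0 h0' hs hs' x hx hx'
    rcases le_total s s' with hle | hle
    · exact huniq s s' h0 hle hs' x hx
    · exact (huniq s' s h0' hle hs x hx').symm
  set V := {x | u x < t ∧ ∃ s, 0 ≤ s ∧ s < t ∧ u x ≤ s ∧ x ∈ B s} with hV
  set W := {x | u x < t ∧ ∃ s, 0 ≤ s ∧ s < t ∧ u x ≤ s ∧ x ∉ B s} with hW
  have hmid : ∀ x, u x < t → ∃ s, 0 ≤ s ∧ s < t ∧ u x < s := by
    intro x hx
    refine ⟨(max 0 (u x) + t) / 2, ?_, ?_, ?_⟩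
    · have := le_max_left 0 (u x); linarith
    · have : max 0 (u x) < t := max_lt ht0 hx
      linarith
    · have := le_max_right 0 (u x); linarith
  refine ⟨V, W, ?_, ?_, ?_, ?_, ?_⟩
  · rw [isOpen_iff_mem_nhds]
    rintro x ⟨hxt, s', h0', hs', hxs', hxB'⟩
    obtain ⟨s, h0, hs, hxs⟩ := hmid x hxt
    have hxB : x ∈ B s := (huniq' s s' h0 h0' hs hs' x hxs.le hxs').2 hxB'
    have ho : IsOpen (({y | u y ≤ s} \ B s)ᶜ ∩ {y | u y < s}) :=
      (hB s h0 hs).2.1.isOpen_compl.inter (isOpen_lt hu continuous_const)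
    refine mem_of_superset (ho.mem_nhds ⟨fun h => h.2 hxB, hxs⟩) ?_
    rintro y ⟨hy1, hy2⟩
    have hy2' : u y < s := hy2
    refine ⟨hy2'.trans hs, s, h0, hs, hy2'.le, ?_⟩
    by_contra hyB
    exact hy1 ⟨hy2'.le, hyB⟩
  · rw [isOpen_iff_mem_nhds]
    rintro x ⟨hxt, s', h0', hs', hxs', hxB'⟩
    obtain ⟨s, h0, hs, hxs⟩ := hmid x hxt
    have hxB : x ∉ B s := fun hx => hxB' ((huniq' s s' h0 h0' hs hs' x hxs.le hxs').1 hx)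
    have ho : IsOpen ((B s)ᶜ ∩ {y | u y < s}) :=
      (hB s h0 hs).1.isOpen_compl.inter (isOpen_lt hu continuous_const)
    refine mem_of_superset (ho.mem_nhds ⟨hxB, hxs⟩) ?_
    rintro y ⟨hy1, hy2⟩
    have hy2' : u y < s := hy2
    exact ⟨hy2'.trans hs, s, h0, hs, hy2'.le, hy1⟩
  · rw [Set.disjoint_left]
    rintro x ⟨-, s, h0, hs, hxs, hxB⟩ ⟨-, s', h0', hs', hxs', hxB'⟩
    exact hxB' ((huniq' s s' h0 h0' hs hs' x hxs hxs').1 hxB)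
  · ext x
    constructor
    · rintro (h | h) <;> exact h.1
    · intro hx
      obtain ⟨s, h0, hs, hxs⟩ := hmid x hx
      by_cases hxB : x ∈ B s
      · exact Or.inl ⟨hx, s, h0, hs, hxs.le, hxB⟩
      · exact Or.inr ⟨hx, s, h0, hs, hxs.le, hxB⟩
  · ext x
    constructor
    · rintro ⟨⟨-, s, h0, hs, hxs, hxB⟩, hx0⟩
      rw [← (hB s h0 hs).2.2.2]
      exact ⟨hxB, hx0⟩
    · intro hx
      rw [← (hB 0 le_rfl ht0).2.2.2] at hx
      have hx0 : u x ≤ 0 := hx.2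
      exact ⟨⟨hx0.trans_lt ht0, 0, le_rfl, ht0, hx0, hx.1⟩, hx0⟩

/-- Passage to a limit level. The closures of the two open halves stay disjoint because {u < t} is
connected near each point of level t (no saddle), and they cover {u ≤ t} because such points are not
local minima. -/
theorem exists_isSublevelPart_of_forall_lt [CompactSpace X] (hu : Continuous u)
    (hmin : ∀ x, 0 < u x → u x < R → x ∈ closure {y | u y < u x})
    (hloc : ∀ x, 0 < u x → u x < R → ∃ N ∈ 𝓝 x, IsPreconnected (N ∩ {y | u y < u x}))
    {t : ℝ} (ht0 : 0 < t) (htR : t < R) (h : ∀ s, 0 ≤ s → s < t → ∃ B, IsSublevelPart u A s B) :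
    ∃ B, IsSublevelPart u A t B := by
  obtain ⟨V, W, hV, hW, hVW, hun, hVA⟩ :=
    exists_open_partition_of_forall_isSublevelPart hu hmin ht0 htR.le h
  have hct : IsClosed {x | u x ≤ t} := isClosed_le hu continuous_const
  have hVt : closure V ⊆ {x | u x ≤ t} := by
    refine closure_minimal (fun x hx => ?_) hct
    have : x ∈ {x | u x < t} := hun ▸ Or.inl hx
    exact le_of_lt (show u x < t from this)
  have hWt : closure W ⊆ {x | u x ≤ t} := by
    refine closure_minimal (fun x hx => ?_) hct
    have : x ∈ {x | u x < t} := hun ▸ Or.inr hx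
    exact le_of_lt (show u x < t from this)
  have hdis : Disjoint (closure V) (closure W) := by
    rw [Set.disjoint_left]
    intro x hxV hxW
    rcases lt_or_eq_of_le (show u x ≤ t from hVt hxV) with hx | hx
    · have : x ∈ V ∪ W := by rw [hun]; exact hx
      rcases this with hxV' | hxW'
      · exact Set.disjoint_left.1 (hVW.closure_right hV) hxV' hxW
      · exact Set.disjoint_left.1 (hVW.closure_left hW) hxV hxW'
    · obtain ⟨N, hN, hNc⟩ := hloc x (hx ▸ ht0) (hx ▸ htR)
      rw [hx] at hNc
      obtain ⟨y, hyN, hyV⟩ := mem_closure_iff_nhds.1 hxV N hN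
      obtain ⟨y', hyN', hyW⟩ := mem_closure_iff_nhds.1 hxW N hN
      have hy : u y < t := by
        have : y ∈ {x | u x < t} := hun ▸ Or.inl hyV
        exact this
      have hy' : u y' < t := by
        have : y' ∈ {x | u x < t} := hun ▸ Or.inr hyW
        exact this
      obtain ⟨w, -, hw⟩ := hNc V W hV hW (fun w hw => by rw [hun]; exact hw.2)
        ⟨y, ⟨hyN, hy⟩, hyV⟩ ⟨y', ⟨hyN', hy'⟩, hyW⟩
      exact Set.disjoint_left.1 hVW hw.1 hw.2
  have hcov : {x | u x ≤ t} \ closure V = closure W := by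
    ext x
    constructor
    · rintro ⟨hx, hxV⟩
      rcases lt_or_eq_of_le (show u x ≤ t from hx) with hx' | hx'
      · have : x ∈ V ∪ W := by rw [hun]; exact hx'
        rcases this with h' | h'
        · exact absurd (subset_closure h') hxV
        · exact subset_closure h'
      · have := hmin x (hx' ▸ ht0) (hx' ▸ htR)
        rw [hx', ← hun, closure_union] at this
        exact this.resolve_left hxV
    · intro hx
      exact ⟨hWt hx, fun h' => Set.disjoint_left.1 hdis h' hx⟩
  refine ⟨closure V, isClosed_closure, ?_, hVt, ?_⟩
  · rw [hcov]; exact isClosed_closure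
  · rw [← hVA]
    ext x
    constructor
    · rintro ⟨hx, hx0⟩
      have hx0' : u x ≤ 0 := hx0
      have : x ∈ V ∪ W := by rw [hun]; exact hx0'.trans_lt ht0
      refine ⟨this.resolve_right fun h' => ?_, hx0⟩
      exact Set.disjoint_left.1 hdis hx (subset_closure h')
    · rintro ⟨hx, hx0⟩
      exact ⟨subset_closure hx, hx0⟩

/-- Normality separates the two halves by disjoint open sets, and by compactness these still cover
{u ≤ t'} for some t' > t. -/
theorem IsSublevelPart.exists_gt [CompactSpace X] [T2Space X] (hu : Continuous u) {t : ℝ}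
    (ht : 0 ≤ t) {B : Set X} (hB : IsSublevelPart u A t B) :
    ∃ t', t < t' ∧ ∃ B', IsSublevelPart u A t' B' := by
  obtain ⟨O₁, O₂, hO₁, hO₂, h1, h2, hd⟩ :=
    normal_separation hB.1 hB.2.1 disjoint_sdiff_right
  obtain ⟨t', htt', ht'⟩ : ∃ t', t < t' ∧ {x | u x ≤ t'} ⊆ O₁ ∪ O₂ := by
    rcases ((O₁ ∪ O₂)ᶜ).eq_empty_or_nonempty with he | hne
    · exact ⟨t + 1, by linarith, by rw [compl_empty_iff.1 he]; exact subset_univ _⟩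
    · obtain ⟨x, hx, hxm⟩ := (hO₁.union hO₂).isClosed_compl.isCompact.exists_isMinOn hne
        hu.continuousOn
      have hxt : t < u x := by
        by_contra h
        apply hx
        by_cases hxB : x ∈ B
        · exact Or.inl (h1 hxB)
        · exact Or.inr (h2 ⟨not_lt.1 h, hxB⟩)
      refine ⟨(t + u x) / 2, by linarith, fun y hy => ?_⟩
      by_contra hyO
      have h3 : u x ≤ u y := hxm hyO
      have h4 : u y ≤ (t + u x) / 2 := hy
      linarith
  have hct : IsClosed {x | u x ≤ t'} := isClosed_le hu continuous_const
  refine ⟨t', htt', {x | u x ≤ t'} ∩ O₂ᶜ, hct.inter hO₂.isClosed_compl, ?_, inter_subset_left, ?_⟩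
  · have : {x | u x ≤ t'} \ ({x | u x ≤ t'} ∩ O₂ᶜ) = {x | u x ≤ t'} ∩ O₁ᶜ := by
      ext x
      constructor
      · rintro ⟨hx, hx'⟩
        refine ⟨hx, fun hxO => ?_⟩
        exact hx' ⟨hx, fun hxO' => Set.disjoint_left.1 hd hxO hxO'⟩
      · rintro ⟨hx, hx'⟩
        exact ⟨hx, fun h => h.2 ((ht' hx).resolve_left hx')⟩
    rw [this]
    exact hct.inter hO₁.isClosed_compl
  · rw [← hB.2.2.2]
    ext x
    constructor
    · rintro ⟨⟨-, hx⟩, hx0⟩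
      have hx0' : u x ≤ 0 := hx0
      refine ⟨?_, hx0⟩
      by_contra hxB
      exact hx (h2 ⟨hx0'.trans ht, hxB⟩)
    · rintro ⟨hxB, hx0⟩
      have hx0' : u x ≤ 0 := hx0
      exact ⟨⟨hx0'.trans (ht.trans htt'.le), fun h => Set.disjoint_left.1 hd (h1 hxB) h⟩, hx0⟩

/-- A continuous function on a compact space that has no local minimum and no saddle between the
levels `0` and `R` has a connected set of minimum points if `{u < R}` is connected. -/
theorem isPreconnected_zero_level [CompactSpace X] [T2Space X] (hu : Continuous u) (hR : 0 < R)
    (hmin : ∀ x, 0 < u x → u x < R → x ∈ closure {y | u y < u x})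
    (hloc : ∀ x, 0 < u x → u x < R → ∃ N ∈ 𝓝 x, IsPreconnected (N ∩ {y | u y < u x}))
    (hconn : IsPreconnected {x | u x < R}) : IsPreconnected {x | u x ≤ 0} := by
  have hc0 : IsClosed {x | u x ≤ 0} := isClosed_le hu continuous_const
  rw [isPreconnected_closed_iff]
  intro C D hC hD hCD hnC hnD
  by_contra hne
  -- A splitting of the zero level is continued upwards through all levels below R, until it splits
  -- {u < R}.
  set A := {x | u x ≤ 0} ∩ C with hA
  have hAD : {x | u x ≤ 0} \ A = {x | u x ≤ 0} ∩ D := by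
    ext x
    constructor
    · rintro ⟨hx, hx'⟩
      exact ⟨hx, (hCD hx).resolve_left fun h => hx' ⟨hx, h⟩⟩
    · rintro ⟨hx, hx'⟩
      exact ⟨hx, fun h => hne ⟨x, hx, h.2, hx'⟩⟩
  have h0 : IsSublevelPart u A 0 A :=
    ⟨hc0.inter hC, by rw [hAD]; exact hc0.inter hD, inter_subset_left, by
      rw [hA, inter_right_comm, inter_self]⟩
  have hall : ∀ s, 0 ≤ s → s < R → ∃ B, IsSublevelPart u A s B := by
    intro b hb hbR
    -- Continuity argument: the set of good levels contains 0, is closed under suprema, and can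
    -- always be extended a little further.
    set T := {t | t ∈ Icc 0 b ∧ ∃ B, IsSublevelPart u A t B} with hT
    have hT0 : (0 : ℝ) ∈ T := ⟨⟨le_rfl, hb⟩, A, h0⟩
    have hTb : BddAbove T := ⟨b, fun t ht => ht.1.2⟩
    have hm0 : 0 ≤ sSup T := le_csSup hTb hT0
    have hmb : sSup T ≤ b := csSup_le ⟨0, hT0⟩ fun t ht => ht.1.2
    have hlt : ∀ s, 0 ≤ s → s < sSup T → ∃ B, IsSublevelPart u A s B := by
      intro s hs hsT
      obtain ⟨t, ⟨ht, B, hB⟩, hst⟩ := exists_lt_of_lt_csSup ⟨0, hT0⟩ hsT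
      exact ⟨_, hB.restrict hu hs hst.le⟩
    have hm : ∃ B, IsSublevelPart u A (sSup T) B := by
      rcases hm0.eq_or_lt with h | h
      · rw [← h]; exact ⟨A, h0⟩
      · exact exists_isSublevelPart_of_forall_lt hu hmin hloc h (hmb.trans_lt hbR) hlt
    rcases hmb.eq_or_lt with h | h
    · rwa [h] at hm
    · exfalso
      obtain ⟨B, hB⟩ := hm
      obtain ⟨t', ht', B', hB'⟩ := hB.exists_gt hu hm0
      have : min t' b ∈ T :=
        ⟨⟨le_min (hm0.trans ht'.le) hb, min_le_right _ _⟩, _,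
          hB'.restrict hu (le_min (hm0.trans ht'.le) hb) (min_le_left _ _)⟩
      exact absurd (le_csSup hTb this) (not_le.2 (lt_min ht' h))
  obtain ⟨V, W, hV, hW, hVW, hun, hVA⟩ :=
    exists_open_partition_of_forall_isSublevelPart hu hmin hR le_rfl hall
  obtain ⟨x, hx0, hxC⟩ := hnC
  obtain ⟨y, hy0, hyD⟩ := hnD
  have hxA : x ∈ V ∩ {x | u x ≤ 0} := by rw [hVA]; exact ⟨hx0, hxC⟩
  have hyV : y ∉ V := fun h => by
    have : y ∈ V ∩ {x | u x ≤ 0} := ⟨h, hy0⟩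
    rw [hVA] at this
    exact hne ⟨y, hy0, this.2, hyD⟩
  have hxR : u x < R := lt_of_le_of_lt hx0 hR
  have hyR : u y < R := lt_of_le_of_lt hy0 hR
  have hyW : y ∈ W := by
    have : y ∈ V ∪ W := by rw [hun]; exact hyR
    exact this.resolve_left hyV
  obtain ⟨w, -, hw⟩ := hconn V W hV hW hun.ge ⟨x, hxR, hxA.1⟩ ⟨y, hyR, hyW⟩
  exact Set.disjoint_left.1 hVW hw.1 hw.2

end Sublevel

/-! ### Locally injective functions on a continuum -/

theorem exists_pos_forall_dist_lt_injective {X : Type*} [MetricSpace X] [CompactSpace X]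
    {z : X → ℝ} (hinj : ∀ x, ∃ N ∈ 𝓝 x, InjOn z N) :
    ∃ δ > 0, ∀ x y, z x = z y → dist x y < δ → x = y := by
  choose N hN hNi using hinj
  obtain ⟨δ, hδ, h⟩ := lebesgue_number_lemma_of_metric (isCompact_univ (X := X))
    (c := fun x => interior (N x)) (fun x => isOpen_interior)
    (fun x _ => mem_iUnion.2 ⟨x, mem_interior_iff_mem_nhds.2 (hN x)⟩)
  refine ⟨δ, hδ, fun x y hxy hd => ?_⟩
  obtain ⟨i, hi⟩ := h x (mem_univ x)
  exact hNi i (interior_subset (hi (mem_ball_self hδ)))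
    (interior_subset (hi (by rwa [mem_ball, dist_comm]))) hxy

/-- A locally injective real function on a continuum is injective. -/
theorem injective_of_locally_injective {X : Type*} [MetricSpace X] [CompactSpace X]
    [PreconnectedSpace X] {z : X → ℝ} (hz : Continuous z) {h : ℝ} (hh : 0 < h)
    (hrange : range z = Icc 0 h) (hinj : ∀ x, ∃ N ∈ 𝓝 x, InjOn z N) : Function.Injective z := by
  obtain ⟨δ₀, hδ₀, hδinj⟩ := exists_pos_forall_dist_lt_injective hinj
  -- Two points within δ of a common centre are then less than δ₀ apart, so `z` separates them.
  set δ := δ₀ / 3 with hδ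
  have hδpos : 0 < δ := by positivity
  -- Pairs at distance exactly δ form a compact set on which the heights differ. So points of a thin
  -- slab around the height of a never lie on the sphere of radius δ about a.
  obtain ⟨η₀, hη₀, hη⟩ : ∃ η₀ > 0, ∀ x y, |z x - z y| < η₀ → dist x y ≠ δ := by
    set E := {p : X × X | dist p.1 p.2 = δ} with hE
    have hEc : IsCompact E :=
      (isClosed_eq (continuous_fst.dist continuous_snd) continuous_const).isCompact
    rcases E.eq_empty_or_nonempty with he | hne
    · refine ⟨1, one_pos, fun x y _ hd => ?_⟩
      have : (x, y) ∈ E := hd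
      rw [he] at this
      exact this
    · obtain ⟨p, hp, hpm⟩ := hEc.exists_isMinOn hne
        (f := fun p : X × X => |z p.1 - z p.2|) (by fun_prop)
      refine ⟨|z p.1 - z p.2|, ?_, fun x y hxy hd => ?_⟩
      · rw [gt_iff_lt, abs_pos, sub_ne_zero]
        intro heq
        have hp' : dist p.1 p.2 = δ := hp
        have := hδinj _ _ heq (by rw [hp']; linarith)
        rw [this, dist_self] at hp'
        exact hδpos.ne hp'
      · exact absurd (hpm (show (x, y) ∈ E from hd)) (not_le.2 hxy)
  obtain ⟨n, hn⟩ := exists_nat_gt (h / η₀)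
  have hnpos : (0 : ℝ) < n := lt_of_le_of_lt (by positivity) hn
  set η := h / n with hηdef
  have hηpos : 0 < η := by positivity
  have hηlt : η < η₀ := by
    rw [hηdef, div_lt_iff₀ hnpos]
    rw [div_lt_iff₀ hη₀] at hn
    linarith
  have hz0 : ∀ x, 0 ≤ z x := fun x => (hrange ▸ mem_range_self x : z x ∈ Icc 0 h).1
  have hzh : ∀ x, z x ≤ h := fun x => (hrange ▸ mem_range_self x : z x ∈ Icc 0 h).2
  -- An arc J is grown from the bottom in steps of height η. It is open except possibly at its top
  -- point a, near which it contains everything not higher than a; this lets the next slab piece be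
  -- attached at a.
  have key : ∀ k : ℕ, k ≤ n → ∃ J : Set X, IsClosed J ∧ J ⊆ {x | z x ≤ k * η} ∧ InjOn z J ∧
      IsOpen (J ∩ {x | z x < k * η}) ∧ ∃ a ∈ J, z a = k * η ∧ ∃ O ∈ 𝓝 a,
        O ∩ {x | z x ≤ k * η} ⊆ J := by
    intro k
    induction k with
    | zero =>
      intro _
      obtain ⟨a, ha⟩ : ∃ a, z a = 0 := by
        have : (0 : ℝ) ∈ range z := hrange ▸ ⟨le_rfl, hh.le⟩
        exact this
      refine ⟨{a}, isClosed_singleton, by simp [ha], by simp, ?_, a, rfl, by simp [ha],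
        ball a δ₀, ball_mem_nhds a hδ₀, ?_⟩
      · convert isOpen_empty
        ext x
        simp only [mem_inter_iff, mem_singleton_iff, mem_ofPred_eq, mem_empty_iff_false, iff_false]
        rintro ⟨rfl, hx⟩
        simp [ha] at hx
      · rintro x ⟨hx1, hx2⟩
        refine hδinj x a ?_ hx1
        rw [ha]
        refine le_antisymm ?_ (hz0 x)
        simpa using hx2
    | succ k ih =>
      intro hk
      obtain ⟨J, hJc, hJz, hJi, hJo, a, haJ, haz, O, hO, hOJ⟩ := ih (by omega)
      push_cast
      set y := (k : ℝ) * η with hy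
      have hy1 : ((k : ℝ) + 1) * η = y + η := by ring
      rw [hy1]
      have hyh : y + η ≤ h := by
        have : ((k + 1 : ℕ) : ℝ) ≤ n := by exact_mod_cast hk
        push_cast at this
        calc y + η = ((k : ℝ) + 1) * η := hy1.symm
          _ ≤ n * η := by gcongr
          _ = h := by rw [hηdef]; field_simp
      set Q := {x | y ≤ z x ∧ z x ≤ y + η ∧ dist x a ≤ δ} with hQ
      have hQball : ∀ x ∈ Q, dist x a < δ := by
        rintro x ⟨h1, h2, h3⟩
        refine lt_of_le_of_ne h3 (hη x a ?_)
        rw [haz, abs_lt]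
        constructor <;> linarith
      have hQc : IsClosed Q :=
        (isClosed_le continuous_const hz).inter ((isClosed_le hz continuous_const).inter
          (isClosed_le (continuous_id.dist continuous_const) continuous_const))
      have haQ : a ∈ Q := ⟨haz.ge, by rw [haz]; linarith, by rw [dist_self]; exact hδpos.le⟩
      have hQi : InjOn z Q := by
        intro x hx x' hx' hxx'
        refine hδinj x x' hxx' ?_
        have h1 := hQball x hx
        have h2 := hQball x' hx'
        have h3 := dist_triangle_right x x' a
        linarith
      have hJQ : ∀ x ∈ J, ∀ x' ∈ Q, z x = z x' → x = x' := by
        intro x hx x' hx' hxx'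
        have h1 : z x ≤ y := hJz hx
        have h2 : z x = z a := by rw [haz]; exact le_antisymm h1 (hxx' ▸ hx'.1)
        rw [hJi hx haJ h2]
        exact hQi haQ hx' (by rw [← hxx', h2])
      have hJ'i : InjOn z (J ∪ Q) := by
        rintro x (hx | hx) x' (hx' | hx') hxx'
        · exact hJi hx hx' hxx'
        · exact hJQ x hx x' hx' hxx'
        · exact (hJQ x' hx' x hx hxx'.symm).symm
        · exact hQi hx hx' hxx'
      have hJ'o : IsOpen ((J ∪ Q) ∩ {x | z x < y + η}) := by
        rw [isOpen_iff_mem_nhds]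
        rintro x ⟨hx, hxy⟩
        have hxy' : z x < y + η := hxy
        rcases lt_trichotomy (z x) y with hlt | heq | hgt
        · have hxJ : x ∈ J := hx.resolve_right fun hQ' => absurd hQ'.1 (not_le.2 hlt)
          refine mem_of_superset (hJo.mem_nhds ⟨hxJ, hlt⟩) ?_
          rintro w ⟨hw, hw'⟩
          have hw'' : z w < y := hw'
          exact ⟨Or.inl hw, by change z w < y + η; linarith⟩
        · have hxa : x = a := hJ'i hx (Or.inl haJ) (by rw [heq, haz])
          subst hxa
          have hlt : {w | z w < y + η} ∈ 𝓝 x :=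
            (isOpen_lt hz continuous_const).mem_nhds hxy
          filter_upwards [hO, ball_mem_nhds x hδpos, hlt] with w hw1 hw2 hw3
          refine ⟨?_, hw3⟩
          rcases le_total (z w) y with hwy | hwy
          · exact Or.inl (hOJ ⟨hw1, hwy⟩)
          · exact Or.inr ⟨hwy, le_of_lt hw3, le_of_lt hw2⟩
        · have hxQ : x ∈ Q := hx.resolve_left fun hJ' => absurd (hJz hJ') (not_le.2 hgt)
          have h1 : {w | z w < y + η} ∈ 𝓝 x := (isOpen_lt hz continuous_const).mem_nhds hxy
          have h2 : {w | y < z w} ∈ 𝓝 x := (isOpen_lt continuous_const hz).mem_nhds hgt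
          have h3 : ball a δ ∈ 𝓝 x := isOpen_ball.mem_nhds (hQball x hxQ)
          filter_upwards [h1, h2, h3] with w hw1 hw2 hw3
          exact ⟨Or.inr ⟨le_of_lt hw2, le_of_lt hw1, le_of_lt hw3⟩, hw1⟩
      have hJ'z : J ∪ Q ⊆ {x | z x ≤ y + η} := by
        rintro x (hx | hx)
        · have : z x ≤ y := hJz hx
          change z x ≤ y + η
          linarith
        · exact hx.2.1
      -- If the arc did not reach the next level it would be clopen, hence everything, although the
      -- height h is attained.
      obtain ⟨a', ha', hza'⟩ : ∃ a' ∈ J ∪ Q, z a' = y + η := by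
        by_contra! hno
        have heq : (J ∪ Q) ∩ {x | z x < y + η} = J ∪ Q :=
          inter_eq_left.2 fun x hx => lt_of_le_of_ne (hJ'z hx) (hno x hx)
        rw [heq] at hJ'o
        have huniv : J ∪ Q = univ :=
          IsClopen.eq_univ ⟨hJc.union hQc, hJ'o⟩ ⟨a, Or.inl haJ⟩
        obtain ⟨b, hb⟩ : h ∈ range z := hrange ▸ ⟨hh.le, le_rfl⟩
        have hbJ : b ∈ J ∪ Q := huniv ▸ mem_univ b
        have h1 : z b ≤ y + η := hJ'z hbJ
        exact hno b hbJ (le_antisymm h1 (by rw [hb]; exact hyh))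
      have ha'Q : a' ∈ Q := ha'.resolve_left fun hJ' => by
        have : z a' ≤ y := hJz hJ'
        linarith
      refine ⟨J ∪ Q, hJc.union hQc, hJ'z, hJ'i, hJ'o, a', ha', hza', ball a δ ∩ {w | y < z w},
        inter_mem (isOpen_ball.mem_nhds (hQball a' ha'Q))
          ((isOpen_lt continuous_const hz).mem_nhds (by change y < z a'; linarith)), ?_⟩
      rintro w ⟨⟨hw1, hw2⟩, hw3⟩
      exact Or.inr ⟨le_of_lt hw2, hw3, le_of_lt hw1⟩
  obtain ⟨J, hJc, -, hJi, hJo, a, haJ, haz, O, hO, hOJ⟩ := key n le_rfl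
  have hnη : (n : ℝ) * η = h := by rw [hηdef]; field_simp
  rw [hnη] at hJo haz hOJ
  have hJopen : IsOpen J := by
    rw [isOpen_iff_mem_nhds]
    intro x hx
    rcases (hzh x).lt_or_eq with hlt | heq
    · exact mem_of_superset (hJo.mem_nhds ⟨hx, hlt⟩) inter_subset_left
    · have hxa : x = a := hJi hx haJ (by rw [heq, haz])
      subst hxa
      exact mem_of_superset hO fun w hw => hOJ ⟨hw, hzh w⟩
  have huniv : J = univ := IsClopen.eq_univ ⟨hJc, hJopen⟩ ⟨a, haJ⟩
  rwa [huniv, injOn_univ] at hJi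

/-! ### Proper local homeomorphisms onto an interval -/

/-- A proper local homeomorphism onto an interval with one one-point fibre is injective. -/
theorem proper_local_homeo_interval {X : Type*} [TopologicalSpace X] [T2Space X] {p : X → ℝ}
    (hp : Continuous p) {r : ℝ} (hr : 0 < r) (hpr : ∀ x, |p x| < r) (hopen : IsOpenMap p)
    (hinj : ∀ x, ∃ N ∈ 𝓝 x, InjOn p N) (hprop : ∀ s < r, IsCompact {x | |p x| ≤ s})
    (h0 : ∃! x, p x = 0) :
    Function.Injective p ∧ range p = Ioo (-r) r ∧ IsPreconnected (univ : Set X) := by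
  have hmid : ∀ y ∈ Ioo (-r) r, ∃ s, s < r ∧ |y| < s := by
    intro y hy
    obtain ⟨s, hs1, hs2⟩ := exists_between (abs_lt.2 hy)
    exact ⟨s, hs2, hs1⟩
  have hrange : range p = Ioo (-r) r := by
    refine Subset.antisymm ?_ ?_
    · rintro _ ⟨x, rfl⟩
      exact abs_lt.1 (hpr x)
    -- The range is open since p is open, and relatively closed in the interval since p is proper.
    · refine isPreconnected_Ioo.subset_of_closure_inter_subset hopen.isOpen_range ?_ ?_
      · obtain ⟨x, hx, -⟩ := h0
        exact ⟨0, ⟨by linarith, hr⟩, x, hx⟩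
      · rintro y ⟨hy, hy'⟩
        obtain ⟨s, hs, hys⟩ := hmid y hy'
        have hcl : IsClosed (p '' {x | |p x| ≤ s}) := ((hprop s hs).image hp).isClosed
        have : y ∈ closure (p '' {x | |p x| ≤ s}) := by
          rw [_root_.mem_closure_iff] at hy ⊢
          intro o ho hyo
          obtain ⟨w, ⟨hwo, hws⟩, x, rfl⟩ := hy (o ∩ {w | |w| < s})
            (ho.inter (isOpen_lt continuous_abs continuous_const)) ⟨hyo, hys⟩
          have hws' : |p x| < s := hws
          exact ⟨p x, hwo, x, hws'.le, rfl⟩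
        rw [hcl.closure_eq] at this
        exact image_subset_range _ _ this
  have hI : Function.Injective p := by
    -- D is closed by local injectivity. The set I of values attained twice is open because p is
    -- open, and relatively closed because p is proper; as it misses 0, it is empty.
    set D : Set (X × X) := {q | p q.1 = p q.2 ∧ q.1 ≠ q.2} with hD
    have hDc : IsClosed D := by
      rw [← isOpen_compl_iff, isOpen_iff_mem_nhds]
      rintro ⟨x, y⟩ hxy
      by_cases hpe : p x = p y
      · have hxy' : x = y := by
          by_contra hne
          exact hxy ⟨hpe, hne⟩
        subst hxy'
        obtain ⟨N, hN, hNi⟩ := hinj x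
        refine mem_of_superset (prod_mem_nhds hN hN) ?_
        rintro ⟨a, b⟩ ⟨ha, hb⟩ ⟨hab, hne⟩
        exact hne (hNi ha hb hab)
      · have : IsOpen {q : X × X | p q.1 ≠ p q.2} :=
          isOpen_ne_fun (hp.comp continuous_fst) (hp.comp continuous_snd)
        exact mem_of_superset (this.mem_nhds hpe) fun q hq hq' => hq hq'.1
    set I := (fun q : X × X => p q.1) '' D with hIdef
    have hIo : IsOpen I := by
      rw [isOpen_iff_mem_nhds]
      rintro _ ⟨⟨x, y⟩, ⟨hxy, hne⟩, rfl⟩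
      obtain ⟨U, V, hU, hV, hxU, hyV, hUV⟩ := t2_separation hne
      have h1 : p '' U ∈ 𝓝 (p x) := hopen.image_mem_nhds (hU.mem_nhds hxU)
      have h2 : p '' V ∈ 𝓝 (p x) := by
        have hxy' : p x = p y := hxy
        rw [hxy']
        exact hopen.image_mem_nhds (hV.mem_nhds hyV)
      filter_upwards [h1, h2]
      rintro s ⟨x', hx', rfl⟩ ⟨y', hy', hxy'⟩
      refine ⟨(x', y'), ⟨hxy'.symm, fun he => ?_⟩, rfl⟩
      have he' : x' = y' := he
      exact Set.disjoint_left.1 hUV hx' (he' ▸ hy')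
    by_contra hni
    have hne : (Ioo (-r) r ∩ I).Nonempty := by
      simp only [Function.Injective, not_forall] at hni
      obtain ⟨x, y, hxy, hne⟩ := hni
      exact ⟨p x, abs_lt.1 (hpr x), (x, y), ⟨hxy, hne⟩, rfl⟩
    have hsub : Ioo (-r) r ⊆ I := by
      refine isPreconnected_Ioo.subset_of_closure_inter_subset hIo hne ?_
      rintro y ⟨hy, hy'⟩
      obtain ⟨s, hs, hys⟩ := hmid y hy'
      have hc : IsCompact (D ∩ ({x | |p x| ≤ s} ×ˢ {x | |p x| ≤ s})) :=
        ((hprop s hs).prod (hprop s hs)).inter_left hDc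
      have hcl := (hc.image (hp.comp continuous_fst)).isClosed
      have : y ∈ closure ((p ∘ Prod.fst) '' (D ∩ ({x | |p x| ≤ s} ×ˢ {x | |p x| ≤ s}))) := by
        rw [_root_.mem_closure_iff] at hy ⊢
        intro o ho hyo
        obtain ⟨w, ⟨hwo, hws⟩, ⟨x, x'⟩, hxx', rfl⟩ := hy (o ∩ {w | |w| < s})
          (ho.inter (isOpen_lt continuous_abs continuous_const)) ⟨hyo, hys⟩
        have h1 : |p x| < s := hws
        have h2 : p x = p x' := hxx'.1
        exact ⟨p x, hwo, (x, x'), ⟨hxx', h1.le, by change |p x'| ≤ s; rw [← h2]; exact h1.le⟩, rfl⟩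
      rw [hcl.closure_eq] at this
      obtain ⟨q, hq, rfl⟩ := this
      exact ⟨q, hq.1, rfl⟩
    obtain ⟨⟨x, y⟩, ⟨hxy, hne'⟩, hx0⟩ := hsub ⟨by linarith, hr⟩
    have hx0' : p x = 0 := hx0
    have hxy' : p x = p y := hxy
    exact hne' (h0.unique hx0' (hxy' ▸ hx0'))
  refine ⟨hI, hrange, ?_⟩
  have := (isPreconnected_Ioo (a := -r) (b := r)).preimage_of_isOpenMap hI hopen hrange.ge
  rwa [← hrange, preimage_range] at this

/-! ### Lifting angles on a disk -/

/-- A nowhere vanishing continuous function on a closed disk has a continuous argument. -/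
theorem exists_continuousOn_arg {K : Set Plane} (e : closedBall (0 : Plane) 1 ≃ₜ K)
    {g : Plane → ℂ} (hg : ContinuousOn g K) (hg0 : ∀ x ∈ K, g x ≠ 0) :
    ∃ ψ : Plane → ℝ, ContinuousOn ψ K ∧ ∀ x ∈ K, g x = ‖g x‖ * Complex.exp (ψ x * Complex.I) := by
  have hgK : Continuous fun x : K => g x := continuousOn_iff_continuous_domRestrict.1 hg
  let c : closedBall (0 : Plane) 1 → Circle := fun y =>
    ⟨g (e y) / ‖g (e y)‖, by
      refine mem_sphere_zero_iff_norm.2 ?_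
      rw [norm_div, Complex.norm_real, norm_norm,
        div_self (norm_ne_zero_iff.2 (hg0 _ (e y).2))]⟩
  have hc : Continuous c := by
    refine Continuous.subtype_mk ?_ _
    have h1 : Continuous fun y : closedBall (0 : Plane) 1 => g (e y) := hgK.comp e.continuous
    refine h1.div (Complex.continuous_ofReal.comp h1.norm) fun y => ?_
    exact Complex.ofReal_ne_zero.2 (norm_ne_zero_iff.2 (hg0 _ (e y).2))
  have hmem : ∀ (t : unitInterval) (y : closedBall (0 : Plane) 1),
      (t : ℝ) • (y : Plane) ∈ closedBall (0 : Plane) 1 := by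
    intro t y
    rw [mem_closedBall_zero_iff, norm_smul, Real.norm_eq_abs, abs_of_nonneg t.2.1]
    have := mem_closedBall_zero_iff.1 y.2
    exact mul_le_one₀ t.2.2 (norm_nonneg _) this
  -- The radial contraction of the disk deforms the unit direction from its value at the centre.
  -- This homotopy is lifted through the covering ℝ → S¹, and the lift at time 1 is the argument.
  let H : C(unitInterval × closedBall (0 : Plane) 1, Circle) :=
    ⟨fun p => c ⟨(p.1 : ℝ) • (p.2 : Plane), hmem p.1 p.2⟩, by
      refine hc.comp (Continuous.subtype_mk ?_ _)
      fun_prop⟩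
  let o : closedBall (0 : Plane) 1 := ⟨0, by simp⟩
  obtain ⟨b, hb⟩ := Circle.isAddQuotientCoveringMap_exp.surjective (c o)
  have H0 : ∀ y, H (0, y) = Circle.exp ((ContinuousMap.const _ b : C(_, ℝ)) y) := by
    intro y
    change c _ = Circle.exp b
    rw [hb]
    congr 1
    ext1
    simp [o]
  let L := Circle.isCoveringMap_exp.liftHomotopy H (ContinuousMap.const _ b) H0
  have hL : ∀ y, Circle.exp (L (1, y)) = c y := by
    intro y
    have := congrFun (Circle.isCoveringMap_exp.liftHomotopy_lifts H (ContinuousMap.const _ b) H0)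
      (1, y)
    refine Eq.trans this ?_
    change c _ = c y
    congr 1
    ext1
    simp
  classical
  refine ⟨fun x => if hx : x ∈ K then L (1, e.symm ⟨x, hx⟩) else 0, ?_, ?_⟩
  · rw [continuousOn_iff_continuous_domRestrict]
    have h1 : Continuous fun x : K => L (1, e.symm x) :=
      L.continuous.comp (Continuous.prodMk continuous_const e.symm.continuous)
    refine h1.congr fun x => ?_
    simp [Set.domRestrict]
  · intro x hx
    have h1 := hL (e.symm ⟨x, hx⟩)
    have h2 : (Circle.exp (L (1, e.symm ⟨x, hx⟩)) : ℂ) = g x / ‖g x‖ := by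
      rw [h1]
      simp [c]
    rw [Circle.coe_exp] at h2
    simp only [dif_pos hx]
    rw [h2, mul_div_cancel₀]
    exact Complex.ofReal_ne_zero.2 (norm_ne_zero_iff.2 (hg0 x hx))

/-! ### A covering criterion -/

/-- The angle increases along a connected set in a half plane from its lower to its upper end. -/
theorem angle_lt_of_isPreconnected {Y : Type*} [TopologicalSpace Y] {S : Set Y}
    (hS : IsPreconnected S) {t : Y → ℝ} (ht : ContinuousOn t S) {P Q : Y} (hP : P ∈ S)
    (hQ : Q ∈ S) (hsP : Real.sin (t P) = 1) (hsQ : Real.sin (t Q) = -1)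
    (hcos : ∀ x ∈ S, Real.cos (t x) ≤ 0) : t P < t Q := by
  by_contra hle
  have hlt : t Q < t P := lt_of_le_of_ne (not_lt.1 hle) fun he => by
    rw [he, hsP] at hsQ; norm_num at hsQ
  have hcP : Real.cos (t P) = 0 := by
    have := Real.sin_sq_add_cos_sq (t P)
    rw [hsP] at this
    nlinarith
  have hint := (hS.image t ht).ordConnected.out (mem_image_of_mem t hQ) (mem_image_of_mem t hP)
  set ε := min (t P - t Q) 1 with hε
  have hε0 : 0 < ε := lt_min (by linarith) one_pos
  have hε1 : ε ≤ 1 := min_le_right _ _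
  have hεle : ε ≤ t P - t Q := min_le_left _ _
  -- At the angle t P - ε the cosine is sin ε, which is positive.
  obtain ⟨x, hx, hxt⟩ := hint (show t P - ε ∈ Icc (t Q) (t P) from ⟨by linarith, by linarith⟩)
  have h1 := hcos x hx
  rw [hxt, Real.cos_sub, hcP, hsP] at h1
  have h2 : 0 < Real.sin ε := Real.sin_pos_of_pos_of_le_one hε0 hε1
  linarith

theorem angle_gt_of_isPreconnected {Y : Type*} [TopologicalSpace Y] {S : Set Y}
    (hS : IsPreconnected S) {t : Y → ℝ} (ht : ContinuousOn t S) {P Q : Y} (hP : P ∈ S)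
    (hQ : Q ∈ S) (hsP : Real.sin (t P) = 1) (hsQ : Real.sin (t Q) = -1)
    (hcos : ∀ x ∈ S, 0 ≤ Real.cos (t x)) : t Q < t P := by
  have := angle_lt_of_isPreconnected hS (t := fun x => t x + Real.pi)
    (ht.add continuousOn_const) hQ hP (by rw [Real.sin_add_pi, hsQ, neg_neg])
    (by rw [Real.sin_add_pi, hsP]) (fun x hx => by rw [Real.cos_add_pi]; linarith [hcos x hx])
  linarith

/-- The unit circle in the parameter plane. -/
noncomputable def unitCircle (t : ℝ) : Plane := !₂[Real.cos t, Real.sin t]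

theorem unitCircle_mem_sphere (t : ℝ) : unitCircle t ∈ sphere (0 : Plane) 1 := by
  rw [mem_sphere_zero_iff_norm, EuclideanSpace.norm_eq]
  simp [unitCircle]

theorem continuous_unitCircle : Continuous unitCircle := by
  unfold unitCircle
  fun_prop

theorem exists_unitCircle_eq {y : Plane} (hy : y ∈ sphere (0 : Plane) 1) (a : ℝ) :
    ∃ t ∈ Ico a (a + 2 * Real.pi), unitCircle t = y := by
  have hy1 : y 0 ^ 2 + y 1 ^ 2 = 1 := by
    have h1 := mem_sphere_zero_iff_norm.1 hy
    have h2 := EuclideanSpace.norm_sq_eq y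
    rw [h1] at h2
    simpa using h2.symm
  set w : ℂ := ⟨y 0, y 1⟩ with hw
  have hnw : ‖w‖ = 1 := by
    have : ‖w‖ ^ 2 = 1 := by
      rw [← Complex.normSq_eq_norm_sq, Complex.normSq_mk]
      linarith
    nlinarith [norm_nonneg w]
  have hw0 : w ≠ 0 := by rw [← norm_ne_zero_iff, hnw]; exact one_ne_zero
  have hper : Function.Periodic unitCircle (2 * Real.pi) := fun t => by
    simp [unitCircle]
  obtain ⟨t, ht, heq⟩ := hper.exists_mem_Ico Real.two_pi_pos (Complex.arg w) a
  refine ⟨t, ht, ?_⟩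
  rw [← heq]
  ext i
  fin_cases i
  · have := Complex.cos_arg hw0
    rw [hnw, div_one] at this
    simpa [unitCircle] using this
  · have := Complex.sin_arg w
    rw [hnw, div_one] at this
    simpa [unitCircle] using this

theorem unitCircle_injOn {a s t : ℝ} (hs : s ∈ Ico a (a + 2 * Real.pi))
    (ht : t ∈ Ico a (a + 2 * Real.pi)) (h : unitCircle s = unitCircle t) : s = t := by
  have h0 : Real.cos s = Real.cos t := by simpa [unitCircle] using congrArg (fun y : Plane => y 0) h
  have h1 : Real.sin s = Real.sin t := by simpa [unitCircle] using congrArg (fun y : Plane => y 1) h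
  have h2 : Real.cos (s - t) = 1 := by
    rw [Real.cos_sub, h0, h1]
    have := Real.sin_sq_add_cos_sq t
    nlinarith
  have := (Real.cos_eq_one_iff_of_lt_of_lt (by linarith [hs.1, ht.2])
    (by linarith [hs.2, ht.1])).1 h2
  linarith

/-- The boundary of a disk is a union of two arcs with given distinct endpoints. -/
theorem exists_boundary_arcs {K : Set Plane} (e : closedBall (0 : Plane) 1 ≃ₜ K)
    (he : ∀ x, (e x : Plane) ∈ frontier K ↔ (x : Plane) ∈ sphere (0 : Plane) 1)
    {P Q : Plane} (hPK : P ∈ K) (hQK : Q ∈ K) (hP : P ∈ frontier K) (hQ : Q ∈ frontier K)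
    (hPQ : P ≠ Q) :
    ∃ S T : Set Plane, IsPreconnected S ∧ IsPreconnected T ∧ S ⊆ (K ∩ frontier K) \ {P, Q} ∧
      T ⊆ (K ∩ frontier K) \ {P, Q} ∧ IsPreconnected (insert P (insert Q S)) ∧
      IsPreconnected (insert P (insert Q T)) ∧ K ∩ frontier K ⊆ S ∪ T ∪ {P, Q} := by
  let γ : ℝ → Plane := fun t => e ⟨unitCircle t, sphere_subset_closedBall (unitCircle_mem_sphere t)⟩
  have hγ : Continuous γ := continuous_subtype_val.comp
    (e.continuous.comp (continuous_unitCircle.subtype_mk _))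
  have hγK : ∀ t, γ t ∈ K := fun t => (e _).2
  have hγf : ∀ t, γ t ∈ frontier K := fun t => (he _).2 (unitCircle_mem_sphere t)
  have hsurj : ∀ x ∈ K, x ∈ frontier K → ∀ a, ∃ t ∈ Ico a (a + 2 * Real.pi), γ t = x := by
    intro x hx hxf a
    have h1 : ((e.symm ⟨x, hx⟩ : closedBall (0 : Plane) 1) : Plane) ∈ sphere (0 : Plane) 1 := by
      rw [← he]
      simpa using hxf
    obtain ⟨t, ht, hte⟩ := exists_unitCircle_eq h1 a
    refine ⟨t, ht, ?_⟩
    have : (⟨unitCircle t, sphere_subset_closedBall (unitCircle_mem_sphere t)⟩ :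
        closedBall (0 : Plane) 1) = e.symm ⟨x, hx⟩ := Subtype.ext hte
    simp only [γ, this]
    simp
  have hinj : ∀ a s t, s ∈ Ico a (a + 2 * Real.pi) → t ∈ Ico a (a + 2 * Real.pi) → γ s = γ t →
      s = t := by
    intro a s t hs ht hst
    have h1 := e.injective (Subtype.ext hst)
    exact unitCircle_injOn hs ht (congrArg Subtype.val h1)
  have hper : ∀ t, γ (t + 2 * Real.pi) = γ t := fun t => by
    simp [γ, unitCircle]
  -- The arcs are the images of (a, b) and (b, a + 2π), where a and b are parameters of P and Q.
  obtain ⟨a, -, haP⟩ := hsurj P hPK hP 0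
  obtain ⟨b, hb, hbQ⟩ := hsurj Q hQK hQ a
  have hab : a < b := lt_of_le_of_ne hb.1 fun h => hPQ (by rw [← haP, ← hbQ, h])
  have hbc : b < a + 2 * Real.pi := hb.2
  have hnot : ∀ t, t ∈ Ico a (a + 2 * Real.pi) → t ≠ a → t ≠ b → γ t ∉ ({P, Q} : Set Plane) := by
    rintro t ht h1 h2 (h | h)
    · exact h1 (hinj a t a ht ⟨le_rfl, by linarith⟩ (by rw [haP]; exact h))
    · exact h2 (hinj a t b ht hb (by rw [hbQ]; exact h))
  refine ⟨γ '' Ioo a b, γ '' Ioo b (a + 2 * Real.pi), isPreconnected_Ioo.image _ hγ.continuousOn,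
    isPreconnected_Ioo.image _ hγ.continuousOn, ?_, ?_, ?_, ?_, ?_⟩
  · rintro _ ⟨t, ht, rfl⟩
    exact ⟨⟨hγK t, hγf t⟩, hnot t ⟨ht.1.le, ht.2.trans hbc⟩ ht.1.ne' ht.2.ne⟩
  · rintro _ ⟨t, ht, rfl⟩
    exact ⟨⟨hγK t, hγf t⟩, hnot t ⟨(hab.trans ht.1).le, ht.2⟩ (hab.trans ht.1).ne' ht.1.ne'⟩
  · have : insert P (insert Q (γ '' Ioo a b)) = γ '' Icc a b := by
      rw [← Ico_insert_right hab.le, ← Ioo_insert_left hab]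
      simp only [image_insert_eq, haP, hbQ]
      rw [insert_comm]
    rw [this]
    exact isPreconnected_Icc.image _ hγ.continuousOn
  · have : insert P (insert Q (γ '' Ioo b (a + 2 * Real.pi))) = γ '' Icc b (a + 2 * Real.pi) := by
      rw [← Ico_insert_right hbc.le, ← Ioo_insert_left hbc]
      simp only [image_insert_eq, haP, hbQ, hper]
    rw [this]
    exact isPreconnected_Icc.image _ hγ.continuousOn
  · rintro x ⟨hx, hxf⟩
    obtain ⟨t, ht, rfl⟩ := hsurj x hx hxf a
    rcases ht.1.eq_or_lt with rfl | h1
    · right; rw [haP]; exact Or.inl rfl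
    · rcases lt_trichotomy t b with h2 | rfl | h2
      · exact Or.inl (Or.inl ⟨t, ⟨h1, h2⟩, rfl⟩)
      · right; rw [hbQ]; exact Or.inr rfl
      · exact Or.inl (Or.inr ⟨t, ⟨h2, ht.2⟩, rfl⟩)

theorem IsPreconnected.lt_or_gt_of_ne {Y : Type*} [TopologicalSpace Y] {S : Set Y}
    (hS : IsPreconnected S) {a : Y → ℝ} (ha : ContinuousOn a S) {c : ℝ} (hne : ∀ x ∈ S, a x ≠ c) :
    (∀ x ∈ S, a x < c) ∨ ∀ x ∈ S, c < a x := by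
  by_contra! h
  obtain ⟨⟨x, hx, hxc⟩, y, hy, hyc⟩ := h
  obtain ⟨w, hw, hwc⟩ := (hS.image a ha).ordConnected.out (mem_image_of_mem a hy)
    (mem_image_of_mem a hx) ⟨hyc, hxc⟩
  exact hne w hw hwc

/-- A map of a disk to the plane takes the value `(c, d)` if exactly two boundary points lie on
the vertical line through it, one above and one below, and the boundary crosses that line. -/
theorem exists_eq_of_boundary_crossing {K : Set Plane} (e : closedBall (0 : Plane) 1 ≃ₜ K)
    (he : ∀ x, (e x : Plane) ∈ frontier K ↔ (x : Plane) ∈ sphere (0 : Plane) 1)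
    {a b : Plane → ℝ} (ha : ContinuousOn a K) (hb : ContinuousOn b K) {c d : ℝ} {P Q : Plane}
    (hPK : P ∈ K) (hQK : Q ∈ K) (hP : P ∈ frontier K) (hQ : Q ∈ frontier K)
    (haP : a P = c) (haQ : a Q = c) (hbP : d < b P) (hbQ : b Q < d)
    (honly : ∀ x ∈ K, x ∈ frontier K → a x = c → x = P ∨ x = Q)
    (hlt : ∃ x ∈ K, x ∈ frontier K ∧ a x < c) (hgt : ∃ x ∈ K, x ∈ frontier K ∧ c < a x) :
    ∃ x ∈ K, a x = c ∧ b x = d := by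
  -- If (c, d) is missed, the vector (a - c, b - d) has a continuous argument ψ on K. Going from P
  -- (pointing up) to Q (pointing down) through the left half plane gives ψ P < ψ Q, through the
  -- right one ψ Q < ψ P. The two boundary arcs do both.
  by_contra! hno
  have hPQ : P ≠ Q := fun h => by rw [h] at hbP; linarith
  obtain ⟨ψ, hψ, hψe⟩ := exists_continuousOn_arg e
    (g := fun x => ((a x - c : ℝ) : ℂ) + ((b x - d : ℝ) : ℂ) * Complex.I)
    (by
      refine ContinuousOn.add ?_ (ContinuousOn.mul ?_ continuousOn_const)
      · exact Complex.continuous_ofReal.comp_continuousOn (ha.sub continuousOn_const)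
      · exact Complex.continuous_ofReal.comp_continuousOn (hb.sub continuousOn_const))
    (fun x hx h0 => by
      have h1 := congrArg Complex.re h0
      have h2 := congrArg Complex.im h0
      simp at h1 h2
      exact hno x hx (by linarith) (by linarith))
  have hpolar : ∀ x ∈ K, ∃ ρ : ℝ, 0 < ρ ∧ a x - c = ρ * Real.cos (ψ x) ∧
      b x - d = ρ * Real.sin (ψ x) := by
    intro x hx
    have h := hψe x hx
    set n := ‖((a x - c : ℝ) : ℂ) + ((b x - d : ℝ) : ℂ) * Complex.I‖ with hn
    have h1 := congrArg Complex.re h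
    have h2 := congrArg Complex.im h
    rw [Complex.re_ofReal_mul, Complex.exp_ofReal_mul_I_re] at h1
    rw [Complex.im_ofReal_mul, Complex.exp_ofReal_mul_I_im] at h2
    simp at h1 h2
    refine ⟨n, ?_, h1, h2⟩
    refine lt_of_le_of_ne (norm_nonneg _) fun h0 => ?_
    rw [← h0] at h1 h2
    exact hno x hx (by linarith) (by linarith)
  have hsP : Real.sin (ψ P) = 1 := by
    obtain ⟨ρ, hρ, h1, h2⟩ := hpolar P hPK
    have hc : Real.cos (ψ P) = 0 := by
      rw [haP, sub_self] at h1
      exact (mul_eq_zero.1 h1.symm).resolve_left hρ.ne'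
    have hs : 0 < Real.sin (ψ P) := by
      have : 0 < ρ * Real.sin (ψ P) := by rw [← h2]; linarith
      exact pos_of_mul_pos_right this hρ.le
    have := Real.sin_sq_add_cos_sq (ψ P)
    rw [hc] at this
    nlinarith
  have hsQ : Real.sin (ψ Q) = -1 := by
    obtain ⟨ρ, hρ, h1, h2⟩ := hpolar Q hQK
    have hc : Real.cos (ψ Q) = 0 := by
      rw [haQ, sub_self] at h1
      exact (mul_eq_zero.1 h1.symm).resolve_left hρ.ne'
    have hs : Real.sin (ψ Q) < 0 := by
      by_contra h0
      have : 0 ≤ ρ * Real.sin (ψ Q) := mul_nonneg hρ.le (not_lt.1 h0)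
      rw [← h2] at this
      linarith
    have := Real.sin_sq_add_cos_sq (ψ Q)
    rw [hc] at this
    nlinarith
  obtain ⟨S, T, hS, hT, hSK, hTK, hSc, hTc, hcov⟩ :=
    exists_boundary_arcs e he hPK hQK hP hQ hPQ
  have hsign : ∀ U : Set Plane, IsPreconnected U → U ⊆ (K ∩ frontier K) \ {P, Q} →
      (∀ x ∈ U, a x < c) ∨ ∀ x ∈ U, c < a x := by
    intro U hU hUK
    refine IsPreconnected.lt_or_gt_of_ne hU (ha.mono fun x hx => (hUK hx).1.1) fun x hx hxc => ?_
    exact (hUK hx).2 (honly x (hUK hx).1.1 (hUK hx).1.2 hxc)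
  have hsub : ∀ U : Set Plane, U ⊆ (K ∩ frontier K) \ {P, Q} → insert P (insert Q U) ⊆ K := by
    rintro U hU x (rfl | rfl | hx)
    exacts [hPK, hQK, (hU hx).1.1]
  have hlow : ∀ U : Set Plane, IsPreconnected (insert P (insert Q U)) →
      U ⊆ (K ∩ frontier K) \ {P, Q} → (∀ x ∈ U, a x < c) → ψ P < ψ Q := by
    intro U hU hUK hUc
    refine angle_lt_of_isPreconnected hU (hψ.mono (hsub U hUK)) (mem_insert _ _)
      (mem_insert_of_mem _ (mem_insert _ _)) hsP hsQ fun x hx => ?_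
    obtain ⟨ρ, hρ, h1, -⟩ := hpolar x (hsub U hUK hx)
    have hxc : a x ≤ c := by
      rcases hx with rfl | rfl | hx
      exacts [haP.le, haQ.le, (hUc x hx).le]
    by_contra h0
    have : 0 < ρ * Real.cos (ψ x) := mul_pos hρ (not_le.1 h0)
    linarith
  have hhigh : ∀ U : Set Plane, IsPreconnected (insert P (insert Q U)) →
      U ⊆ (K ∩ frontier K) \ {P, Q} → (∀ x ∈ U, c < a x) → ψ Q < ψ P := by
    intro U hU hUK hUc
    refine angle_gt_of_isPreconnected hU (hψ.mono (hsub U hUK)) (mem_insert _ _)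
      (mem_insert_of_mem _ (mem_insert _ _)) hsP hsQ fun x hx => ?_
    obtain ⟨ρ, hρ, h1, -⟩ := hpolar x (hsub U hUK hx)
    have hxc : c ≤ a x := by
      rcases hx with rfl | rfl | hx
      exacts [haP.ge, haQ.ge, (hUc x hx).le]
    by_contra h0
    have : ρ * Real.cos (ψ x) < 0 := mul_neg_of_pos_of_neg hρ (not_le.1 h0)
    linarith
  obtain ⟨x, hxK, hxf, hxc⟩ := hlt
  obtain ⟨y, hyK, hyf, hyc⟩ := hgt
  have hmem : ∀ w ∈ K, w ∈ frontier K → a w ≠ c → w ∈ S ∨ w ∈ T := by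
    intro w hw hwf hwc
    rcases hcov ⟨hw, hwf⟩ with h | rfl | h
    · exact h
    · exact absurd haP hwc
    · rw [mem_singleton_iff] at h
      exact absurd (h ▸ haQ) hwc
  -- Two arcs on the same side are excluded because the boundary has points on both sides of the
  -- line.
  rcases hsign S hS hSK with h1 | h1 <;> rcases hsign T hT hTK with h2 | h2
  · rcases hmem y hyK hyf hyc.ne' with h | h
    · linarith [h1 y h]
    · linarith [h2 y h]
  · exact lt_asymm (hlow S hSc hSK h1) (hhigh T hTc hTK h2)
  · exact lt_asymm (hlow T hTc hTK h2) (hhigh S hSc hSK h1)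
  · rcases hmem x hxK hxf hxc.ne with h | h
    · linarith [h1 x h]
    · linarith [h2 x h]

/-! ### Charts of the plane given by two functions -/

theorem clm_apply_eq_coord (a : Plane →L[ℝ] ℝ) (v : Plane) :
    a v = v 0 * a (EuclideanSpace.single 0 1) + v 1 * a (EuclideanSpace.single 1 1) := by
  have : v = v 0 • EuclideanSpace.single 0 1 + v 1 • EuclideanSpace.single 1 1 := by
    ext i
    fin_cases i <;> simp
  conv_lhs => rw [this]
  rw [map_add, map_smul, map_smul, smul_eq_mul, smul_eq_mul]

theorem eq_zero_of_det_ne_zero {a : Plane →L[ℝ] ℝ} {v w : Plane} (hv : a v = 0) (hw : a w = 0)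
    (hdet : v 0 * w 1 - v 1 * w 0 ≠ 0) : a = 0 := by
  have h1 := clm_apply_eq_coord a v
  have h2 := clm_apply_eq_coord a w
  rw [hv] at h1
  rw [hw] at h2
  have e0 : a (EuclideanSpace.single 0 1) = 0 := by
    refine (mul_eq_zero.1 (?_ : (v 0 * w 1 - v 1 * w 0) * _ = 0)).resolve_left hdet
    linear_combination -(w 1 * h1) + v 1 * h2
  have e1 : a (EuclideanSpace.single 1 1) = 0 := by
    refine (mul_eq_zero.1 (?_ : (v 0 * w 1 - v 1 * w 0) * _ = 0)).resolve_left hdet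
    linear_combination w 0 * h1 - v 0 * h2
  ext u
  rw [clm_apply_eq_coord a u, e0, e1]
  simp

theorem det_ne_zero_of_apply {a : Plane →L[ℝ] ℝ} {v w : Plane} (hv : a v ≠ 0) (hw : a w = 0)
    (hw0 : w ≠ 0) : v 0 * w 1 - v 1 * w 0 ≠ 0 := by
  intro hdet
  have h1 := clm_apply_eq_coord a v
  have h2 := clm_apply_eq_coord a w
  rw [hw] at h2
  apply hw0
  ext i
  fin_cases i
  · refine (mul_eq_zero.1 (?_ : w 0 * a v = 0)).resolve_right hv
    linear_combination w 0 * h1 - v 0 * h2 - a (EuclideanSpace.single 1 1) * hdet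
  · refine (mul_eq_zero.1 (?_ : w 1 * a v = 0)).resolve_right hv
    linear_combination w 1 * h1 - v 1 * h2 + a (EuclideanSpace.single 0 1) * hdet

theorem exists_ne_zero_apply_eq_zero (a : Plane →L[ℝ] ℝ) : ∃ w : Plane, w ≠ 0 ∧ a w = 0 := by
  by_cases h : a (EuclideanSpace.single 0 1) = 0
  · exact ⟨EuclideanSpace.single 0 1, by simp, h⟩
  · refine ⟨!₂[-a (EuclideanSpace.single 1 1), a (EuclideanSpace.single 0 1)], fun h0 => ?_, ?_⟩
    · exact h (by simpa using congrArg (fun y : Plane => y 1) h0)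
    · rw [clm_apply_eq_coord]
      simp only [Matrix.cons_val_zero, Matrix.cons_val_one]
      ring

/-- Inverse function theorem for a pair of functions on the plane. -/
theorem exists_chart {a b : Plane → ℝ} {a' b' : Plane →L[ℝ] ℝ} {x : Plane}
    (ha : HasStrictFDerivAt a a' x) (hb : HasStrictFDerivAt b b' x)
    (hind : ∀ v, a' v = 0 → b' v = 0 → v = 0) {W : Set Plane} (hW : W ∈ 𝓝 x) :
    ∃ (N : Set Plane) (δ : ℝ), IsOpen N ∧ x ∈ N ∧ N ⊆ W ∧ 0 < δ ∧
      BijOn (fun y => (a y, b y)) N (ball (a x, b x) δ) ∧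
      (∀ O ⊆ N, IsOpen O → IsOpen ((fun y => (a y, b y)) '' O)) ∧
      ∀ C ⊆ ball (a x, b x) δ, IsPreconnected C →
        IsPreconnected (N ∩ (fun y => (a y, b y)) ⁻¹' C) := by
  have hker : (a'.prod b').toLinearMap.ker = ⊥ := by
    rw [LinearMap.ker_eq_bot']
    intro v hv
    have hv' : (a' v, b' v) = (0, 0) := hv
    exact hind v (Prod.ext_iff.1 hv').1 (Prod.ext_iff.1 hv').2
  have hrange : (a'.prod b').toLinearMap.range = ⊤ :=
    (LinearMap.ker_eq_bot_iff_range_eq_top_of_finrank_eq_finrank (by simp)).1 hker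
  let E := ContinuousLinearEquiv.ofBijective (a'.prod b') hker hrange
  have hE : (E : Plane →L[ℝ] ℝ × ℝ) = a'.prod b' := ContinuousLinearEquiv.coe_ofBijective _ _ _
  have hΦ : HasStrictFDerivAt (fun y => (a y, b y)) (E : Plane →L[ℝ] ℝ × ℝ) x := by
    rw [hE]; exact ha.prodMk hb
  let e := hΦ.toOpenPartialHomeomorph (fun y => (a y, b y))
  have hex : x ∈ e.source := hΦ.mem_toOpenPartialHomeomorph_source
  have hecoe : ∀ y, e y = (a y, b y) := fun y => rfl
  have hopen : IsOpen (e '' (e.source ∩ interior W)) :=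
    e.isOpen_image_of_subset_source (e.open_source.inter isOpen_interior) inter_subset_left
  have hmem : (a x, b x) ∈ e '' (e.source ∩ interior W) :=
    ⟨x, ⟨hex, mem_interior_iff_mem_nhds.2 hW⟩, rfl⟩
  -- The chart is cut down to the preimage of a ball, so that convex pieces of the ball pull back to
  -- connected sets.
  obtain ⟨δ, hδ, hball⟩ := Metric.isOpen_iff.1 hopen _ hmem
  have htarget : ball (a x, b x) δ ⊆ e.target := by
    intro p hp
    obtain ⟨y, hy, rfl⟩ := hball hp
    exact e.map_source hy.1
  set N := e.source ∩ e ⁻¹' ball (a x, b x) δ with hN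
  have hNo : IsOpen N := e.isOpen_inter_preimage isOpen_ball
  refine ⟨N, δ, hNo, ⟨hex, mem_ball_self hδ⟩, ?_, hδ, ⟨fun y hy => hy.2, ?_, ?_⟩, ?_, ?_⟩
  · rintro y ⟨hy1, hy2⟩
    obtain ⟨y', hy', hyy'⟩ := hball hy2
    rw [← e.injOn hy'.1 hy1 hyy']
    exact interior_subset hy'.2
  · exact e.injOn.mono inter_subset_left
  · intro p hp
    refine ⟨e.symm p, ⟨e.map_target (htarget hp), ?_⟩, e.right_inv (htarget hp)⟩
    rw [mem_preimage, e.right_inv (htarget hp)]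
    exact hp
  · intro O hON hO
    exact e.isOpen_image_of_subset_source hO fun y hy => (hON hy).1
  · intro C hC hCc
    have : N ∩ (fun y => (a y, b y)) ⁻¹' C = e.symm '' C := by
      ext y
      constructor
      · rintro ⟨hy, hyC⟩
        exact ⟨e y, hyC, e.left_inv hy.1⟩
      · rintro ⟨p, hp, rfl⟩
        have h1 : e (e.symm p) = p := e.right_inv (htarget (hC hp))
        refine ⟨⟨e.map_target (htarget (hC hp)), ?_⟩, ?_⟩
        · rw [mem_preimage, h1]; exact hC hp
        · change e (e.symm p) ∈ C
          rwa [h1]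
    rw [this]
    exact hCc.image _ (e.continuousOn_symm.mono (hC.trans htarget))

theorem mem_nhds_prod_exists_pos {O : Set (ℝ × ℝ)} {s t : ℝ} (hO : O ∈ 𝓝 (s, t)) :
    ∃ ε > 0, ∀ τ, |τ| < ε → (s, t + τ) ∈ O ∧ (s + τ, t) ∈ O := by
  obtain ⟨ε, hε, h⟩ := Metric.mem_nhds_iff.1 hO
  refine ⟨ε, hε, fun τ hτ => ⟨h ?_, h ?_⟩⟩ <;>
  · rw [mem_ball, Prod.dist_eq]
    simp [hτ]

theorem isPreconnected_ball_inter_halfspace {p : ℝ × ℝ} {δ : ℝ} (f : ℝ × ℝ →L[ℝ] ℝ) (c : ℝ) :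
    IsPreconnected (ball p δ ∩ {q | f q < c}) :=
  ((convex_ball p δ).inter (convex_halfSpace_lt f.toLinearMap.isLinear c)).isPreconnected

/-- A domain whose boundary lies locally on a regular curve is locally one side of that curve. -/
theorem eventually_mem_iff_of_frontier_subset {K : Set Plane} (hK : IsClosed K)
    (hKi : K ⊆ closure (interior K)) {x : Plane} (hx : x ∈ frontier K) {a ξ : Plane → ℝ}
    {a' ξ' : Plane →L[ℝ] ℝ} (ha : HasStrictFDerivAt a a' x) (hξ : HasStrictFDerivAt ξ ξ' x)
    (hind : ∀ v, a' v = 0 → ξ' v = 0 → v = 0)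
    (hfr : ∀ᶠ y in 𝓝 x, y ∈ frontier K → ξ y = 0) :
    ((∀ᶠ y in 𝓝 x, (y ∈ K ↔ 0 ≤ ξ y)) ∨ ∀ᶠ y in 𝓝 x, (y ∈ K ↔ ξ y ≤ 0)) ∧
      ∀ᶠ y in 𝓝 x, (y ∈ frontier K ↔ ξ y = 0) := by
  obtain ⟨N, δ, hN, hxN, hNW, hδ, hbij, hopen, hconn⟩ := exists_chart ha hξ hind hfr
  have hxK : x ∈ K := hK.frontier_subset hx
  have hside : ∀ y ∈ N, ξ y = 0 → ∀ O ∈ 𝓝 y, (∃ w ∈ O ∩ N, 0 < ξ w) ∧ ∃ w ∈ O ∩ N, ξ w < 0 := by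
    intro y hy hy0 O hO
    have h1 : IsOpen (interior O ∩ N) := isOpen_interior.inter hN
    have h2 := (hopen _ inter_subset_right h1).mem_nhds
      (mem_image_of_mem _ (⟨mem_interior_iff_mem_nhds.2 hO, hy⟩ : y ∈ interior O ∩ N))
    obtain ⟨ε, hε, h3⟩ := mem_nhds_prod_exists_pos h2
    constructor
    · obtain ⟨w, hw, hwe⟩ := (h3 (ε / 2) (by rw [abs_of_pos] <;> linarith)).1
      refine ⟨w, ⟨interior_subset hw.1, hw.2⟩, ?_⟩
      have : ξ w = ξ y + ε / 2 := (Prod.ext_iff.1 hwe).2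
      rw [this, hy0]
      linarith
    · obtain ⟨w, hw, hwe⟩ := (h3 (-(ε / 2)) (by rw [abs_neg, abs_of_pos] <;> linarith)).1
      refine ⟨w, ⟨interior_subset hw.1, hw.2⟩, ?_⟩
      have : ξ w = ξ y + -(ε / 2) := (Prod.ext_iff.1 hwe).2
      rw [this, hy0]
      linarith
  have hpos : IsPreconnected (N ∩ {y | 0 < ξ y}) := by
    have := hconn _ inter_subset_left
      (isPreconnected_ball_inter_halfspace (-ContinuousLinearMap.snd ℝ ℝ ℝ) 0)
    convert this using 1
    ext y
    constructor
    · rintro ⟨h1, h2⟩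
      exact ⟨h1, hbij.mapsTo h1, by simpa using h2⟩
    · rintro ⟨h1, h2, h3⟩
      exact ⟨h1, by simpa using h3⟩
  have hneg : IsPreconnected (N ∩ {y | ξ y < 0}) := by
    have := hconn _ inter_subset_left
      (isPreconnected_ball_inter_halfspace (ContinuousLinearMap.snd ℝ ℝ ℝ) 0)
    convert this using 1
    ext y
    constructor
    · rintro ⟨h1, h2⟩
      exact ⟨h1, hbij.mapsTo h1, by simpa using h2⟩
    · rintro ⟨h1, h2, h3⟩
      exact ⟨h1, by simpa using h3⟩
  -- A connected set off the curve contains no frontier point, so it cannot meet both K and its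
  -- complement.
  have hdich : ∀ S : Set Plane, S ⊆ N → (∀ y ∈ S, ξ y ≠ 0) → IsPreconnected S →
      S ⊆ K ∨ S ⊆ Kᶜ := by
    intro S hSN hS0 hS
    by_contra! h
    obtain ⟨y, hy, hyK⟩ := not_subset.1 h.1
    obtain ⟨w, hw, hwK⟩ := not_subset.1 h.2
    have hint : ∀ p ∈ S, p ∈ K → p ∈ interior K := by
      intro p hpS hpK
      by_contra hpi
      exact hS0 p hpS (hNW (hSN hpS) ⟨subset_closure hpK, hpi⟩)
    obtain ⟨p, -, hp1, hp2⟩ := hS (interior K) Kᶜ isOpen_interior hK.isOpen_compl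
      (fun p hpS => (em (p ∈ K)).imp (hint p hpS) id)
      ⟨w, hw, hint w hw (not_not.1 hwK)⟩ ⟨y, hy, hyK⟩
    exact hp2 (interior_subset hp1)
  have hNx : N ∈ 𝓝 x := hN.mem_nhds hxN
  have hx0 : ξ x = 0 := hNW hxN hx
  have hclK : ∀ y, (∀ O ∈ 𝓝 y, ∃ w ∈ O, w ∈ K) → y ∈ K := by
    intro y hy
    rw [← hK.closure_eq, mem_closure_iff_nhds]
    intro O hO
    obtain ⟨w, hw, hwK⟩ := hy O hO
    exact ⟨w, hw, hwK⟩
  -- Both sides in K would make x an interior point; both outside K is impossible since K is the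
  -- closure of its interior. The mixed cases are the two alternatives of the conclusion.
  rcases hdich _ inter_subset_left (fun y hy => (show 0 < ξ y from hy.2).ne') hpos with hp | hp <;>
    rcases hdich _ inter_subset_left (fun y hy => (show ξ y < 0 from hy.2).ne) hneg with hn | hn
  · exfalso
    have hsub : N ⊆ K := by
      intro y hy
      rcases lt_trichotomy (ξ y) 0 with h | h | h
      · exact hn ⟨hy, h⟩
      · refine hclK y fun O hO => ?_
        obtain ⟨w, hw, hw0⟩ := (hside y hy h O hO).1
        exact ⟨w, hw.1, hp ⟨hw.2, hw0⟩⟩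
      · exact hp ⟨hy, h⟩
    exact hx.2 (mem_interior_iff_mem_nhds.2 (mem_of_superset hNx hsub))
  · have hmem : ∀ y ∈ N, (y ∈ K ↔ 0 ≤ ξ y) := by
      intro y hy
      constructor
      · intro hyK
        by_contra h
        exact hn ⟨hy, not_le.1 h⟩ hyK
      · intro h
        rcases h.eq_or_lt with h | h
        · refine hclK y fun O hO => ?_
          obtain ⟨w, hw, hw0⟩ := (hside y hy h.symm O hO).1
          exact ⟨w, hw.1, hp ⟨hw.2, hw0⟩⟩
        · exact hp ⟨hy, h⟩
    refine ⟨Or.inl (mem_of_superset hNx hmem), ?_⟩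
    filter_upwards [hNx] with y hy
    refine ⟨fun h => hNW hy h, fun h => ⟨subset_closure ((hmem y hy).2 h.ge), fun hi => ?_⟩⟩
    obtain ⟨w, hw, hw0⟩ := (hside y hy h _ (mem_interior_iff_mem_nhds.1 hi)).2
    exact hn ⟨hw.2, hw0⟩ hw.1
  · have hmem : ∀ y ∈ N, (y ∈ K ↔ ξ y ≤ 0) := by
      intro y hy
      constructor
      · intro hyK
        by_contra h
        exact hp ⟨hy, not_le.1 h⟩ hyK
      · intro h
        rcases h.eq_or_lt with h | h
        · refine hclK y fun O hO => ?_
          obtain ⟨w, hw, hw0⟩ := (hside y hy h O hO).2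
          exact ⟨w, hw.1, hn ⟨hw.2, hw0⟩⟩
        · exact hn ⟨hy, h⟩
    refine ⟨Or.inr (mem_of_superset hNx hmem), ?_⟩
    filter_upwards [hNx] with y hy
    refine ⟨fun h => hNW hy h, fun h => ⟨subset_closure ((hmem y hy).2 h.le), fun hi => ?_⟩⟩
    obtain ⟨w, hw, hw0⟩ := (hside y hy h _ (mem_interior_iff_mem_nhds.1 hi)).1
    exact hp ⟨hw.2, hw0⟩ hw.1
  · exfalso
    obtain ⟨y, hyN, hyi⟩ := mem_closure_iff_nhds.1 (hKi hxK) N hNx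
    have hy0 : ξ y = 0 := by
      rcases lt_trichotomy (ξ y) 0 with h | h | h
      · exact absurd (interior_subset hyi) (hn ⟨hyN, h⟩)
      · exact h
      · exact absurd (interior_subset hyi) (hp ⟨hyN, h⟩)
    obtain ⟨w, hw, hw0⟩ := (hside y hyN hy0 _ (mem_interior_iff_mem_nhds.1 hyi)).1
    exact hp ⟨hw.2, hw0⟩ hw.1

/-- Local structure of a domain at a boundary point near which an immersion with components
`η, ξ₁, ξ₂` takes the boundary to the line `ξ₁ = ξ₂ = 0`. -/
theorem exists_boundary_chart {K : Set Plane} (hK : IsClosed K) (hKi : K ⊆ closure (interior K))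
    {x : Plane} (hx : x ∈ frontier K) {η ξ₁ ξ₂ : Plane → ℝ} {η' ξ₁' ξ₂' : Plane →L[ℝ] ℝ}
    (h₁ : HasStrictFDerivAt ξ₁ ξ₁' x)
    (h₂ : HasStrictFDerivAt ξ₂ ξ₂' x)
    (hinj : ∀ v, η' v = 0 → ξ₁' v = 0 → ξ₂' v = 0 → v = 0)
    (hη : HasStrictFDerivAt η η' x)
    (hfr : ∀ᶠ y in 𝓝 x, y ∈ frontier K → ξ₁ y = 0 ∧ ξ₂ y = 0) :
    ∃ (ξ : Plane → ℝ) (ξ' : Plane →L[ℝ] ℝ), HasStrictFDerivAt ξ ξ' x ∧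
      (∀ v, η' v = 0 → ξ' v = 0 → v = 0) ∧ (∀ᶠ y in 𝓝 x, (y ∈ K ↔ 0 ≤ ξ y)) ∧
      ∀ᶠ y in 𝓝 x, (y ∈ frontier K ↔ ξ y = 0) := by
  -- Were the two differentials independent, the frontier would be the whole curve ξ₁ = 0 near x,
  -- along which ξ₂ varies; yet ξ₂ vanishes on the frontier.
  have hdep : ∃ v, v ≠ 0 ∧ ξ₁' v = 0 ∧ ξ₂' v = 0 := by
    by_contra! hno
    have hind : ∀ v, ξ₂' v = 0 → ξ₁' v = 0 → v = 0 := fun v h2 h1 => by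
      by_contra hv
      exact hno v hv h1 h2
    have hh := (eventually_mem_iff_of_frontier_subset hK hKi hx h₂ h₁ hind
      (hfr.mono fun y hy hyf => (hy hyf).1)).2
    obtain ⟨N, δ, hN, hxN, hNW, hδ, hbij, -, -⟩ := exists_chart h₂ h₁ hind (hh.and hfr)
    have hx12 := (hNW hxN).2 hx
    obtain ⟨w, hw, hwe⟩ := hbij.surjOn (show (ξ₂ x + δ / 2, ξ₁ x) ∈ ball (ξ₂ x, ξ₁ x) δ by
      rw [mem_ball, Prod.dist_eq]
      simp [abs_of_pos hδ, hδ])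
    have hw1 : ξ₁ w = 0 := (show ξ₁ w = ξ₁ x from (Prod.ext_iff.1 hwe).2).trans hx12.1
    have hw2 : ξ₂ w = ξ₂ x + δ / 2 := (Prod.ext_iff.1 hwe).1
    have := ((hNW hw).2 ((hNW hw).1.2 hw1)).2
    rw [hw2, hx12.2] at this
    linarith
  obtain ⟨v, hv, hv1, hv2⟩ := hdep
  have hηv : η' v ≠ 0 := fun h => hv (hinj v h hv1 hv2)
  -- Since v lies in the kernel of ξ' but not of η', any nonzero such ξ' is independent of η'. One
  -- of ξ₁', ξ₂' is nonzero by injectivity, and a sign change puts K on the side ξ ≥ 0.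
  have key : ∀ (ξ : Plane → ℝ) (ξ' : Plane →L[ℝ] ℝ), HasStrictFDerivAt ξ ξ' x → ξ' v = 0 →
      ξ' ≠ 0 → (∀ᶠ y in 𝓝 x, y ∈ frontier K → ξ y = 0) →
      ∃ (ξ : Plane → ℝ) (ξ' : Plane →L[ℝ] ℝ), HasStrictFDerivAt ξ ξ' x ∧
        (∀ v, η' v = 0 → ξ' v = 0 → v = 0) ∧ (∀ᶠ y in 𝓝 x, (y ∈ K ↔ 0 ≤ ξ y)) ∧
        ∀ᶠ y in 𝓝 x, (y ∈ frontier K ↔ ξ y = 0) := by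
    intro ξ ξ' hξ hξv hξ0 hξf
    have hind : ∀ w, η' w = 0 → ξ' w = 0 → w = 0 := by
      intro w hw1 hw2
      by_contra hw
      exact hξ0 (eq_zero_of_det_ne_zero hξv hw2 (det_ne_zero_of_apply hηv hw1 hw))
    obtain ⟨hc | hc, hf⟩ := eventually_mem_iff_of_frontier_subset hK hKi hx hη hξ hind hξf
    · exact ⟨ξ, ξ', hξ, hind, hc, hf⟩
    · refine ⟨fun y => -ξ y, -ξ', hξ.neg, fun w h1 h2 => hind w h1 (by simpa using h2), ?_, ?_⟩
      · filter_upwards [hc] with y hy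
        rw [hy, neg_nonneg]
      · filter_upwards [hf] with y hy
        rw [hy, neg_eq_zero]
  by_cases hz : ξ₁' = 0
  · have hz2 : ξ₂' ≠ 0 := by
      intro hz2
      obtain ⟨w, hw, hw0⟩ := exists_ne_zero_apply_eq_zero η'
      exact hw (hinj w hw0 (by rw [hz]; rfl) (by rw [hz2]; rfl))
    exact key ξ₂ ξ₂' h₂ hv2 hz2 (hfr.mono fun y hy hyf => (hy hyf).2)
  · exact key ξ₁ ξ₁' h₁ hv1 hz (hfr.mono fun y hy hyf => (hy hyf).1)

/-! ### Closed disks in the plane -/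

section Disk

variable {K : Set Plane} (e : closedBall (0 : Plane) 1 ≃ₜ K)
  (he : ∀ x, (e x : Plane) ∈ frontier K ↔ (x : Plane) ∈ sphere (0 : Plane) 1)

include e in
theorem isCompact_of_homeomorph : IsCompact K := by
  have : CompactSpace K := e.compactSpace
  exact isCompact_iff_compactSpace.2 this

include he in
theorem interior_eq_image_ball :
    interior K = (fun y : closedBall (0 : Plane) 1 => (e y : Plane)) ''
      {y | (y : Plane) ∈ ball (0 : Plane) 1} := by
  have hK : IsClosed K := (isCompact_of_homeomorph e).isClosed
  ext x
  constructor
  · intro hx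
    obtain ⟨y, hy⟩ := e.surjective ⟨x, interior_subset hx⟩
    have hyx : (e y : Plane) = x := congrArg Subtype.val hy
    refine ⟨y, ?_, hyx⟩
    have h1 : (y : Plane) ∉ sphere (0 : Plane) 1 := by
      rw [← he, hyx]
      exact fun h => h.2 hx
    have h2 : dist (y : Plane) 0 ≤ 1 := y.2
    have h3 : dist (y : Plane) 0 < 1 := lt_of_le_of_ne h2 h1
    exact h3
  · rintro ⟨y, hy, rfl⟩
    by_contra hi
    have h1 : (e y : Plane) ∈ frontier K := ⟨subset_closure (e y).2, hi⟩
    rw [he, mem_sphere] at h1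
    have h2 : dist (y : Plane) 0 < 1 := hy
    exact h2.ne h1

include he in
theorem isPreconnected_interior_disk : IsPreconnected (interior K) := by
  rw [interior_eq_image_ball e he]
  refine IsPreconnected.image ?_ _ (continuous_subtype_val.comp e.continuous).continuousOn
  rw [← Topology.IsInducing.subtypeVal.isPreconnected_image]
  have : Subtype.val '' {y : closedBall (0 : Plane) 1 | (y : Plane) ∈ ball (0 : Plane) 1} =
      ball (0 : Plane) 1 := by
    ext y
    constructor
    · rintro ⟨y, hy, rfl⟩
      exact hy
    · intro hy
      exact ⟨⟨y, ball_subset_closedBall hy⟩, hy, rfl⟩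
  rw [this]
  exact (convex_ball _ _).isPreconnected

include he in
theorem subset_closure_interior_disk : K ⊆ closure (interior K) := by
  intro x hx
  rw [interior_eq_image_ball e he]
  have hcont : Continuous fun y : closedBall (0 : Plane) 1 => (e y : Plane) :=
    continuous_subtype_val.comp e.continuous
  refine image_closure_subset_closure_image hcont ⟨e.symm ⟨x, hx⟩, ?_, by simp⟩
  rw [closure_subtype]
  have : Subtype.val '' {y : closedBall (0 : Plane) 1 | (y : Plane) ∈ ball (0 : Plane) 1} =
      ball (0 : Plane) 1 := by
    ext y
    constructor
    · rintro ⟨y, hy, rfl⟩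
      exact hy
    · intro hy
      exact ⟨⟨y, ball_subset_closedBall hy⟩, hy, rfl⟩
  rw [this, closure_ball _ one_ne_zero]
  exact (e.symm ⟨x, hx⟩).2

end Disk

/-! ### Disks in a cylinder -/

/-- The squared distance of `f x` to the axis. -/
def radiusSq (f : Plane → Space) (x : Plane) : ℝ := f x 0 ^ 2 + f x 1 ^ 2

/-- The differential of the `i`-th coordinate of `f`. -/
noncomputable def coordDeriv (f : Plane → Space) (x : Plane) (i : Fin 3) : Plane →L[ℝ] ℝ :=
  (EuclideanSpace.proj i : Space →L[ℝ] ℝ).comp (fderiv ℝ f x)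

/-- The differential of `radiusSq f`. -/
noncomputable def radiusSqDeriv (f : Plane → Space) (x : Plane) : Plane →L[ℝ] ℝ :=
  (2 * f x 0) • coordDeriv f x 0 + (2 * f x 1) • coordDeriv f x 1

/-- The points of `K` that `f` maps to the axis. -/
def axisPoints (f : Plane → Space) (K : Set Plane) : Set Plane := {x | x ∈ K ∧ radiusSq f x = 0}

/-- The hypotheses on the competing surface. -/
structure IsCompetitor (r h φ₁ φ₂ : ℝ) (f : Plane → Space) (K : Set Plane) : Prop where
  r_pos : 0 < r
  h_pos : 0 < h
  immersed : IsImmersedDisk f K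
  image_subset : f '' K ⊆ solidCylinder r h
  boundary_subset :
    f '' frontier K ⊆ diameter r h φ₁ ∪ diameter r 0 φ₂ ∪ sideSurface r h
  axis_subset : axis h ⊆ f '' K
  transversal : TransversalToCylinders r f K

/-- The height and direction of one of the two diameters. -/
def IsEnd (h φ₁ φ₂ c φ : ℝ) : Prop := (c = h ∧ φ = φ₁) ∨ (c = 0 ∧ φ = φ₂)

theorem radiusSq_nonneg (f : Plane → Space) (x : Plane) : 0 ≤ radiusSq f x := by
  unfold radiusSq; positivity

theorem radiusSq_eq_zero {f : Plane → Space} {x : Plane} (hx : radiusSq f x = 0) :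
    f x 0 = 0 ∧ f x 1 = 0 := by
  unfold radiusSq at hx
  constructor <;> nlinarith [sq_nonneg (f x 0), sq_nonneg (f x 1)]

theorem coordDeriv_apply (f : Plane → Space) (x v : Plane) (i : Fin 3) :
    coordDeriv f x i v = fderiv ℝ f x v i := rfl

namespace IsCompetitor

variable {r h φ₁ φ₂ : ℝ} {f : Plane → Space} {K : Set Plane} (H : IsCompetitor r h φ₁ φ₂ f K)

include H

theorem isCompact : IsCompact K := by
  obtain ⟨e, -⟩ := H.immersed.disk
  exact isCompact_of_homeomorph e

theorem isClosed : IsClosed K := H.isCompact.isClosed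

theorem frontier_subset : frontier K ⊆ K := H.isClosed.frontier_subset

omit H in
theorem mem_interior {x : Plane} (hx : x ∈ K) (hxf : x ∉ frontier K) : x ∈ interior K := by
  by_contra hi
  exact hxf ⟨subset_closure hx, hi⟩

theorem isPreconnected_interior : IsPreconnected (interior K) := by
  obtain ⟨e, he⟩ := H.immersed.disk
  exact isPreconnected_interior_disk e he

theorem subset_closure_interior : K ⊆ closure (interior K) := by
  obtain ⟨e, he⟩ := H.immersed.disk
  exact subset_closure_interior_disk e he

theorem contDiffAt {x : Plane} (hx : x ∈ K) : ContDiffAt ℝ 1 f x := by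
  obtain ⟨U, hU, hKU, hf⟩ := H.immersed.contDiff
  exact hf.contDiffAt (hU.mem_nhds (hKU hx))

theorem hasStrictFDerivAt {x : Plane} (hx : x ∈ K) :
    HasStrictFDerivAt f (fderiv ℝ f x) x :=
  (H.contDiffAt hx).hasStrictFDerivAt one_ne_zero

theorem coord_hasStrictFDerivAt {x : Plane} (hx : x ∈ K) (i : Fin 3) :
    HasStrictFDerivAt (fun y => f y i) (coordDeriv f x i) x :=
  ((EuclideanSpace.proj i : Space →L[ℝ] ℝ).hasStrictFDerivAt).comp x (H.hasStrictFDerivAt hx)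

theorem coord_continuousOn (i : Fin 3) : ContinuousOn (fun y => f y i) K := fun _ hx =>
  (H.coord_hasStrictFDerivAt hx i).continuousAt.continuousWithinAt

theorem radiusSq_hasStrictFDerivAt {x : Plane} (hx : x ∈ K) :
    HasStrictFDerivAt (radiusSq f) (radiusSqDeriv f x) x := by
  have h0 := H.coord_hasStrictFDerivAt hx 0
  have h1 := H.coord_hasStrictFDerivAt hx 1
  refine ((h0.pow 2).add (h1.pow 2)).congr_fderiv ?_
  unfold radiusSqDeriv
  simp

theorem radiusSq_continuousOn : ContinuousOn (radiusSq f) K := fun _ hx =>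
  (H.radiusSq_hasStrictFDerivAt hx).continuousAt.continuousWithinAt

theorem eq_zero_of_coordDeriv {x : Plane} (hx : x ∈ K) {v : Plane} (h0 : coordDeriv f x 0 v = 0)
    (h1 : coordDeriv f x 1 v = 0) (h2 : coordDeriv f x 2 v = 0) : v = 0 := by
  apply H.immersed.immersion x hx
  rw [map_zero]
  ext i
  fin_cases i
  exacts [h0, h1, h2]

theorem radiusSq_le {x : Plane} (hx : x ∈ K) : radiusSq f x ≤ r ^ 2 :=
  (H.image_subset (mem_image_of_mem f hx)).1

theorem height_mem {x : Plane} (hx : x ∈ K) : f x 2 ∈ Icc 0 h :=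
  (H.image_subset (mem_image_of_mem f hx)).2

/-- This is what transversality provides: if the differential vanished, the image of df would lie in
the tangent plane of the cylinder, and the radial vector would be outside the span. -/
theorem radiusSqDeriv_ne_zero {x : Plane} (hx : x ∈ K) (hpos : 0 < radiusSq f x) :
    radiusSqDeriv f x ≠ 0 := by
  intro h0
  have ht := H.transversal (√(radiusSq f x)) (Real.sqrt_pos.2 hpos)
    (Real.sqrt_le_iff.2 ⟨H.r_pos.le, H.radiusSq_le hx⟩) x hx
    (by change _ = _; rw [Real.sq_sqrt hpos.le]; rfl)
  set w : Space := !₂[f x 0, f x 1, 0] with hw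
  have hle : LinearMap.range (fderiv ℝ f x).toLinearMap ≤ coaxialTangent (f x) := by
    rintro _ ⟨v, rfl⟩
    rw [coaxialTangent, Submodule.mem_orthogonal_singleton_iff_inner_right]
    have h1 : radiusSqDeriv f x v = 0 := by rw [h0]; rfl
    have h2 : 2 * f x 0 * fderiv ℝ f x v 0 + 2 * f x 1 * fderiv ℝ f x v 1 = 0 := by
      simpa [radiusSqDeriv, coordDeriv_apply] using h1
    simp only [PiLp.inner_apply, Fin.sum_univ_three]
    simp
    linarith
  rw [sup_eq_right.2 hle] at ht
  have hmem : w ∈ coaxialTangent (f x) := by rw [ht]; trivial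
  rw [coaxialTangent, Submodule.mem_orthogonal_singleton_iff_inner_right,
    real_inner_self_eq_norm_sq, EuclideanSpace.norm_sq_eq, Fin.sum_univ_three] at hmem
  simp at hmem
  unfold radiusSq at hpos
  linarith

/-- An interior point on the side surface would be a local maximum of the radius, hence a critical
point off the axis. -/
theorem radiusSq_lt_of_mem_interior {x : Plane} (hx : x ∈ interior K) : radiusSq f x < r ^ 2 := by
  have hxK := interior_subset hx
  refine lt_of_le_of_ne (H.radiusSq_le hxK) fun heq => ?_
  have hmax : IsLocalMax (radiusSq f) x := by
    filter_upwards [mem_interior_iff_mem_nhds.1 hx] with y hy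
    rw [heq]
    exact H.radiusSq_le hy
  have := hmax.hasFDerivAt_eq_zero (H.radiusSq_hasStrictFDerivAt hxK).hasFDerivAt
  exact H.radiusSqDeriv_ne_zero hxK (by rw [heq]; have := H.r_pos; positivity) this

theorem frontier_cases {x : Plane} (hx : x ∈ frontier K) :
    (f x 2 = h ∧ -Real.sin φ₁ * f x 0 + Real.cos φ₁ * f x 1 = 0) ∨
      (f x 2 = 0 ∧ -Real.sin φ₂ * f x 0 + Real.cos φ₂ * f x 1 = 0) ∨ radiusSq f x = r ^ 2 := by
  rcases H.boundary_subset (mem_image_of_mem f hx) with (⟨s, -, hs⟩ | ⟨s, -, hs⟩) | hs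
  · left
    rw [hs]
    simp
    ring
  · right; left
    rw [hs]
    simp
    ring
  · right; right
    exact hs.1

theorem exists_isEnd {x : Plane} (hx : x ∈ frontier K) (hxr : radiusSq f x < r ^ 2) :
    ∃ c φ, IsEnd h φ₁ φ₂ c φ ∧ f x 2 = c := by
  rcases H.frontier_cases hx with h1 | h1 | h1
  · exact ⟨h, φ₁, Or.inl ⟨rfl, rfl⟩, h1.1⟩
  · exact ⟨0, φ₂, Or.inr ⟨rfl, rfl⟩, h1.1⟩
  · exact absurd h1 hxr.ne

/-- Near such a point the radius stays below r and the height within h of c, so only one of the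
three boundary pieces can be reached. -/
theorem eventually_frontier {x : Plane} (hx : x ∈ frontier K) (hxr : radiusSq f x < r ^ 2)
    {c φ : ℝ} (hc : IsEnd h φ₁ φ₂ c φ) (hxc : f x 2 = c) :
    ∀ᶠ y in 𝓝 x, y ∈ frontier K →
      -Real.sin φ * f y 0 + Real.cos φ * f y 1 = 0 ∧ f y 2 - c = 0 := by
  have hxK := H.frontier_subset hx
  have h1 : ∀ᶠ y in 𝓝 x, radiusSq f y < r ^ 2 :=
    (H.radiusSq_hasStrictFDerivAt hxK).continuousAt.eventually_lt continuousAt_const hxr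
  have h2 : ∀ᶠ y in 𝓝 x, |f y 2 - c| < h := by
    have : ContinuousAt (fun y => |f y 2 - c|) x :=
      ((H.coord_hasStrictFDerivAt hxK 2).continuousAt.sub continuousAt_const).abs
    refine this.eventually_lt continuousAt_const ?_
    rw [hxc, sub_self, abs_zero]
    exact H.h_pos
  filter_upwards [h1, h2] with y hy1 hy2 hyf
  have hh := H.h_pos
  rcases H.frontier_cases hyf with h3 | h3 | h3
  · rcases hc with ⟨rfl, rfl⟩ | ⟨rfl, rfl⟩
    · exact ⟨h3.2, by rw [h3.1, sub_self]⟩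
    · rw [h3.1, sub_zero, abs_of_pos hh] at hy2
      exact absurd hy2 (lt_irrefl _)
  · rcases hc with ⟨rfl, rfl⟩ | ⟨rfl, rfl⟩
    · rw [h3.1, zero_sub, abs_neg, abs_of_pos hh] at hy2
      exact absurd hy2 (lt_irrefl _)
    · exact ⟨h3.2, by rw [h3.1, sub_self]⟩
  · exact absurd h3 hy1.ne

/-- At a boundary point inside the cylinder, the position along the diameter and a function that
vanishes on the boundary are local coordinates. -/
theorem exists_end_chart {x : Plane} (hx : x ∈ frontier K) (hxr : radiusSq f x < r ^ 2)
    {c φ : ℝ} (hc : IsEnd h φ₁ φ₂ c φ) (hxc : f x 2 = c) :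
    ∃ (ξ : Plane → ℝ) (ξ' : Plane →L[ℝ] ℝ), HasStrictFDerivAt ξ ξ' x ∧
      (∀ v, (Real.cos φ • coordDeriv f x 0 + Real.sin φ • coordDeriv f x 1) v = 0 →
        ξ' v = 0 → v = 0) ∧ (∀ᶠ y in 𝓝 x, (y ∈ K ↔ 0 ≤ ξ y)) ∧
      ∀ᶠ y in 𝓝 x, (y ∈ frontier K ↔ ξ y = 0) := by
  have hxK := H.frontier_subset hx
  have h0 := H.coord_hasStrictFDerivAt hxK 0
  have h1 := H.coord_hasStrictFDerivAt hxK 1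
  have h2 := H.coord_hasStrictFDerivAt hxK 2
  refine exists_boundary_chart H.isClosed H.subset_closure_interior hx
    ((h0.const_mul (-Real.sin φ)).add (h1.const_mul (Real.cos φ))) (h2.sub_const c) ?_
    ((h0.const_mul (Real.cos φ)).add (h1.const_mul (Real.sin φ)))
    (H.eventually_frontier hx hxr hc hxc)
  intro v hv1 hv2 hv3
  have e1 : Real.cos φ * coordDeriv f x 0 v + Real.sin φ * coordDeriv f x 1 v = 0 := by
    simpa using hv1
  have e2 : -Real.sin φ * coordDeriv f x 0 v + Real.cos φ * coordDeriv f x 1 v = 0 := by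
    simpa using hv2
  have hsc := Real.sin_sq_add_cos_sq φ
  refine H.eq_zero_of_coordDeriv hxK ?_ ?_ hv3
  · linear_combination Real.cos φ * e1 - Real.sin φ * e2 - coordDeriv f x 0 v * hsc
  · linear_combination Real.sin φ * e1 + Real.cos φ * e2 - coordDeriv f x 1 v * hsc

/-- Away from the axis and the side surface, the distance to the axis is one of two local
coordinates in which `K` is a half plane, or the whole plane. -/
theorem exists_radius_chart {x : Plane} (hx : x ∈ K) (hpos : 0 < radiusSq f x)
    (hxr : radiusSq f x < r ^ 2) :
    ∃ (ξ : Plane → ℝ) (ξ' : Plane →L[ℝ] ℝ), HasStrictFDerivAt ξ ξ' x ∧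
      (∀ v, radiusSqDeriv f x v = 0 → ξ' v = 0 → v = 0) ∧
      (∀ᶠ y in 𝓝 x, (y ∈ K ↔ 0 ≤ ξ y)) ∧ 0 ≤ ξ x := by
  by_cases hxf : x ∈ frontier K
  · obtain ⟨c, φ, hc, hxc⟩ := H.exists_isEnd hxf hxr
    obtain ⟨ξ, ξ', hξ, hind, hK, hfr⟩ := H.exists_end_chart hxf hxr hc hxc
    -- At a frontier point f x lies on the diameter at signed position η ≠ 0, so the differential of
    -- the squared radius is 2η times that of the position, and the chart of the diameter serves
    -- here too.
    refine ⟨ξ, ξ', hξ, fun v hv1 hv2 => hind v ?_ hv2, hK, (hfr.self_of_nhds.1 hxf).ge⟩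
    have hk := ((H.eventually_frontier hxf hxr hc hxc).self_of_nhds hxf).1
    have e1 : 2 * f x 0 * coordDeriv f x 0 v + 2 * f x 1 * coordDeriv f x 1 v = 0 := by
      simpa [radiusSqDeriv] using hv1
    have hsc := Real.sin_sq_add_cos_sq φ
    set η := Real.cos φ * f x 0 + Real.sin φ * f x 1 with hη
    have f0 : f x 0 = η * Real.cos φ := by
      linear_combination Real.cos φ * hη - Real.sin φ * hk - f x 0 * hsc
    have f1 : f x 1 = η * Real.sin φ := by
      linear_combination Real.sin φ * hη + Real.cos φ * hk - f x 1 * hsc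
    have hη0 : η ≠ 0 := by
      intro h0
      rw [radiusSq, f0, f1, h0] at hpos
      simp at hpos
    rw [f0, f1] at e1
    have : η * (Real.cos φ * coordDeriv f x 0 v + Real.sin φ * coordDeriv f x 1 v) = 0 := by
      linarith
    simpa using (mul_eq_zero.1 this).resolve_left hη0
  · have hxi := mem_interior hx hxf
    obtain ⟨w, hw, hw0⟩ := exists_ne_zero_apply_eq_zero (radiusSqDeriv f x)
    have hne := H.radiusSqDeriv_ne_zero hx hpos
    let m : Plane →L[ℝ] ℝ := innerSL ℝ w
    have hmw : m w ≠ 0 := by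
      simp only [m, innerSL_apply_apply, real_inner_self_eq_norm_sq]
      exact pow_ne_zero 2 (norm_ne_zero_iff.2 hw)
    -- The summand 1 keeps the second coordinate positive near x, where K is a full neighbourhood.
    refine ⟨fun y => m y - m x + 1, m, (m.hasStrictFDerivAt.sub_const (m x)).add_const 1,
      fun v hv1 hv2 => ?_, ?_, by simp⟩
    · by_contra hv
      exact hne (eq_zero_of_det_ne_zero hw0 hv1 (det_ne_zero_of_apply hmw hv2 hv))
    · have h1 : ∀ᶠ y in 𝓝 x, 0 < m y - m x + 1 := by
        have : ContinuousAt (fun y => m y - m x + 1) x := by fun_prop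
        exact continuousAt_const.eventually_lt this (by simp)
      filter_upwards [h1, mem_interior_iff_mem_nhds.1 hxi] with y hy1 hy2
      exact ⟨fun _ => hy1.le, fun _ => hy2⟩

/-- No local minimum on K off the axis, boundary points included: in the chart (radius², ξ) the
first coordinate can be lowered while ξ ≥ 0 is kept. -/
theorem mem_closure_radiusSq_lt {x : Plane} (hx : x ∈ K) (hpos : 0 < radiusSq f x)
    (hxr : radiusSq f x < r ^ 2) : x ∈ closure (K ∩ {y | radiusSq f y < radiusSq f x}) := by
  obtain ⟨ξ, ξ', hξ, hind, hK, hξ0⟩ := H.exists_radius_chart hx hpos hxr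
  rw [mem_closure_iff_nhds]
  intro O hO
  obtain ⟨N, δ, hN, hxN, hNW, hδ, hbij, -, -⟩ :=
    exists_chart (H.radiusSq_hasStrictFDerivAt hx) hξ hind (inter_mem hO hK)
  obtain ⟨y, hy, hye⟩ := hbij.surjOn
    (show (radiusSq f x - δ / 2, ξ x) ∈ ball (radiusSq f x, ξ x) δ by
      rw [mem_ball, Prod.dist_eq]
      simp [abs_of_pos hδ, hδ])
  have h1 : radiusSq f y = radiusSq f x - δ / 2 := (Prod.ext_iff.1 hye).1
  have h2 : ξ y = ξ x := (Prod.ext_iff.1 hye).2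
  refine ⟨y, (hNW hy).1, ?_, ?_⟩
  · have := (hNW hy).2
    exact this.2 (by rw [h2]; exact hξ0)
  · change radiusSq f y < radiusSq f x
    linarith

/-- No saddle: in the same chart the sublevel set is a ball cut by two half planes, which is convex.
-/
theorem exists_preconnected_radiusSq_lt {x : Plane} (hx : x ∈ K) (hpos : 0 < radiusSq f x)
    (hxr : radiusSq f x < r ^ 2) :
    ∃ N ∈ 𝓝 x, IsPreconnected (N ∩ (K ∩ {y | radiusSq f y < radiusSq f x})) := by
  obtain ⟨ξ, ξ', hξ, hind, hK, hξ0⟩ := H.exists_radius_chart hx hpos hxr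
  obtain ⟨N, δ, hN, hxN, hNW, hδ, hbij, -, hconn⟩ :=
    exists_chart (H.radiusSq_hasStrictFDerivAt hx) hξ hind hK
  refine ⟨N, hN.mem_nhds hxN, ?_⟩
  have hconv : Convex ℝ (ball (radiusSq f x, ξ x) δ ∩
      ({q : ℝ × ℝ | q.1 < radiusSq f x} ∩ {q | 0 ≤ q.2})) :=
    (convex_ball _ _).inter ((convex_halfSpace_lt (LinearMap.fst ℝ ℝ ℝ).isLinear _).inter
      (convex_halfSpace_ge (LinearMap.snd ℝ ℝ ℝ).isLinear _))
  have := hconn _ inter_subset_left hconv.isPreconnected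
  convert this using 1
  ext y
  constructor
  · rintro ⟨h1, h2, h3⟩
    have h4 : y ∈ K ↔ 0 ≤ ξ y := hNW h1
    exact ⟨h1, hbij.mapsTo h1, h3, h4.1 h2⟩
  · rintro ⟨h1, -, h3, h2⟩
    have h4 : y ∈ K ↔ 0 ≤ ξ y := hNW h1
    exact ⟨h1, h4.2 h2, h3⟩

/-- The set lies between the connected interior of K and its closure. -/
theorem isPreconnected_radiusSq_lt : IsPreconnected (K ∩ {y | radiusSq f y < r ^ 2}) :=
  H.isPreconnected_interior.subset_closure
    (fun _ hx => ⟨interior_subset hx, H.radiusSq_lt_of_mem_interior hx⟩)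
    (fun _ hx => H.subset_closure_interior hx.1)

/-- The axis points are the zero level of the squared radius, so `isPreconnected_zero_level` applies
on the compact space K. -/
theorem isPreconnected_axisPoints : IsPreconnected (axisPoints f K) := by
  have : CompactSpace K := isCompact_iff_compactSpace.1 H.isCompact
  have hu : Continuous fun x : K => radiusSq f x :=
    continuousOn_iff_continuous_domRestrict.1 H.radiusSq_continuousOn
  have himg : ∀ S : Set Plane, Subtype.val '' ((Subtype.val : K → Plane) ⁻¹' S) = S ∩ K := by
    intro S
    rw [Subtype.image_preimage_coe, inter_comm]
  have hr := H.r_pos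
  have key := isPreconnected_zero_level hu (R := r ^ 2) (by positivity) ?_ ?_ ?_
  · have h1 := key.image _ continuous_subtype_val.continuousOn
    convert h1 using 1
    ext x
    constructor
    · rintro ⟨hx, hx0⟩
      exact ⟨⟨x, hx⟩, hx0.le, rfl⟩
    · rintro ⟨x, hx, rfl⟩
      exact ⟨x.2, le_antisymm hx (radiusSq_nonneg f x)⟩
  · intro x h0 hxr
    rw [closure_subtype]
    convert H.mem_closure_radiusSq_lt x.2 h0 hxr using 2
    rw [inter_comm]
    exact himg {y | radiusSq f y < radiusSq f x}
  · intro x h0 hxr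
    obtain ⟨N, hN, hc⟩ := H.exists_preconnected_radiusSq_lt x.2 h0 hxr
    refine ⟨Subtype.val ⁻¹' N, continuous_subtype_val.continuousAt.preimage_mem_nhds hN, ?_⟩
    rw [← Topology.IsInducing.subtypeVal.isPreconnected_image]
    convert hc using 1
    rw [inter_comm K, ← inter_assoc]
    exact himg (N ∩ {y | radiusSq f y < radiusSq f x})
  · rw [← Topology.IsInducing.subtypeVal.isPreconnected_image]
    convert H.isPreconnected_radiusSq_lt using 1
    rw [inter_comm]
    exact himg {y | radiusSq f y < r ^ 2}

/-! ### The points on the axis -/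

theorem image_axisPoints : (fun x => f x 2) '' axisPoints f K = Icc 0 h := by
  refine Subset.antisymm ?_ ?_
  · rintro _ ⟨x, hx, rfl⟩
    exact H.height_mem hx.1
  · intro c hc
    obtain ⟨x, hx, hxe⟩ := H.axis_subset (show (!₂[0, 0, c] : Space) ∈ axis h from
      ⟨by simp, by simp, by simpa using hc.1, by simpa using hc.2⟩)
    refine ⟨x, ⟨hx, ?_⟩, ?_⟩
    · simp [radiusSq, hxe]
    · simp [hxe]

theorem isCompact_axisPoints : IsCompact (axisPoints f K) := by
  have : axisPoints f K = K ∩ radiusSq f ⁻¹' {0} := rfl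
  rw [this]
  exact H.isCompact.of_isClosed_subset
    (H.radiusSq_continuousOn.preimage_isClosed_of_isClosed H.isClosed isClosed_singleton)
    inter_subset_left

/-- Otherwise the two horizontal coordinates form a chart, x is isolated among the axis points, and
by connectedness it is the only one; but the heights of axis points fill [0, h]. -/
theorem exists_vertical_tangent {x : Plane} (hx : x ∈ axisPoints f K) :
    ∃ v, v ≠ 0 ∧ coordDeriv f x 0 v = 0 ∧ coordDeriv f x 1 v = 0 := by
  by_contra! hno
  obtain ⟨N, δ, hN, hxN, -, hδ, hbij, -, -⟩ :=
    exists_chart (H.coord_hasStrictFDerivAt hx.1 0) (H.coord_hasStrictFDerivAt hx.1 1)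
      (fun v h0 h1 => by
        by_contra hv
        exact hno v hv h0 h1) univ_mem
  have hiso : ∀ y ∈ axisPoints f K, y ∈ N → y = x := by
    intro y hy hyN
    refine hbij.injOn hyN hxN ?_
    have h1 := radiusSq_eq_zero hy.2
    have h2 := radiusSq_eq_zero hx.2
    simp only [h1.1, h1.2, h2.1, h2.2]
  have hall : ∀ y ∈ axisPoints f K, y = x := by
    intro y hy
    by_contra hyx
    obtain ⟨w, hw, hwN, hwx⟩ := H.isPreconnected_axisPoints N {x}ᶜ hN isOpen_compl_singleton
      (fun w _ => by
        by_cases hwx : w = x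
        · exact Or.inl (hwx ▸ hxN)
        · exact Or.inr hwx) ⟨x, hx, hxN⟩ ⟨y, hy, hyx⟩
    exact hwx (hiso w hw hwN)
  have hsub : ∀ c ∈ Icc 0 h, c = f x 2 := by
    intro c hc
    rw [← H.image_axisPoints] at hc
    obtain ⟨y, hy, rfl⟩ := hc
    rw [hall y hy]
  have h1 := hsub 0 ⟨le_rfl, H.h_pos.le⟩
  have h2 := hsub h ⟨H.h_pos.le, le_rfl⟩
  have := H.h_pos
  linarith

/-- At a point on the axis the height and a horizontal coordinate are local coordinates. -/
theorem exists_axis_chart {x : Plane} (hx : x ∈ axisPoints f K) :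
    ∃ i : Fin 3, (i = 0 ∨ i = 1) ∧
      ∀ v, coordDeriv f x 2 v = 0 → coordDeriv f x i v = 0 → v = 0 := by
  obtain ⟨v, hv, hv0, hv1⟩ := H.exists_vertical_tangent hx
  have hv2 : coordDeriv f x 2 v ≠ 0 := fun h2 => hv (H.eq_zero_of_coordDeriv hx.1 hv0 hv1 h2)
  have key : ∀ i, coordDeriv f x i v = 0 → coordDeriv f x i ≠ 0 →
      ∀ w, coordDeriv f x 2 w = 0 → coordDeriv f x i w = 0 → w = 0 := by
    intro i hiv hi w hw2 hwi
    by_contra hw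
    exact hi (eq_zero_of_det_ne_zero hiv hwi (det_ne_zero_of_apply hv2 hw2 hw))
  by_cases h0 : coordDeriv f x 0 = 0
  · refine ⟨1, Or.inr rfl, key 1 hv1 fun h1 => ?_⟩
    obtain ⟨w, hw, hw2⟩ := exists_ne_zero_apply_eq_zero (coordDeriv f x 2)
    exact hw (H.eq_zero_of_coordDeriv hx.1 (by rw [h0]; rfl) (by rw [h1]; rfl) hw2)
  · exact ⟨0, Or.inl rfl, key 0 hv0 h0⟩

/-- Height and one horizontal coordinate are a local chart, and the latter vanishes on axis points.
So the height is locally injective on a continuum, hence injective: each point of the axis is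
covered once. -/
theorem height_injOn_axisPoints : InjOn (fun x => f x 2) (axisPoints f K) := by
  have : CompactSpace (axisPoints f K) := isCompact_iff_compactSpace.1 H.isCompact_axisPoints
  have : PreconnectedSpace (axisPoints f K) :=
    isPreconnected_iff_preconnectedSpace.1 H.isPreconnected_axisPoints
  have hz : Continuous fun x : axisPoints f K => f x 2 :=
    continuousOn_iff_continuous_domRestrict.1
      ((H.coord_continuousOn 2).mono fun x hx => hx.1)
  have hinj := injective_of_locally_injective hz H.h_pos (by
    rw [← H.image_axisPoints, image_eq_range]) (fun x => by
      obtain ⟨i, hi, hind⟩ := H.exists_axis_chart x.2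
      obtain ⟨N, δ, hN, hxN, -, hδ, hbij, -, -⟩ :=
        exists_chart (H.coord_hasStrictFDerivAt x.2.1 2) (H.coord_hasStrictFDerivAt x.2.1 i)
          hind univ_mem
      refine ⟨Subtype.val ⁻¹' N, continuous_subtype_val.continuousAt.preimage_mem_nhds
        (hN.mem_nhds hxN), fun y hy w hw hyw => Subtype.ext (hbij.injOn hy hw ?_)⟩
      have h1 := radiusSq_eq_zero y.2.2
      have h2 := radiusSq_eq_zero w.2.2
      have hyw' : f y 2 = f w 2 := hyw
      rcases hi with rfl | rfl
      · simp only [h1.1, h2.1, hyw']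
      · simp only [h1.2, h2.2, hyw'])
  intro x hx y hy hxy
  exact congrArg Subtype.val (@hinj ⟨x, hx⟩ ⟨y, hy⟩ hxy)

/-- At an interior point the height would have an extremum, and its differential would vanish,
although it is part of a chart. -/
theorem mem_frontier_of_height {x : Plane} (hx : x ∈ axisPoints f K)
    (hxh : f x 2 = h ∨ f x 2 = 0) : x ∈ frontier K := by
  by_contra hxf
  have hxi := mem_interior_iff_mem_nhds.1 (mem_interior hx.1 hxf)
  have h2 := (H.coord_hasStrictFDerivAt hx.1 2).hasFDerivAt
  have hz : coordDeriv f x 2 = 0 := by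
    rcases hxh with hc | hc
    · refine IsLocalMax.hasFDerivAt_eq_zero ?_ h2
      filter_upwards [hxi] with y hy
      rw [hc]
      exact (H.height_mem hy).2
    · refine IsLocalMin.hasFDerivAt_eq_zero ?_ h2
      filter_upwards [hxi] with y hy
      rw [hc]
      exact (H.height_mem hy).1
  obtain ⟨i, -, hind⟩ := H.exists_axis_chart hx
  obtain ⟨w, hw, hw0⟩ := exists_ne_zero_apply_eq_zero (coordDeriv f x i)
  exact hw (hind w (by rw [hz]; rfl) hw0)

end IsCompetitor

/-! ### Signed polar coordinates -/

/-- The horizontal part of `f x` as a complex number. -/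
noncomputable def horizontal (f : Plane → Space) (x : Plane) : ℂ :=
  (f x 0 : ℂ) + (f x 1 : ℂ) * Complex.I

theorem norm_horizontal_sq (f : Plane → Space) (x : Plane) :
    ‖horizontal f x‖ ^ 2 = radiusSq f x := by
  rw [← Complex.normSq_eq_norm_sq, horizontal, Complex.normSq_add_mul_I, radiusSq]

/-- Squares of unit vectors differ by twice the sine of the angle between the lines. This turns a
cross product estimate into convergence of directions up to sign. -/
theorem norm_sq_div_sub_sq_div (w n : ℂ) (hw : w ≠ 0) (hn : n ≠ 0) :
    ‖w ^ 2 / (‖w‖ ^ 2 : ℝ) - n ^ 2 / (‖n‖ ^ 2 : ℝ)‖ =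
      2 * |w.im * n.re - w.re * n.im| / (‖w‖ * ‖n‖) := by
  have hw' : (starRingEnd ℂ) w ≠ 0 := (map_ne_zero _).2 hw
  have hn' : (starRingEnd ℂ) n ≠ 0 := (map_ne_zero _).2 hn
  have e1 : ((‖w‖ ^ 2 : ℝ) : ℂ) = w * (starRingEnd ℂ) w := by
    rw [Complex.mul_conj, Complex.normSq_eq_norm_sq]
  have e2 : ((‖n‖ ^ 2 : ℝ) : ℂ) = n * (starRingEnd ℂ) n := by
    rw [Complex.mul_conj, Complex.normSq_eq_norm_sq]
  have e3 : w ^ 2 / (‖w‖ ^ 2 : ℝ) - n ^ 2 / (‖n‖ ^ 2 : ℝ) =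
      (w * (starRingEnd ℂ) n - (starRingEnd ℂ) (w * (starRingEnd ℂ) n)) /
        ((starRingEnd ℂ) w * (starRingEnd ℂ) n) := by
    rw [e1, e2, map_mul, Complex.conj_conj]
    field_simp
  rw [e3, Complex.sub_conj, norm_div, norm_mul, norm_mul, Complex.norm_conj, Complex.norm_conj,
    Complex.norm_I, mul_one, Complex.norm_real, Real.norm_eq_abs, abs_mul, abs_two]
  congr 3
  simp [Complex.mul_im]
  ring_nf

namespace IsCompetitor

variable {r h φ₁ φ₂ : ℝ} {f : Plane → Space} {K : Set Plane} (H : IsCompetitor r h φ₁ φ₂ f K)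

include H

theorem horizontal_continuousOn : ContinuousOn (horizontal f) K :=
  (Complex.continuous_ofReal.comp_continuousOn (H.coord_continuousOn 0)).add
    ((Complex.continuous_ofReal.comp_continuousOn (H.coord_continuousOn 1)).mul continuousOn_const)

/-- The inverse of the height function on the axis points is continuous. -/
theorem eventually_exists_axisPoint {a : Plane} (ha : a ∈ axisPoints f K) {O : Set Plane}
    (hO : O ∈ 𝓝 a) : ∀ᶠ x in 𝓝[K] a, ∃ y ∈ axisPoints f K, y ∈ O ∧ f y 2 = f x 2 := by
  have hc : IsCompact (axisPoints f K \ interior O) := H.isCompact_axisPoints.diff isOpen_interior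
  have hcont : ContinuousOn (fun y => f y 2) (axisPoints f K \ interior O) :=
    (H.coord_continuousOn 2).mono fun y hy => hy.1.1
  have hcl : IsClosed ((fun y => f y 2) '' (axisPoints f K \ interior O)) :=
    (hc.image_of_continuousOn hcont).isClosed
  have hnot : f a 2 ∉ (fun y => f y 2) '' (axisPoints f K \ interior O) := by
    rintro ⟨y, hy, hya⟩
    have : y = a := H.height_injOn_axisPoints hy.1 ha hya
    exact hy.2 (this ▸ mem_interior_iff_mem_nhds.2 hO)
  have hev : ∀ᶠ x in 𝓝[K] a, f x 2 ∈ ((fun y => f y 2) '' (axisPoints f K \ interior O))ᶜ :=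
    (H.coord_continuousOn 2 a ha.1).eventually (hcl.isOpen_compl.mem_nhds hnot)
  filter_upwards [hev, self_mem_nhdsWithin] with x hx hxK
  have hxh := H.height_mem hxK
  rw [← H.image_axisPoints] at hxh
  obtain ⟨y, hy, hyx⟩ := hxh
  refine ⟨y, hy, ?_, hyx⟩
  by_contra hyO
  exact hx ⟨y, ⟨hy, fun h => hyO (interior_subset h)⟩, hyx⟩

/-- The tangent plane at a is spanned by the vertical and a horizontal n, so the component of f
normal to this plane has zero differential at a. Each x near a is compared with the axis point y of
the same height: f x - f y is horizontal, strict differentiability makes its normal component o(|x -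
y|), and the immersion bounds |x - y| by a multiple of |f x - f y|. -/
theorem eventually_horizontal_near_axis {a : Plane} (ha : a ∈ axisPoints f K) :
    ∃ n : ℂ, n ≠ 0 ∧ ∀ ε > 0, ∀ᶠ x in 𝓝[K] a,
      |(horizontal f x).im * n.re - (horizontal f x).re * n.im| ≤ ε * ‖horizontal f x‖ := by
  obtain ⟨v, hv, hv0, hv1⟩ := H.exists_vertical_tangent ha
  have hv2 : coordDeriv f a 2 v ≠ 0 := fun h2 => hv (H.eq_zero_of_coordDeriv ha.1 hv0 hv1 h2)
  obtain ⟨w, hw, hw2⟩ := exists_ne_zero_apply_eq_zero (coordDeriv f a 2)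
  set n : ℂ := ⟨coordDeriv f a 0 w, coordDeriv f a 1 w⟩ with hn
  refine ⟨n, fun h0 => ?_, fun ε hε => ?_⟩
  · rw [Complex.ext_iff] at h0
    exact hw (H.eq_zero_of_coordDeriv ha.1 h0.1 h0.2 hw2)
  have hk0 : n.re • coordDeriv f a 1 - n.im • coordDeriv f a 0 = 0 := by
    refine eq_zero_of_det_ne_zero (v := v) (w := w) ?_ ?_ (det_ne_zero_of_apply hv2 hw2 hw)
    · simp [hv0, hv1]
    · simp only [_root_.sub_apply, _root_.smul_apply, smul_eq_mul, hn]
      ring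
  have hk : HasStrictFDerivAt (fun y => n.re * f y 1 - n.im * f y 0) (0 : Plane →L[ℝ] ℝ) a := by
    rw [← hk0]
    exact ((H.coord_hasStrictFDerivAt ha.1 1).const_mul _).sub
      ((H.coord_hasStrictFDerivAt ha.1 0).const_mul _)
  obtain ⟨C, hC0, hC⟩ : ∃ C > 0, ∀ v, C * ‖v‖ ≤ ‖fderiv ℝ f a v‖ := by
    obtain ⟨c, hc0, hc⟩ := (fderiv ℝ f a).toLinearMap.exists_antilipschitzWith
      (LinearMap.ker_eq_bot.2 (H.immersed.immersion a ha.1))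
    refine ⟨(c : ℝ)⁻¹, by positivity, fun v => ?_⟩
    have := hc.le_mul_dist v 0
    simp only [dist_zero_right, map_zero] at this
    rw [inv_mul_le_iff₀ (by positivity)]
    exact this
  have h1 := hk.isLittleO.def (c := ε * (C / 2)) (by positivity)
  have h2 := (H.hasStrictFDerivAt ha.1).isLittleO.def (c := C / 2) (by positivity)
  rw [nhds_prod_eq] at h1 h2
  obtain ⟨O, hO, hOp⟩ := Filter.mem_prod_same_iff.1 (h1.and h2)
  filter_upwards [H.eventually_exists_axisPoint ha hO, nhdsWithin_le_nhds hO] with x hx hxO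
  obtain ⟨y, hy, hyO, hyx⟩ := hx
  obtain ⟨h3, h4⟩ := hOp (mk_mem_prod hxO hyO)
  have hy0 := radiusSq_eq_zero hy.2
  simp only [_root_.zero_apply, sub_zero, hy0.1, hy0.2, mul_zero,
    Real.norm_eq_abs] at h3
  have hnorm : ‖f x - f y‖ = ‖horizontal f x‖ := by
    rw [← sq_eq_sq₀ (norm_nonneg _) (norm_nonneg _), norm_horizontal_sq,
      EuclideanSpace.norm_sq_eq, Fin.sum_univ_three]
    simp [hy0.1, hy0.2, hyx, radiusSq]
  have h5 : C / 2 * ‖x - y‖ ≤ ‖horizontal f x‖ := by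
    have h6 := norm_sub_norm_le (fderiv ℝ f a (x - y)) (f x - f y)
    have h7 := hC (x - y)
    rw [norm_sub_rev] at h4
    simp only at h4
    rw [hnorm] at h6
    linarith
  have h8 : (horizontal f x).im * n.re - (horizontal f x).re * n.im
      = n.re * f x 1 - n.im * f x 0 := by
    simp [horizontal]
    ring
  rw [h8]
  calc |n.re * f x 1 - n.im * f x 0| ≤ ε * (C / 2) * ‖x - y‖ := h3
    _ = ε * (C / 2 * ‖x - y‖) := by ring
    _ ≤ ε * ‖horizontal f x‖ := by gcongr

/-- If axis points filled an open set, both horizontal coordinates would have zero differential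
there and df would have rank at most one. -/
theorem subset_closure_diff_axisPoints : K ⊆ closure (K \ axisPoints f K) := by
  have hint : interior K ⊆ closure (K \ axisPoints f K) := by
    intro x hx
    by_contra hxc
    have hev : ∀ᶠ y in 𝓝 x, y ∈ axisPoints f K := by
      filter_upwards [isClosed_closure.isOpen_compl.mem_nhds hxc,
        mem_interior_iff_mem_nhds.1 hx] with y hy hyK
      by_contra hyA
      exact hy (subset_closure ⟨hyK, hyA⟩)
    have hxK := interior_subset hx
    have hzero : ∀ i : Fin 3, (∀ᶠ y in 𝓝 x, f y i = 0) → coordDeriv f x i = 0 := by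
      intro i hi
      have h1 := (H.coord_hasStrictFDerivAt hxK i).hasFDerivAt
      have h2 : HasFDerivAt (fun y => f y i) (0 : Plane →L[ℝ] ℝ) x :=
        (hasFDerivAt_const (0 : ℝ) x).congr_of_eventuallyEq hi
      exact h1.unique h2
    have h0 := hzero 0 (hev.mono fun y hy => (radiusSq_eq_zero hy.2).1)
    have h1 := hzero 1 (hev.mono fun y hy => (radiusSq_eq_zero hy.2).2)
    obtain ⟨w, hw, hw2⟩ := exists_ne_zero_apply_eq_zero (coordDeriv f x 2)
    exact hw (H.eq_zero_of_coordDeriv hxK (by rw [h0]; rfl) (by rw [h1]; rfl) hw2)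
  exact H.subset_closure_interior.trans (closure_minimal hint isClosed_closure)

/-- The direction flips as the surface crosses the axis; squaring it removes the sign and yields a
limit. -/
theorem exists_tendsto_direction {a : Plane} (ha : a ∈ K) :
    ∃ q : ℂ, Tendsto (fun x => horizontal f x ^ 2 / (‖horizontal f x‖ ^ 2 : ℝ))
      (𝓝[K \ axisPoints f K] a) (𝓝 q) := by
  have hne : ∀ x ∈ K \ axisPoints f K, horizontal f x ≠ 0 := by
    rintro x ⟨hxK, hxA⟩ h0
    refine hxA ⟨hxK, ?_⟩
    rw [← norm_horizontal_sq, h0]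
    simp
  by_cases haA : a ∈ axisPoints f K
  · obtain ⟨n, hn, hev⟩ := H.eventually_horizontal_near_axis haA
    have hnpos : 0 < ‖n‖ := norm_pos_iff.2 hn
    refine ⟨n ^ 2 / (‖n‖ ^ 2 : ℝ), ?_⟩
    rw [Metric.tendsto_nhds]
    intro ε hε
    have h1 := hev (ε * ‖n‖ / 4) (by positivity)
    have h2 := h1.filter_mono (nhdsWithin_mono a (sdiff_subset : K \ axisPoints f K ⊆ K))
    filter_upwards [h2, self_mem_nhdsWithin] with x hx hxA
    have hw := hne x hxA
    have hwpos : 0 < ‖horizontal f x‖ := norm_pos_iff.2 hw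
    rw [dist_eq_norm, norm_sq_div_sub_sq_div _ _ hw hn, div_lt_iff₀ (by positivity)]
    calc 2 * |(horizontal f x).im * n.re - (horizontal f x).re * n.im|
        ≤ 2 * (ε * ‖n‖ / 4 * ‖horizontal f x‖) := by gcongr
      _ = ε * (‖horizontal f x‖ * ‖n‖) / 2 := by ring
      _ < ε * (‖horizontal f x‖ * ‖n‖) := half_lt_self (by positivity)
  · refine ⟨_, ContinuousWithinAt.tendsto (f := fun x => horizontal f x ^ 2 /
      (‖horizontal f x‖ ^ 2 : ℝ)) ?_⟩
    have h1 : ContinuousWithinAt (horizontal f) (K \ axisPoints f K) a :=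
      (H.horizontal_continuousOn a ha).mono sdiff_subset
    refine (h1.pow 2).div (Complex.continuous_ofReal.continuousAt.comp_continuousWithinAt
      (h1.norm.pow 2)) ?_
    have := norm_ne_zero_iff.2 (hne a ⟨ha, haA⟩)
    exact Complex.ofReal_ne_zero.2 (pow_ne_zero 2 this)

/-- The surface has global signed polar coordinates. -/
theorem exists_signed_polar : ∃ σ ψ : Plane → ℝ, ContinuousOn σ K ∧ ContinuousOn ψ K ∧
    ∀ x ∈ K, f x 0 = σ x * Real.cos (ψ x) ∧ f x 1 = σ x * Real.sin (ψ x) := by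
  obtain ⟨e, he⟩ := H.immersed.disk
  set q : Plane → ℂ := fun x => horizontal f x ^ 2 / (‖horizontal f x‖ ^ 2 : ℝ) with hq
  set g := extendFrom (K \ axisPoints f K) q with hg
  have hcl := H.subset_closure_diff_axisPoints
  have hgc : ContinuousOn g K :=
    continuousOn_extendFrom hcl fun x hx => H.exists_tendsto_direction hx
  have hne : ∀ x ∈ K \ axisPoints f K, horizontal f x ≠ 0 := by
    rintro x ⟨hxK, hxA⟩ h0
    refine hxA ⟨hxK, ?_⟩
    rw [← norm_horizontal_sq, h0]
    simp
  have hgt : ∀ x ∈ K, Tendsto q (𝓝[K \ axisPoints f K] x) (𝓝 (g x)) := fun x hx =>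
    tendsto_extendFrom (H.exists_tendsto_direction hx)
  have hg1 : ∀ x ∈ K, ‖g x‖ = 1 := by
    intro x hx
    have : (𝓝[K \ axisPoints f K] x).NeBot := mem_closure_iff_nhdsWithin_neBot.1 (hcl hx)
    have h1 := (hgt x hx).norm
    refine tendsto_nhds_unique h1 (tendsto_const_nhds.congr' ?_)
    filter_upwards [self_mem_nhdsWithin] with y hy
    have := norm_ne_zero_iff.2 (hne y hy)
    simp only [hq]
    rw [norm_div, norm_pow, Complex.norm_real, norm_pow, norm_norm, div_self (pow_ne_zero 2 this)]
  have hgq : ∀ x ∈ K \ axisPoints f K, g x = q x := by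
    intro x hx
    refine extendFrom_eq (hcl hx.1) ?_
    have h1 : ContinuousWithinAt (horizontal f) (K \ axisPoints f K) x :=
      (H.horizontal_continuousOn x hx.1).mono sdiff_subset
    refine (h1.pow 2).div (Complex.continuous_ofReal.continuousAt.comp_continuousWithinAt
      (h1.norm.pow 2)) ?_
    have := norm_ne_zero_iff.2 (hne x hx)
    exact Complex.ofReal_ne_zero.2 (pow_ne_zero 2 this)
  obtain ⟨Ψ, hΨ, hΨe⟩ := exists_continuousOn_arg e hgc fun x hx => by
    rw [← norm_ne_zero_iff, hg1 x hx]; exact one_ne_zero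
  have hψ : ContinuousOn (fun x => Ψ x / 2) K := hΨ.div_const 2
  -- Halving the argument of the squared direction gives a unit vector that is parallel to the
  -- horizontal part up to sign; the signed radius is the component along it.
  refine ⟨fun x => f x 0 * Real.cos (Ψ x / 2) + f x 1 * Real.sin (Ψ x / 2), fun x => Ψ x / 2,
    ?_, hψ, ?_⟩
  · exact ((H.coord_continuousOn 0).mul (Real.continuous_cos.comp_continuousOn hψ)).add
      ((H.coord_continuousOn 1).mul (Real.continuous_sin.comp_continuousOn hψ))
  · intro x hx
    set t := Ψ x / 2 with ht
    have hsc := Real.sin_sq_add_cos_sq t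
    have hτ : f x 1 * Real.cos t - f x 0 * Real.sin t = 0 := by
      by_cases hxA : x ∈ axisPoints f K
      · have := radiusSq_eq_zero hxA.2
        rw [this.1, this.2]
        simp
      · have h1 := hΨe x hx
        rw [hg1 x hx, hgq x ⟨hx, hxA⟩] at h1
        simp only [hq] at h1
        have hnz := norm_ne_zero_iff.2 (hne x ⟨hx, hxA⟩)
        rw [div_eq_iff (Complex.ofReal_ne_zero.2 (pow_ne_zero 2 hnz)), norm_horizontal_sq] at h1
        have hΨt : Ψ x = 2 * t := by rw [ht]; ring
        rw [hΨt] at h1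
        have hre := congrArg Complex.re h1
        have him := congrArg Complex.im h1
        rw [Complex.re_mul_ofReal] at hre
        rw [Complex.im_mul_ofReal] at him
        simp only [Complex.ofReal_one, one_mul] at hre him
        rw [Complex.exp_ofReal_mul_I_re] at hre
        rw [Complex.exp_ofReal_mul_I_im] at him
        have hre' : f x 0 ^ 2 - f x 1 ^ 2 = Real.cos (2 * t) * radiusSq f x := by
          rw [← hre]
          simp [horizontal, pow_two]
        have him' : 2 * f x 0 * f x 1 = Real.sin (2 * t) * radiusSq f x := by
          rw [← him]
          simp [horizontal, pow_two]
          ring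
        rw [Real.cos_two_mul] at hre'
        rw [Real.sin_two_mul] at him'
        unfold radiusSq at hre' him'
        have key : (f x 1 * Real.cos t - f x 0 * Real.sin t) ^ 2 = 0 := by
          have hs2 : Real.sin t ^ 2 = 1 - Real.cos t ^ 2 := by linarith
          have e1 : (f x 1 * Real.cos t - f x 0 * Real.sin t) ^ 2 =
              f x 1 ^ 2 * Real.cos t ^ 2 - (2 * f x 0 * f x 1) * (Real.sin t * Real.cos t)
                + f x 0 ^ 2 * Real.sin t ^ 2 := by ring
          rw [e1, him']
          have e2 : 2 * Real.sin t * Real.cos t * (f x 0 ^ 2 + f x 1 ^ 2) *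
              (Real.sin t * Real.cos t) =
                2 * Real.sin t ^ 2 * Real.cos t ^ 2 * (f x 0 ^ 2 + f x 1 ^ 2) := by ring
          rw [e2, hs2]
          linear_combination (1 / 2 - Real.cos t ^ 2) * hre'
        exact pow_eq_zero_iff (two_ne_zero) |>.1 key
    constructor
    · linear_combination -Real.sin t * hτ - f x 0 * hsc
    · linear_combination Real.cos t * hτ - f x 1 * hsc

end IsCompetitor

/-- Signed polar coordinates of `f` on `K`. -/
structure IsSignedPolar (f : Plane → Space) (K : Set Plane) (σ ψ : Plane → ℝ) : Prop where
  cont_radius : ContinuousOn σ K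
  cont_angle : ContinuousOn ψ K
  coord_zero : ∀ x ∈ K, f x 0 = σ x * Real.cos (ψ x)
  coord_one : ∀ x ∈ K, f x 1 = σ x * Real.sin (ψ x)

theorem IsSignedPolar.sq_eq {f : Plane → Space} {K : Set Plane} {σ ψ : Plane → ℝ}
    (P : IsSignedPolar f K σ ψ) {x : Plane} (hx : x ∈ K) : σ x ^ 2 = radiusSq f x := by
  rw [radiusSq, P.coord_zero x hx, P.coord_one x hx]
  linear_combination -σ x ^ 2 * Real.sin_sq_add_cos_sq (ψ x)

/-! ### The boundary over the two diameters -/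

/-- The boundary points at height `c` inside the open cylinder. -/
def endPoints (r : ℝ) (f : Plane → Space) (K : Set Plane) (c : ℝ) : Set Plane :=
  {x | x ∈ frontier K ∧ f x 2 = c ∧ radiusSq f x < r ^ 2}

namespace IsCompetitor

variable {r h φ₁ φ₂ : ℝ} {f : Plane → Space} {K : Set Plane} (H : IsCompetitor r h φ₁ φ₂ f K)
  {σ ψ : Plane → ℝ} (P : IsSignedPolar f K σ ψ) {c φ : ℝ} (hc : IsEnd h φ₁ φ₂ c φ)

include H hc

include P in
theorem eq_of_mem_endPoints {x : Plane} (hx : x ∈ endPoints r f K c) :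
    f x 0 = (Real.cos φ * f x 0 + Real.sin φ * f x 1) * Real.cos φ ∧
      f x 1 = (Real.cos φ * f x 0 + Real.sin φ * f x 1) * Real.sin φ ∧
      radiusSq f x = (Real.cos φ * f x 0 + Real.sin φ * f x 1) ^ 2 ∧
      σ x * Real.sin (ψ x - φ) = 0 ∧
      Real.cos φ * f x 0 + Real.sin φ * f x 1 = σ x * Real.cos (ψ x - φ) := by
  have hk := ((H.eventually_frontier hx.1 hx.2.2 hc hx.2.1).self_of_nhds hx.1).1
  have hsc := Real.sin_sq_add_cos_sq φ
  have hxK := H.frontier_subset hx.1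
  refine ⟨?_, ?_, ?_, ?_, ?_⟩
  · linear_combination -Real.sin φ * hk - f x 0 * hsc
  · linear_combination Real.cos φ * hk - f x 1 * hsc
  · unfold radiusSq
    linear_combination (-Real.sin φ * f x 0 + Real.cos φ * f x 1) * hk
      - (f x 0 ^ 2 + f x 1 ^ 2) * hsc
  · rw [P.coord_zero x hxK, P.coord_one x hxK] at hk
    rw [Real.sin_sub]
    linear_combination hk
  · rw [P.coord_zero x hxK, P.coord_one x hxK, Real.cos_sub]
    ring

/-- Near a boundary point the boundary is parametrized by the position along the diameter. -/
theorem exists_endPoints_chart {x : Plane} (hx : x ∈ endPoints r f K c) {W : Set Plane}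
    (hW : W ∈ 𝓝 x) : ∃ (N : Set Plane) (δ : ℝ), IsOpen N ∧ x ∈ N ∧ N ⊆ W ∧ 0 < δ ∧
      InjOn (fun y => Real.cos φ * f y 0 + Real.sin φ * f y 1) (endPoints r f K c ∩ N) ∧
      ∀ s, |s - (Real.cos φ * f x 0 + Real.sin φ * f x 1)| < δ →
        ∃ y ∈ endPoints r f K c ∩ N, Real.cos φ * f y 0 + Real.sin φ * f y 1 = s := by
  have hxK := H.frontier_subset hx.1
  obtain ⟨ξ, ξ', hξ, hind, -, hfr⟩ := H.exists_end_chart hx.1 hx.2.2 hc hx.2.1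
  have hη : HasStrictFDerivAt (fun y => Real.cos φ * f y 0 + Real.sin φ * f y 1)
      (Real.cos φ • coordDeriv f x 0 + Real.sin φ • coordDeriv f x 1) x :=
    ((H.coord_hasStrictFDerivAt hxK 0).const_mul _).add
      ((H.coord_hasStrictFDerivAt hxK 1).const_mul _)
  have hu : ∀ᶠ y in 𝓝 x, radiusSq f y < r ^ 2 :=
    (H.radiusSq_hasStrictFDerivAt hxK).continuousAt.eventually_lt continuousAt_const hx.2.2
  obtain ⟨N, δ, hN, hxN, hNW, hδ, hbij, -, -⟩ := exists_chart hη hξ hind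
    (inter_mem hW (hfr.and (hu.and (H.eventually_frontier hx.1 hx.2.2 hc hx.2.1))))
  have hx0 : ξ x = 0 := (hNW hxN).2.1.1 hx.1
  refine ⟨N, δ, hN, hxN, fun y hy => (hNW hy).1, hδ, ?_, ?_⟩
  · rintro y ⟨hyE, hyN⟩ w ⟨hwE, hwN⟩ hyw
    refine hbij.injOn hyN hwN (Prod.ext hyw ?_)
    have h1 : ξ y = 0 := (hNW hyN).2.1.1 hyE.1
    have h2 : ξ w = 0 := (hNW hwN).2.1.1 hwE.1
    exact h1.trans h2.symm
  · intro s hs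
    obtain ⟨y, hy, hye⟩ := hbij.surjOn
      (show (s, ξ x) ∈ ball (Real.cos φ * f x 0 + Real.sin φ * f x 1, ξ x) δ by
        rw [mem_ball, Prod.dist_eq, dist_self, Real.dist_eq]
        exact max_lt hs hδ)
    have h1 : Real.cos φ * f y 0 + Real.sin φ * f y 1 = s := (Prod.ext_iff.1 hye).1
    have h2 : ξ y = ξ x := (Prod.ext_iff.1 hye).2
    have hyf : y ∈ frontier K := (hNW hy).2.1.2 (h2.trans hx0)
    have h3 := ((hNW hy).2.2.2 hyf).2
    exact ⟨y, ⟨⟨hyf, by linarith, (hNW hy).2.2.1⟩, hy⟩, h1⟩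

include P

/-- Where σ ≠ 0 this says that f x lies on the diameter. At the point over the axis it follows by
continuity, since nearby boundary points have nonzero position along the diameter. -/
theorem sin_angle_sub_eq_zero {x : Plane} (hx : x ∈ endPoints r f K c) :
    Real.sin (ψ x - φ) = 0 := by
  by_contra hne
  have hxK := H.frontier_subset hx.1
  have hcont : ContinuousWithinAt (fun y => Real.sin (ψ y - φ)) K x :=
    Real.continuous_sin.continuousAt.comp_continuousWithinAt
      ((P.cont_angle x hxK).sub continuousWithinAt_const)
  have hev : ∀ᶠ y in 𝓝[K] x, Real.sin (ψ y - φ) ≠ 0 := hcont.eventually_ne hne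
  rw [eventually_nhdsWithin_iff] at hev
  obtain ⟨N, δ, hN, hxN, hNW, hδ, -, hsurj⟩ := H.exists_endPoints_chart hc hx hev
  set η := Real.cos φ * f x 0 + Real.sin φ * f x 1 with hη
  obtain ⟨s, hs, hs0⟩ : ∃ s, |s - η| < δ ∧ s ≠ 0 := by
    by_cases h0 : η = 0
    · exact ⟨δ / 2, by rw [h0, sub_zero, abs_of_pos] <;> linarith, by positivity⟩
    · exact ⟨η, by rw [sub_self, abs_zero]; exact hδ, h0⟩
  obtain ⟨y, ⟨hyE, hyN⟩, hys⟩ := hsurj s hs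
  obtain ⟨-, -, -, h4, h5⟩ := H.eq_of_mem_endPoints P hc hyE
  have hσ : σ y = 0 := (mul_eq_zero.1 h4).resolve_right (hNW hyN (H.frontier_subset hyE.1))
  rw [hσ, zero_mul, hys] at h5
  exact hs0 h5

/-- On these points ψ - φ takes values in the discrete set πℤ. -/
theorem eventually_angle_eq {x : Plane} (hx : x ∈ endPoints r f K c) :
    ∀ᶠ y in 𝓝 x, y ∈ endPoints r f K c → ψ y = ψ x := by
  have hxK := H.frontier_subset hx.1
  have hev : ∀ᶠ y in 𝓝[K] x, |ψ y - ψ x| < Real.pi := by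
    have : ContinuousWithinAt (fun y => |ψ y - ψ x|) K x :=
      ((P.cont_angle x hxK).sub continuousWithinAt_const).abs
    refine this.eventually (gt_mem_nhds ?_)
    simp [Real.pi_pos]
  rw [eventually_nhdsWithin_iff] at hev
  filter_upwards [hev] with y hy hyE
  have h1 := hy (H.frontier_subset hyE.1)
  have h2 : Real.sin (ψ y - ψ x) = 0 := by
    have e : ψ y - ψ x = (ψ y - φ) - (ψ x - φ) := by ring
    rw [e, Real.sin_sub, H.sin_angle_sub_eq_zero P hc hyE, H.sin_angle_sub_eq_zero P hc hx]
    simp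
  have h3 := abs_lt.1 h1
  have := (Real.sin_eq_zero_iff_of_lt_of_lt h3.1 h3.2).1 h2
  linarith

/-- As ψ - φ is locally a constant multiple of π, σ is plus or minus the position along the
diameter. This makes σ a local homeomorphism on the boundary arc. -/
theorem exists_sign {x : Plane} (hx : x ∈ endPoints r f K c) :
    ∃ ε : ℝ, (ε = 1 ∨ ε = -1) ∧ ∀ᶠ y in 𝓝 x, y ∈ endPoints r f K c →
      σ y = ε * (Real.cos φ * f y 0 + Real.sin φ * f y 1) := by
  have hs := H.sin_angle_sub_eq_zero P hc hx
  have hcos : Real.cos (ψ x - φ) = 1 ∨ Real.cos (ψ x - φ) = -1 := by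
    have := Real.sin_sq_add_cos_sq (ψ x - φ)
    rw [hs] at this
    exact sq_eq_one_iff.1 (by linarith)
  refine ⟨Real.cos (ψ x - φ), hcos, ?_⟩
  filter_upwards [H.eventually_angle_eq P hc hx] with y hy hyE
  obtain ⟨-, -, -, -, h5⟩ := H.eq_of_mem_endPoints P hc hyE
  rw [h5, hy hyE]
  rcases hcos with h | h <;> rw [h] <;> ring

theorem existsUnique_axis_endPoint : ∃! x : endPoints r f K c, σ x = 0 := by
  have hh := H.h_pos
  have hcI : c ∈ Icc 0 h := by
    rcases hc with ⟨rfl, -⟩ | ⟨rfl, -⟩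
    exacts [⟨hh.le, le_rfl⟩, ⟨le_rfl, hh.le⟩]
  rw [← H.image_axisPoints] at hcI
  obtain ⟨x, hx, hxc⟩ := hcI
  have hxc' : f x 2 = c := hxc
  have hxf : x ∈ frontier K := H.mem_frontier_of_height hx (by
    rcases hc with ⟨rfl, -⟩ | ⟨rfl, -⟩
    exacts [Or.inl hxc', Or.inr hxc'])
  have hr := H.r_pos
  refine ⟨⟨x, hxf, hxc', by rw [hx.2]; positivity⟩, ?_, ?_⟩
  · have := P.sq_eq hx.1
    rw [hx.2] at this
    exact pow_eq_zero_iff two_ne_zero |>.1 this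
  · rintro ⟨y, hy⟩ hy0
    have hy0' : σ y = 0 := hy0
    have hyK := H.frontier_subset hy.1
    have hyA : y ∈ axisPoints f K := ⟨hyK, by rw [← P.sq_eq hyK, hy0']; simp⟩
    refine Subtype.ext (H.height_injOn_axisPoints hyA hx ?_)
    exact hy.2.1.trans hxc'.symm

/-- `proper_local_homeo_interval` applied to σ: the diameter charts give openness and local
injectivity, and injectivity of the height on axis points gives the one-point fibre over 0. -/
theorem endPoints_radius_bijective :
    Function.Injective (fun x : endPoints r f K c => σ x) ∧
      range (fun x : endPoints r f K c => σ x) = Ioo (-r) r ∧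
      IsPreconnected (univ : Set (endPoints r f K c)) := by
  have hr := H.r_pos
  have hsub : endPoints r f K c ⊆ K := fun x hx => H.frontier_subset hx.1
  have hcont : Continuous fun x : endPoints r f K c => σ x :=
    continuousOn_iff_continuous_domRestrict.1 (P.cont_radius.mono hsub)
  refine proper_local_homeo_interval hcont hr ?_ ?_ ?_ ?_ (H.existsUnique_axis_endPoint P hc)
  · intro x
    refine abs_lt_of_sq_lt_sq ?_ hr.le
    rw [P.sq_eq (hsub x.2)]
    exact x.2.2.2
  · rw [isOpenMap_iff_nhds_le]
    intro x O hO
    rw [Filter.mem_map, nhds_subtype_eq_comap, Filter.mem_comap] at hO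
    obtain ⟨O', hO', hOO'⟩ := hO
    obtain ⟨ε, hε, hsgn⟩ := H.exists_sign P hc x.2
    obtain ⟨N, δ, hN, hxN, hNW, hδ, -, hsurj⟩ :=
      H.exists_endPoints_chart hc x.2 (inter_mem hO' hsgn)
    have hεε : ε * ε = 1 := by rcases hε with rfl | rfl <;> norm_num
    have habs : |ε| = 1 := by rcases hε with rfl | rfl <;> norm_num
    rw [Metric.mem_nhds_iff]
    refine ⟨δ, hδ, fun s hs => ?_⟩
    have hx := (hNW hxN).2 x.2
    have h1 : |ε * s - (Real.cos φ * f x 0 + Real.sin φ * f x 1)| < δ := by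
      have h2 : ε * s - (Real.cos φ * f x 0 + Real.sin φ * f x 1) = ε * (s - σ x) := by
        rw [hx]
        linear_combination -(Real.cos φ * f x 0 + Real.sin φ * f x 1) * -hεε
      rw [h2, abs_mul, habs, one_mul]
      exact hs
    obtain ⟨y, ⟨hyE, hyN⟩, hys⟩ := hsurj _ h1
    have h3 : σ y = s := by
      rw [(hNW hyN).2 hyE, hys, ← mul_assoc, hεε, one_mul]
    have h4 : (⟨y, hyE⟩ : endPoints r f K c) ∈ Subtype.val ⁻¹' O' := (hNW hyN).1
    have h5 := hOO' h4
    rw [mem_preimage] at h5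
    simpa [h3] using h5
  · intro x
    obtain ⟨ε, hε, hsgn⟩ := H.exists_sign P hc x.2
    obtain ⟨N, δ, hN, hxN, hNW, hδ, hinj, -⟩ := H.exists_endPoints_chart hc x.2 hsgn
    refine ⟨Subtype.val ⁻¹' N, continuous_subtype_val.continuousAt.preimage_mem_nhds
      (hN.mem_nhds hxN), fun y hy w hw hyw => Subtype.ext (hinj ⟨y.2, hy⟩ ⟨w.2, hw⟩ ?_)⟩
    have h1 := (hNW hy) y.2
    have h2 := (hNW hw) w.2
    have hyw' : σ y = σ w := hyw
    rw [h1, h2] at hyw'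
    have hε0 : ε ≠ 0 := by rcases hε with rfl | rfl <;> norm_num
    exact mul_left_cancel₀ hε0 hyw'
  · intro s hs
    rw [Topology.IsInducing.subtypeVal.isCompact_iff]
    -- Properness: for s < r the bound |σ| ≤ s implies the strict radius condition, so the set is
    -- closed in the compact K.
    have : Subtype.val '' {x : endPoints r f K c | |σ x| ≤ s} =
        (frontier K ∩ (fun x => f x 2) ⁻¹' {c}) ∩ (fun x => |σ x|) ⁻¹' Iic s := by
      ext x
      constructor
      · rintro ⟨x, hx, rfl⟩
        exact ⟨⟨x.2.1, x.2.2.1⟩, hx⟩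
      · rintro ⟨⟨hxf, hxc⟩, hxs⟩
        have hxs' : |σ x| ≤ s := hxs
        refine ⟨⟨x, hxf, hxc, ?_⟩, hxs, rfl⟩
        rw [← P.sq_eq (H.frontier_subset hxf), sq_lt_sq, abs_of_pos hr]
        linarith
    rw [this]
    have hfc : IsClosed (frontier K) := isClosed_frontier
    have h1 : IsClosed (frontier K ∩ (fun x => f x 2) ⁻¹' {c}) :=
      ((H.coord_continuousOn 2).mono H.frontier_subset).preimage_isClosed_of_isClosed hfc
        isClosed_singleton
    have h2 : IsClosed ((frontier K ∩ (fun x => f x 2) ⁻¹' {c}) ∩ (fun x => |σ x|) ⁻¹' Iic s) :=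
      (P.cont_radius.abs.mono fun x hx => H.frontier_subset hx.1).preimage_isClosed_of_isClosed h1
        isClosed_Iic
    exact H.isCompact.of_isClosed_subset h2 fun x hx => H.frontier_subset hx.1.1

/-- The signed radius parametrizes each of the two diameters, along which the angle is constant. -/
theorem existsUnique_endPoint {s : ℝ} (hs : s ∈ Ioo (-r) r) :
    ∃! x, x ∈ frontier K ∧ f x 2 = c ∧ σ x = s := by
  obtain ⟨hinj, hrange, -⟩ := H.endPoints_radius_bijective P hc
  have hr := H.r_pos
  have hmem : ∀ y, y ∈ frontier K → f y 2 = c → σ y = s → y ∈ endPoints r f K c := by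
    intro y hyf hyc hys
    refine ⟨hyf, hyc, ?_⟩
    rw [← P.sq_eq (H.frontier_subset hyf), hys]
    exact sq_lt_sq' hs.1 hs.2
  rw [← hrange] at hs
  obtain ⟨x, hx⟩ := hs
  refine ⟨x, ⟨x.2.1, x.2.2.1, hx⟩, ?_⟩
  rintro y ⟨hyf, hyc, hys⟩
  have := @hinj ⟨y, hmem y hyf hyc hys⟩ x (hys.trans hx.symm)
  exact congrArg Subtype.val this

theorem exists_end_angle : ∃ ψ₀ : ℝ, (∃ k : ℤ, ψ₀ = φ + k * Real.pi) ∧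
    ∀ x ∈ endPoints r f K c, ψ x = ψ₀ := by
  obtain ⟨-, -, hconn⟩ := H.endPoints_radius_bijective P hc
  obtain ⟨p, -, -⟩ := H.existsUnique_axis_endPoint P hc
  refine ⟨ψ p, ?_, ?_⟩
  · obtain ⟨k, hk⟩ := Real.sin_eq_zero_iff.1 (H.sin_angle_sub_eq_zero P hc p.2)
    exact ⟨k, by linarith⟩
  · intro x hx
    have hps : PreconnectedSpace (endPoints r f K c) := ⟨hconn⟩
    have hloc : IsLocallyConstant fun y : endPoints r f K c => ψ y := by
      rw [IsLocallyConstant.iff_eventually_eq]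
      intro y
      have := H.eventually_angle_eq P hc y.2
      rw [nhds_subtype_eq_comap]
      exact (this.comap Subtype.val).mono fun w hw => hw w.2
    exact hloc.apply_eq_of_preconnectedSpace ⟨x, hx⟩ p

end IsCompetitor

/-! ### The calibrating map -/

/-- The linear endomorphism of the plane with components `a` and `b`. -/
noncomputable def pairCLM (a b : Plane →L[ℝ] ℝ) : Plane →L[ℝ] Plane :=
  a.smulRight (EuclideanSpace.single 0 1) + b.smulRight (EuclideanSpace.single 1 1)

theorem pairCLM_det (a b : Plane →L[ℝ] ℝ) :
    (pairCLM a b).det = a (EuclideanSpace.single 0 1) * b (EuclideanSpace.single 1 1) -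
      a (EuclideanSpace.single 1 1) * b (EuclideanSpace.single 0 1) := by
  rw [ContinuousLinearMap.det, ← LinearMap.det_toMatrix (EuclideanSpace.basisFun (Fin 2) ℝ).toBasis,
    Matrix.det_fin_two]
  simp [LinearMap.toMatrix_apply, pairCLM]

/-- The density of the area of a helicoid with respect to the signed distance to its axis. -/
noncomputable def helixLength (h α s : ℝ) : ℝ := √(h ^ 2 + s ^ 2 * α ^ 2)

theorem helixLength_pos {h : ℝ} (hh : 0 < h) (α s : ℝ) : 0 < helixLength h α s := by
  unfold helixLength
  positivity

theorem continuous_helixLength (h α : ℝ) : Continuous (helixLength h α) := by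
  unfold helixLength
  fun_prop

theorem helixLength_sq (h α s : ℝ) : helixLength h α s ^ 2 = h ^ 2 + s ^ 2 * α ^ 2 :=
  Real.sq_sqrt (by positivity)

/-- The second component of the calibrating map. -/
noncomputable def helixCoord (h α : ℝ) (f : Plane → Space) (σ ψ : Plane → ℝ) (x : Plane) : ℝ :=
  (helixLength h α (σ x))⁻¹ * (σ x ^ 2 * α * ψ x + h * f x 2)

/-- The calibrating map. -/
noncomputable def calibration (h α : ℝ) (f : Plane → Space) (σ ψ : Plane → ℝ) (x : Plane) :
    Plane :=
  σ x • EuclideanSpace.single 0 1 + helixCoord h α f σ ψ x • EuclideanSpace.single 1 1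

theorem calibration_zero (h α : ℝ) (f : Plane → Space) (σ ψ : Plane → ℝ) (x : Plane) :
    calibration h α f σ ψ x 0 = σ x := by simp [calibration]

theorem calibration_one (h α : ℝ) (f : Plane → Space) (σ ψ : Plane → ℝ) (x : Plane) :
    calibration h α f σ ψ x 1 = helixCoord h α f σ ψ x := by simp [calibration]

/-- The differential of the signed radius. -/
noncomputable def radiusDeriv (f : Plane → Space) (ψ : Plane → ℝ) (x : Plane) : Plane →L[ℝ] ℝ :=
  Real.cos (ψ x) • coordDeriv f x 0 + Real.sin (ψ x) • coordDeriv f x 1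

/-- The signed radius times the differential of the angle. -/
noncomputable def arcDeriv (f : Plane → Space) (ψ : Plane → ℝ) (x : Plane) : Plane →L[ℝ] ℝ :=
  -Real.sin (ψ x) • coordDeriv f x 0 + Real.cos (ψ x) • coordDeriv f x 1

/-- The exterior product of two functionals on the plane. -/
noncomputable def wedge (a b : Plane →L[ℝ] ℝ) : ℝ :=
  a (EuclideanSpace.single 0 1) * b (EuclideanSpace.single 1 1) -
    a (EuclideanSpace.single 1 1) * b (EuclideanSpace.single 0 1)

/-- The area element is the norm of the bivector ∂₁f ∧ ∂₂f, which may be computed in any orthonormal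
frame, here the cylindrical one turned by an arbitrary angle. -/
theorem areaElement_eq (f : Plane → Space) (ψ : Plane → ℝ) (x : Plane) :
    areaElement f x = √(wedge (radiusDeriv f ψ x) (arcDeriv f ψ x) ^ 2 +
      wedge (radiusDeriv f ψ x) (coordDeriv f x 2) ^ 2 +
      wedge (arcDeriv f ψ x) (coordDeriv f x 2) ^ 2) := by
  unfold areaElement
  simp only
  congr 1
  rw [EuclideanSpace.norm_sq_eq, EuclideanSpace.norm_sq_eq, PiLp.inner_apply]
  simp only [Fin.sum_univ_three, Real.norm_eq_abs, sq_abs, wedge, radiusDeriv, arcDeriv,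
    _root_.add_apply, _root_.smul_apply, smul_eq_mul, coordDeriv_apply, RCLike.inner_apply,
    conj_trivial]
  generalize fderiv ℝ f x (EuclideanSpace.single 0 1) = a
  generalize fderiv ℝ f x (EuclideanSpace.single 1 1) = b
  have hs : Real.sin (ψ x) ^ 2 = 1 - Real.cos (ψ x) ^ 2 := by
    linarith [Real.sin_sq_add_cos_sq (ψ x)]
  generalize Real.sin (ψ x) = s at *
  generalize Real.cos (ψ x) = c at *
  have hcs : c ^ 2 + s ^ 2 = 1 := by linarith
  have e1 : (c * a 0 + s * a 1) * (-s * b 0 + c * b 1) - (c * b 0 + s * b 1) * (-s * a 0 + c * a 1)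
      = a 0 * b 1 - a 1 * b 0 := by
    linear_combination (a 0 * b 1 - a 1 * b 0) * hcs
  rw [e1]
  linear_combination -((a 0 * b 2 - b 0 * a 2) ^ 2 + (a 1 * b 2 - b 1 * a 2) ^ 2) * hcs

namespace IsCompetitor

variable {r h φ₁ φ₂ : ℝ} {f : Plane → Space} {K : Set Plane} (H : IsCompetitor r h φ₁ φ₂ f K)
  {σ ψ : Plane → ℝ} (P : IsSignedPolar f K σ ψ)

include P in
theorem radius_ne_zero {x : Plane} (hx : x ∈ K \ axisPoints f K) : σ x ≠ 0 := by
  intro h0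
  refine hx.2 ⟨hx.1, ?_⟩
  rw [← P.sq_eq hx.1, h0]
  simp

include H P

/-- ψ comes only with continuity. In the frame turned by ψ x it equals, near x, ψ x plus the
arctangent of a quotient of differentiable functions whose denominator is σ x ≠ 0 at x. -/
theorem angle_hasFDerivAt {x : Plane} (hx : x ∈ interior K) (hxA : x ∉ axisPoints f K) :
    HasFDerivAt ψ ((σ x)⁻¹ • arcDeriv f ψ x) x := by
  have hxK := interior_subset hx
  have hσ : σ x ≠ 0 := radius_ne_zero P ⟨hxK, hxA⟩
  have hKx := mem_interior_iff_mem_nhds.1 hx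
  have h0 := (H.coord_hasStrictFDerivAt hxK 0).hasFDerivAt
  have h1 := (H.coord_hasStrictFDerivAt hxK 1).hasFDerivAt
  have hB : HasFDerivAt (fun y => -Real.sin (ψ x) * f y 0 + Real.cos (ψ x) * f y 1)
      (arcDeriv f ψ x) x := (h0.const_mul _).add (h1.const_mul _)
  have hA : HasFDerivAt (fun y => Real.cos (ψ x) * f y 0 + Real.sin (ψ x) * f y 1)
      (radiusDeriv f ψ x) x := (h0.const_mul _).add (h1.const_mul _)
  have hAx : Real.cos (ψ x) * f x 0 + Real.sin (ψ x) * f x 1 = σ x := by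
    rw [P.coord_zero x hxK, P.coord_one x hxK]
    linear_combination σ x * Real.sin_sq_add_cos_sq (ψ x)
  have hBx : -Real.sin (ψ x) * f x 0 + Real.cos (ψ x) * f x 1 = 0 := by
    rw [P.coord_zero x hxK, P.coord_one x hxK]
    ring
  have hAi := (hasDerivAt_inv (by rw [hAx]; exact hσ)).comp_hasFDerivAt x hA
  have hq := (hB.mul hAi).arctan.add_const (ψ x)
  have hev : ψ =ᶠ[𝓝 x] fun y => Real.arctan
      ((-Real.sin (ψ x) * f y 0 + Real.cos (ψ x) * f y 1) *
        (Real.cos (ψ x) * f y 0 + Real.sin (ψ x) * f y 1)⁻¹) + ψ x := by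
    have hψc : ContinuousAt ψ x := P.cont_angle.continuousAt hKx
    have hσc : ContinuousAt σ x := P.cont_radius.continuousAt hKx
    have h2 : ∀ᶠ y in 𝓝 x, |ψ y - ψ x| < Real.pi / 2 := by
      have : ContinuousAt (fun y => |ψ y - ψ x|) x := (hψc.sub continuousAt_const).abs
      refine this.eventually_lt continuousAt_const ?_
      rw [sub_self, abs_zero]
      exact Real.pi_div_two_pos
    filter_upwards [h2, hKx, hσc.eventually_ne hσ] with y hy hyK hyσ
    have e1 : -Real.sin (ψ x) * f y 0 + Real.cos (ψ x) * f y 1 = σ y * Real.sin (ψ y - ψ x) := by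
      rw [P.coord_zero y hyK, P.coord_one y hyK, Real.sin_sub]
      ring
    have e2 : Real.cos (ψ x) * f y 0 + Real.sin (ψ x) * f y 1 = σ y * Real.cos (ψ y - ψ x) := by
      rw [P.coord_zero y hyK, P.coord_one y hyK, Real.cos_sub]
      ring
    have hy' := abs_lt.1 hy
    have e3 : σ y * Real.sin (ψ y - ψ x) * (σ y * Real.cos (ψ y - ψ x))⁻¹ =
        Real.tan (ψ y - ψ x) := by
      rw [Real.tan_eq_sin_div_cos, ← div_eq_mul_inv, mul_div_mul_left _ _ hyσ]
    rw [e1, e2, e3, Real.arctan_tan hy'.1 hy'.2]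
    ring
  refine (hq.congr_of_eventuallyEq hev).congr_fderiv ?_
  simp only [Pi.mul_apply, Function.comp_apply, hAx, hBx]
  simp

theorem radius_hasFDerivAt {x : Plane} (hx : x ∈ interior K) (hxA : x ∉ axisPoints f K) :
    HasFDerivAt σ (radiusDeriv f ψ x) x := by
  have hxK := interior_subset hx
  have hKx := mem_interior_iff_mem_nhds.1 hx
  have h0 := (H.coord_hasStrictFDerivAt hxK 0).hasFDerivAt
  have h1 := (H.coord_hasStrictFDerivAt hxK 1).hasFDerivAt
  have hψ := H.angle_hasFDerivAt P hx hxA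
  have hq := (h0.mul hψ.cos).add (h1.mul hψ.sin)
  have hev : σ =ᶠ[𝓝 x] fun y => f y 0 * Real.cos (ψ y) + f y 1 * Real.sin (ψ y) := by
    filter_upwards [hKx] with y hy
    rw [P.coord_zero y hy, P.coord_one y hy]
    linear_combination -σ y * Real.sin_sq_add_cos_sq (ψ y)
  refine (hq.congr_of_eventuallyEq hev).congr_fderiv ?_
  ext v
  simp only [P.coord_zero x hxK, P.coord_one x hxK, radiusDeriv, _root_.add_apply,
    _root_.smul_apply, smul_eq_mul]
  ring

/-- The coefficient β is left unspecified because multiples of dσ do not affect the Jacobian. -/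
theorem helixCoord_hasFDerivAt (α : ℝ) {x : Plane} (hx : x ∈ interior K)
    (hxA : x ∉ axisPoints f K) :
    ∃ β : ℝ, HasFDerivAt (helixCoord h α f σ ψ) (β • radiusDeriv f ψ x +
      (helixLength h α (σ x))⁻¹ • ((σ x * α) • arcDeriv f ψ x + h • coordDeriv f x 2)) x := by
  have hxK := interior_subset hx
  have hσ0 : σ x ≠ 0 := radius_ne_zero P ⟨hxK, hxA⟩
  have h2 := (H.coord_hasStrictFDerivAt hxK 2).hasFDerivAt
  have hψ := H.angle_hasFDerivAt P hx hxA
  have hσ := H.radius_hasFDerivAt P hx hxA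
  have hh := H.h_pos
  have hL : DifferentiableAt ℝ (fun s => (helixLength h α s)⁻¹) (σ x) := by
    refine DifferentiableAt.inv ?_ (helixLength_pos hh α _).ne'
    unfold helixLength
    refine DifferentiableAt.sqrt (by fun_prop) ?_
    positivity
  have hc := hL.hasDerivAt.comp_hasFDerivAt x hσ
  have hm := hc.mul ((((hσ.pow 2).mul_const α).mul hψ).add (h2.const_mul h))
  refine ⟨(helixLength h α (σ x))⁻¹ * (2 * σ x * α * ψ x) +
    (σ x ^ 2 * α * ψ x + h * f x 2) * deriv (fun s => (helixLength h α s)⁻¹) (σ x),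
    hm.congr_fderiv ?_⟩
  ext v
  simp only [_root_.add_apply, _root_.smul_apply, smul_eq_mul, Function.comp_apply, nsmul_eq_mul,
    Pi.add_apply, Pi.mul_apply]
  field_simp
  push_cast
  ring

/-- The Jacobian of the calibrating map. -/
theorem calibration_hasFDerivAt (α : ℝ) {x : Plane} (hx : x ∈ interior K)
    (hxA : x ∉ axisPoints f K) :
    ∃ G' : Plane →L[ℝ] Plane, HasFDerivAt (calibration h α f σ ψ) G' x ∧
      G'.det = (helixLength h α (σ x))⁻¹ * (σ x * α * wedge (radiusDeriv f ψ x) (arcDeriv f ψ x) +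
        h * wedge (radiusDeriv f ψ x) (coordDeriv f x 2)) := by
  obtain ⟨β, hβ⟩ := H.helixCoord_hasFDerivAt P α hx hxA
  refine ⟨_, ((H.radius_hasFDerivAt P hx hxA).smul_const _).add (hβ.smul_const _), ?_⟩
  refine (pairCLM_det _ _).trans ?_
  simp only [_root_.add_apply, _root_.smul_apply, smul_eq_mul, wedge]
  ring

omit H P in
-- Cauchy-Schwarz against the unit vector (sα, h, 0)/L(s).
theorem abs_calibration_det_le (hh : 0 < h) (α s a b c : ℝ) :
    |(helixLength h α s)⁻¹ * (s * α * a + h * b)| ≤ √(a ^ 2 + b ^ 2 + c ^ 2) := by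
  have hL := helixLength_pos hh α s
  apply Real.abs_le_sqrt
  rw [mul_pow, inv_pow, helixLength_sq, inv_mul_le_iff₀ (by positivity)]
  nlinarith [sq_nonneg (h * a - s * α * b), sq_nonneg (h * c), sq_nonneg (s * α * c)]

omit H P in
-- Equality in Cauchy-Schwarz forces (a, b, c) to be parallel to (sα, h, 0).
theorem eq_zero_of_calibration_det_eq (hh : 0 < h) (α s a b c : ℝ)
    (heq : |(helixLength h α s)⁻¹ * (s * α * a + h * b)| = √(a ^ 2 + b ^ 2 + c ^ 2)) :
    c = 0 ∧ h * a = s * α * b := by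
  have hL := helixLength_pos hh α s
  have h1 : ((helixLength h α s)⁻¹ * (s * α * a + h * b)) ^ 2 = a ^ 2 + b ^ 2 + c ^ 2 := by
    rw [← sq_abs, heq, Real.sq_sqrt (by positivity)]
  rw [mul_pow, inv_pow, helixLength_sq, inv_mul_eq_iff_eq_mul₀ (by positivity)] at h1
  have h2 : (h * a - s * α * b) ^ 2 + (h * c) ^ 2 + (s * α * c) ^ 2 = 0 := by
    linear_combination -h1
  have h3 : h * c = 0 := by
    nlinarith [sq_nonneg (h * a - s * α * b), sq_nonneg (h * c), sq_nonneg (s * α * c)]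
  have h4 : h * a - s * α * b = 0 := by
    nlinarith [sq_nonneg (h * a - s * α * b), sq_nonneg (h * c), sq_nonneg (s * α * c)]
  exact ⟨(mul_eq_zero.1 h3).resolve_left hh.ne', by linarith⟩

theorem abs_det_le_areaElement (α : ℝ) {x : Plane} (hx : x ∈ interior K)
    (hxA : x ∉ axisPoints f K) :
    ∃ G' : Plane →L[ℝ] Plane, HasFDerivAt (calibration h α f σ ψ) G' x ∧
      |G'.det| ≤ areaElement f x ∧ (|G'.det| = areaElement f x →
        wedge (arcDeriv f ψ x) (coordDeriv f x 2) = 0 ∧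
        h * wedge (radiusDeriv f ψ x) (arcDeriv f ψ x) =
          σ x * α * wedge (radiusDeriv f ψ x) (coordDeriv f x 2)) := by
  obtain ⟨G', hG, hdet⟩ := H.calibration_hasFDerivAt P α hx hxA
  refine ⟨G', hG, ?_, fun heq => ?_⟩
  · rw [hdet, areaElement_eq f ψ x]
    exact abs_calibration_det_le H.h_pos α _ _ _ _
  · rw [hdet, areaElement_eq f ψ x] at heq
    exact eq_zero_of_calibration_det_eq H.h_pos α _ _ _ _ heq

end IsCompetitor

/-! ### The area of the helicoid -/

/-- The area of a helicoid of radius `r` and height `h` that turns by the angle `α`. -/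
noncomputable def profileArea (r h α : ℝ) : ℝ≥0∞ :=
  ∫⁻ s in Ioo (-r) r, ENNReal.ofReal (helixLength h α s)

theorem measurePreserving_coords :
    MeasurePreserving (fun x : Plane => (x 0, x 1)) volume volume :=
  (volume_preserving_finTwoArrow ℝ).comp (PiLp.volume_preserving_ofLp (Fin 2))

theorem contDiff_helicoidMap (φ ω : ℝ) : ContDiff ℝ 1 (helicoidMap φ ω) := by
  rw [contDiff_euclidean]
  intro i
  fin_cases i <;> simp [helicoidMap] <;> fun_prop

theorem helicoidMap_coordDeriv (φ ω : ℝ) (x : Plane) :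
    radiusDeriv (helicoidMap φ ω) (fun y => φ + ω * y 1) x =
        (EuclideanSpace.proj 0 : Plane →L[ℝ] ℝ) ∧
      arcDeriv (helicoidMap φ ω) (fun y => φ + ω * y 1) x =
        (x 0 * ω) • (EuclideanSpace.proj 1 : Plane →L[ℝ] ℝ) ∧
      coordDeriv (helicoidMap φ ω) x 2 = (EuclideanSpace.proj 1 : Plane →L[ℝ] ℝ) := by
  have hd : HasFDerivAt (helicoidMap φ ω) (fderiv ℝ (helicoidMap φ ω) x) x :=
    ((contDiff_helicoidMap φ ω).differentiable one_ne_zero x).hasFDerivAt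
  have hi : ∀ i : Fin 3, HasFDerivAt (fun y => helicoidMap φ ω y i)
      (coordDeriv (helicoidMap φ ω) x i) x := fun i =>
    ((EuclideanSpace.proj i : Space →L[ℝ] ℝ).hasFDerivAt).comp x hd
  have p0 : HasFDerivAt (fun y : Plane => y 0) (EuclideanSpace.proj 0 : Plane →L[ℝ] ℝ) x :=
    (EuclideanSpace.proj 0 : Plane →L[ℝ] ℝ).hasFDerivAt
  have p1 : HasFDerivAt (fun y : Plane => y 1) (EuclideanSpace.proj 1 : Plane →L[ℝ] ℝ) x :=
    (EuclideanSpace.proj 1 : Plane →L[ℝ] ℝ).hasFDerivAt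
  have pψ := (p1.const_mul ω).const_add φ
  have e0 := (hi 0).unique (p0.mul pψ.cos)
  have e1 := (hi 1).unique (p0.mul pψ.sin)
  have e2 := (hi 2).unique p1
  have hsc := Real.sin_sq_add_cos_sq (φ + ω * x 1)
  refine ⟨?_, ?_, e2⟩
  · unfold radiusDeriv
    rw [e0, e1]
    ext v
    simp only [_root_.add_apply, _root_.smul_apply, smul_eq_mul]
    linear_combination (EuclideanSpace.proj 0 : Plane →L[ℝ] ℝ) v * hsc
  · unfold arcDeriv
    rw [e0, e1]
    ext v
    simp only [_root_.add_apply, _root_.smul_apply, smul_eq_mul]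
    linear_combination x 0 * ω * (EuclideanSpace.proj 1 : Plane →L[ℝ] ℝ) v * hsc

theorem areaElement_helicoidMap (φ ω : ℝ) (x : Plane) :
    areaElement (helicoidMap φ ω) x = √((x 0 * ω) ^ 2 + 1) := by
  obtain ⟨e0, e1, e2⟩ := helicoidMap_coordDeriv φ ω x
  rw [areaElement_eq _ (fun y => φ + ω * y 1), e0, e1, e2]
  congr 1
  simp [wedge]

theorem helicoidArea_eq {r h : ℝ} (hh : 0 < h) (φ θ : ℝ) :
    helicoidArea r h φ θ = profileArea r h θ := by
  unfold helicoidArea area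
  simp only [areaElement_helicoidMap]
  have hrect : parameterRectangle r h = (fun x : Plane => (x 0, x 1)) ⁻¹' (Icc (-r) r ×ˢ Icc 0 h) :=
    rfl
  have hm : Measurable fun p : ℝ × ℝ => ENNReal.ofReal √((p.1 * (θ / h)) ^ 2 + 1) := by
    fun_prop
  rw [hrect, measurePreserving_coords.setLIntegral_comp_preimage
    (measurableSet_Icc.prod measurableSet_Icc) hm, Measure.volume_eq_prod,
    setLIntegral_prod _ hm.aemeasurable]
  unfold profileArea
  rw [← setLIntegral_congr Ioo_ae_eq_Icc]
  refine lintegral_congr fun s => ?_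
  dsimp only
  rw [setLIntegral_const, Real.volume_Icc, ← ENNReal.ofReal_mul (Real.sqrt_nonneg _)]
  congr 1
  unfold helixLength
  rw [sub_zero]
  nth_rewrite 2 [← Real.sqrt_sq hh.le]
  rw [← Real.sqrt_mul (by positivity)]
  congr 1
  field_simp
  ring

theorem profileArea_ne_top (r h α : ℝ) : profileArea r h α ≠ ∞ := by
  unfold profileArea
  have h1 : IntegrableOn (helixLength h α) (Ioo (-r) r) :=
    ((continuous_helixLength h α).continuousOn.integrableOn_compact isCompact_Icc).mono_set
      Ioo_subset_Icc_self
  exact h1.lintegral_lt_top.ne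

theorem profileArea_mono (r h : ℝ) {θ α : ℝ} (hle : |θ| ≤ |α|) :
    profileArea r h θ ≤ profileArea r h α := by
  refine lintegral_mono fun s => ENNReal.ofReal_le_ofReal (Real.sqrt_le_sqrt ?_)
  have := sq_le_sq.2 hle
  have := mul_le_mul_of_nonneg_left this (sq_nonneg s)
  linarith

theorem profileArea_strictMono {r h : ℝ} (hr : 0 < r) (hh : 0 < h) {θ α : ℝ} (hlt : |θ| < |α|) :
    profileArea r h θ < profileArea r h α := by
  refine lintegral_strict_mono ?_ ?_ (profileArea_ne_top r h θ) ?_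
  · rw [Ne, Measure.restrict_eq_zero, Real.volume_Ioo, ENNReal.ofReal_eq_zero]
    linarith
  · exact (ENNReal.measurable_ofReal.comp (continuous_helixLength h α).measurable).aemeasurable
  · refine ae_restrict_of_ae ?_
    -- On the axis both densities equal h; off it they differ strictly.
    have h0 : ∀ᵐ s : ℝ, s ≠ 0 := by
      rw [ae_iff]
      simp
    filter_upwards [h0] with s hs
    refine (ENNReal.ofReal_lt_ofReal_iff (helixLength_pos hh α s)).2 (Real.sqrt_lt_sqrt
      (by positivity) ?_)
    have h1 := sq_lt_sq.2 hlt
    have h2 : 0 < s ^ 2 := by positivity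
    nlinarith

/-- The lower boundary of the image of the calibrating map, for `e = 0`, and the upper one, for
`e = h`. -/
noncomputable def helixBound (h α e p s : ℝ) : ℝ :=
  (helixLength h α s)⁻¹ * (s ^ 2 * α * p + h * e)

theorem continuous_helixBound {h : ℝ} (hh : 0 < h) (α e p : ℝ) :
    Continuous (helixBound h α e p) := by
  unfold helixBound
  exact ((continuous_helixLength h α).inv₀ fun s => (helixLength_pos hh α s).ne').mul (by fun_prop)

/-- The image of the calibrating map without its boundary and the axis. -/
noncomputable def calibratedRegion (r h ψ₁ ψ₂ : ℝ) : Set Plane :=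
  (fun x : Plane => (x 0, x 1)) ⁻¹' regionBetween (helixBound h (ψ₁ - ψ₂) 0 ψ₂)
    (helixBound h (ψ₁ - ψ₂) h ψ₁) (Ioo (-r) r \ {0})

/-- The difference of the bounds is (s²α² + h²)/L(s) with α = ψ₁ - ψ₂. Thus vertical slices of the
calibrated region have exactly the length that the area of the helicoid requires. -/
theorem helixBound_sub {h : ℝ} (hh : 0 < h) (ψ₁ ψ₂ s : ℝ) :
    helixBound h (ψ₁ - ψ₂) h ψ₁ s - helixBound h (ψ₁ - ψ₂) 0 ψ₂ s = helixLength h (ψ₁ - ψ₂) s := by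
  unfold helixBound
  have h1 := helixLength_pos hh (ψ₁ - ψ₂) s
  have h2 := helixLength_sq h (ψ₁ - ψ₂) s
  rw [← mul_sub, inv_mul_eq_iff_eq_mul₀ h1.ne']
  linear_combination -h2

theorem volume_calibratedRegion {r h : ℝ} (hh : 0 < h) (ψ₁ ψ₂ : ℝ) :
    volume (calibratedRegion r h ψ₁ ψ₂) = profileArea r h (ψ₁ - ψ₂) := by
  have hs : MeasurableSet (Ioo (-r) r \ {0}) := measurableSet_Ioo.diff (measurableSet_singleton 0)
  have h1 := (continuous_helixBound hh (ψ₁ - ψ₂) 0 ψ₂).measurable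
  have h2 := (continuous_helixBound hh (ψ₁ - ψ₂) h ψ₁).measurable
  unfold calibratedRegion profileArea
  rw [measurePreserving_coords.measure_preimage
    (measurableSet_regionBetween h1 h2 hs).nullMeasurableSet, Measure.volume_eq_prod,
    volume_regionBetween_eq_lintegral h1.aemeasurable h2.aemeasurable hs]
  have hae : (Ioo (-r) r \ {0} : Set ℝ) =ᵐ[volume] Ioo (-r) r :=
    sdiff_null_ae_eq_self (by simp)
  rw [setLIntegral_congr hae]
  refine lintegral_congr fun s => ?_
  rw [Pi.sub_apply, helixBound_sub hh]

/-! ### The calibrating map covers the region; the lower bound -/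

namespace IsCompetitor

variable {r h φ₁ φ₂ : ℝ} {f : Plane → Space} {K : Set Plane} (H : IsCompetitor r h φ₁ φ₂ f K)
  {σ ψ : Plane → ℝ} (P : IsSignedPolar f K σ ψ) {ψ₁ ψ₂ : ℝ}
  (h₁ : ∀ x ∈ endPoints r f K h, ψ x = ψ₁) (h₂ : ∀ x ∈ endPoints r f K 0, ψ x = ψ₂)

include H

theorem isOpen_interior_diff : IsOpen (interior K \ axisPoints f K) :=
  isOpen_interior.sdiff H.isCompact_axisPoints.isClosed

include P

theorem helixCoord_continuousOn (α : ℝ) : ContinuousOn (helixCoord h α f σ ψ) K := by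
  unfold helixCoord
  refine ContinuousOn.mul ?_ ?_
  · refine ContinuousOn.inv₀ ((continuous_helixLength h α).comp_continuousOn P.cont_radius)
      fun x _ => (helixLength_pos H.h_pos α _).ne'
  · exact (((P.cont_radius.pow 2).mul continuousOn_const).mul P.cont_angle).add
      (continuousOn_const.mul (H.coord_continuousOn 2))

include h₁ h₂

/-- The line σ = s meets the boundary of K exactly in one point A over the top diameter and one
point B over the bottom one, and their second coordinates are the two bounds.
`exists_eq_of_boundary_crossing` supplies the values in between. The radius 0 is left out so that
the preimages avoid the axis, where the map need not be differentiable. -/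
theorem calibratedRegion_subset :
    calibratedRegion r h ψ₁ ψ₂ ⊆
      calibration h (ψ₁ - ψ₂) f σ ψ '' (interior K \ axisPoints f K) := by
  rintro p ⟨⟨hp, hp0⟩, hpl, hpu⟩
  obtain ⟨e, he⟩ := H.immersed.disk
  set α := ψ₁ - ψ₂ with hα
  have hr := H.r_pos
  have hhp := H.h_pos
  have htop : IsEnd h φ₁ φ₂ h φ₁ := Or.inl ⟨rfl, rfl⟩
  have hbot : IsEnd h φ₁ φ₂ 0 φ₂ := Or.inr ⟨rfl, rfl⟩
  change p 0 ∈ Ioo (-r) r at hp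
  change helixBound h α 0 ψ₂ (p 0) < p 1 at hpl
  change p 1 < helixBound h α h ψ₁ (p 0) at hpu
  have hsq : ∀ x ∈ K, ∀ s ∈ Ioo (-r) r, σ x = s → radiusSq f x < r ^ 2 := by
    intro x hx s hs hxs
    rw [← P.sq_eq hx, hxs]
    exact sq_lt_sq' hs.1 hs.2
  obtain ⟨A, ⟨hAf, hAz, hAσ⟩, hAu⟩ := H.existsUnique_endPoint P htop hp
  obtain ⟨B, ⟨hBf, hBz, hBσ⟩, hBu⟩ := H.existsUnique_endPoint P hbot hp
  have hAK := H.frontier_subset hAf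
  have hBK := H.frontier_subset hBf
  have hAψ : ψ A = ψ₁ := h₁ A ⟨hAf, hAz, hsq A hAK _ hp hAσ⟩
  have hBψ : ψ B = ψ₂ := h₂ B ⟨hBf, hBz, hsq B hBK _ hp hBσ⟩
  have hAw : helixCoord h α f σ ψ A = helixBound h α h ψ₁ (p 0) := by
    unfold helixCoord helixBound
    rw [hAσ, hAψ, hAz]
  have hBw : helixCoord h α f σ ψ B = helixBound h α 0 ψ₂ (p 0) := by
    unfold helixCoord helixBound
    rw [hBσ, hBψ, hBz]
  have honly : ∀ x ∈ K, x ∈ frontier K → σ x = p 0 → x = A ∨ x = B := by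
    intro x hx hxf hxσ
    rcases H.frontier_cases hxf with hc | hc | hc
    · exact Or.inl (hAu x ⟨hxf, hc.1, hxσ⟩)
    · exact Or.inr (hBu x ⟨hxf, hc.1, hxσ⟩)
    · exact absurd hc (hsq x hx _ hp hxσ).ne
  -- C and D are boundary points of smaller and larger signed radius, which show that the boundary
  -- crosses the line.
  obtain ⟨C, ⟨hCf, -, hCσ⟩, -⟩ := H.existsUnique_endPoint P htop
    (show (-r + p 0) / 2 ∈ Ioo (-r) r from ⟨by linarith [hp.1], by linarith [hp.1, hp.2]⟩)
  obtain ⟨D, ⟨hDf, -, hDσ⟩, -⟩ := H.existsUnique_endPoint P htop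
    (show (r + p 0) / 2 ∈ Ioo (-r) r from ⟨by linarith [hp.1, hp.2], by linarith [hp.2]⟩)
  obtain ⟨x, hxK, hxσ, hxw⟩ := exists_eq_of_boundary_crossing e he P.cont_radius
    (H.helixCoord_continuousOn P α) hAK hBK hAf hBf hAσ hBσ (d := p 1) (by rw [hAw]; exact hpu)
    (by rw [hBw]; exact hpl) honly
    ⟨C, H.frontier_subset hCf, hCf, by rw [hCσ]; linarith [hp.1]⟩
    ⟨D, H.frontier_subset hDf, hDf, by rw [hDσ]; linarith [hp.2]⟩
  refine ⟨x, ⟨mem_interior hxK fun hxf => ?_, fun hxA => hp0 ?_⟩, ?_⟩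
  · rcases honly x hxK hxf hxσ with rfl | rfl
    · linarith
    · linarith
  · have := P.sq_eq hxK
    rw [hxA.2, hxσ] at this
    exact pow_eq_zero_iff two_ne_zero |>.1 this
  · ext i
    fin_cases i
    · exact (calibration_zero h α f σ ψ x).trans hxσ
    · exact (calibration_one h α f σ ψ x).trans hxw

omit h₁ h₂ in
/-- The calibration inequality. -/
theorem profileArea_le_lintegral {E : Set Plane} (hE : MeasurableSet E)
    (hEK : E ⊆ interior K \ axisPoints f K)
    (hcov : calibratedRegion r h ψ₁ ψ₂ ⊆ calibration h (ψ₁ - ψ₂) f σ ψ '' E) :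
    profileArea r h (ψ₁ - ψ₂) ≤ ∫⁻ x in E,
        ENNReal.ofReal |(fderiv ℝ (calibration h (ψ₁ - ψ₂) f σ ψ) x).det| ∧
      ∀ x ∈ E, |(fderiv ℝ (calibration h (ψ₁ - ψ₂) f σ ψ) x).det| ≤ areaElement f x := by
  refine ⟨?_, fun x hx => ?_⟩
  · rw [← volume_calibratedRegion H.h_pos]
    refine (measure_mono hcov).trans (addHaar_image_le_lintegral_abs_det_fderiv volume hE ?_)
    intro x hx
    obtain ⟨G', hG, -⟩ := H.abs_det_le_areaElement P (ψ₁ - ψ₂) (hEK hx).1 (hEK hx).2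
    rw [hG.fderiv]
    exact hG.hasFDerivWithinAt
  · obtain ⟨G', hG, hle, -⟩ := H.abs_det_le_areaElement P (ψ₁ - ψ₂) (hEK hx).1 (hEK hx).2
    rw [hG.fderiv]
    exact hle

theorem profileArea_le_area : profileArea r h (ψ₁ - ψ₂) ≤ area f K := by
  obtain ⟨h3, h4⟩ := H.profileArea_le_lintegral P H.isOpen_interior_diff.measurableSet
    Subset.rfl (H.calibratedRegion_subset P h₁ h₂)
  refine h3.trans ?_
  unfold area
  refine (setLIntegral_mono' H.isOpen_interior_diff.measurableSet fun x hx =>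
    ENNReal.ofReal_le_ofReal (h4 x hx)).trans ?_
  exact lintegral_mono_set (sdiff_subset.trans interior_subset)

end IsCompetitor

/-! ### The case of equality -/

theorem wedge_mul_det (a b : Plane →L[ℝ] ℝ) (v w : Plane) :
    wedge a b * (v 0 * w 1 - v 1 * w 0) = a v * b w - a w * b v := by
  rw [clm_apply_eq_coord a v, clm_apply_eq_coord a w, clm_apply_eq_coord b v,
    clm_apply_eq_coord b w, wedge]
  ring

theorem apply_eq_zero_of_wedge_eq_zero {a b : Plane →L[ℝ] ℝ} (hab : wedge a b = 0) (ha : a ≠ 0)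
    {w : Plane} (hw : a w = 0) : b w = 0 := by
  obtain ⟨v, hv⟩ : ∃ v, a v ≠ 0 := by
    by_contra! hno
    exact ha (ContinuousLinearMap.ext hno)
  have := wedge_mul_det a b v w
  rw [hab, hw, zero_mul, zero_mul, sub_zero] at this
  exact (mul_eq_zero.1 this.symm).resolve_left hv

theorem eq_zero_of_wedge_eq_zero {a b c : Plane →L[ℝ] ℝ} (hab : wedge a b ≠ 0)
    (hac : wedge a c = 0) (hbc : wedge c b = 0) : c = 0 := by
  have ha : a ≠ 0 := by
    rintro rfl
    simp [wedge] at hab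
  obtain ⟨w, hw, haw⟩ := exists_ne_zero_apply_eq_zero a
  obtain ⟨w', hw', hbw'⟩ := exists_ne_zero_apply_eq_zero b
  have hb : b ≠ 0 := by
    rintro rfl
    simp [wedge] at hab
  have hcw := apply_eq_zero_of_wedge_eq_zero hac ha haw
  have hbc' : wedge b c = 0 := by
    unfold wedge at *
    linarith
  have hcw' := apply_eq_zero_of_wedge_eq_zero hbc' hb hbw'
  have hbw : b w ≠ 0 := by
    intro h0
    obtain ⟨v, hv⟩ : ∃ v, a v ≠ 0 := by
      by_contra! hno
      exact ha (ContinuousLinearMap.ext hno)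
    have h1 := wedge_mul_det a b v w
    rw [h0, haw, mul_zero, zero_mul, sub_zero] at h1
    exact (mul_eq_zero.1 h1).elim hab (det_ne_zero_of_apply hv haw hw)
  exact eq_zero_of_det_ne_zero hcw hcw' (det_ne_zero_of_apply hbw hbw' hw')

/-- The map that recovers the parameters of a point of a helicoid. -/
noncomputable def helicoidParam (φ ω : ℝ) (p : Space) : Plane :=
  !₂[p 0 * Real.cos (φ + ω * p 2) + p 1 * Real.sin (φ + ω * p 2), p 2]

theorem helicoidParam_helicoidMap (φ ω : ℝ) (x : Plane) :
    helicoidParam φ ω (helicoidMap φ ω x) = x := by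
  have hsc := Real.sin_sq_add_cos_sq (φ + ω * x 1)
  ext i
  fin_cases i
  · simp only [helicoidParam, helicoidMap]
    simp
    linear_combination x 0 * hsc
  · simp [helicoidParam, helicoidMap]

theorem contDiff_helicoidParam (φ ω : ℝ) : ContDiff ℝ 1 (helicoidParam φ ω) := by
  rw [contDiff_euclidean]
  intro i
  fin_cases i <;> simp [helicoidParam] <;> fun_prop

/-- A locally injective map of the closure of a domain to the plane that is injective and open on
the domain, with convex image, is injective. -/
theorem injOn_of_injOn_interior {K : Set Plane} (hK : IsCompact K)
    (hKi : K ⊆ closure (interior K)) {g : Plane → ℝ × ℝ} (hg : ContinuousOn g K)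
    {V : Set (ℝ × ℝ)} (hV : Convex ℝ V) (himg : g '' interior K = V)
    (hinj : InjOn g (interior K)) (hopen : ∀ x ∈ interior K, ∀ O ∈ 𝓝 x, g '' O ∈ 𝓝 (g x))
    (hloc : ∀ x ∈ K, ∃ O ∈ 𝓝 x, InjOn g (K ∩ O)) : InjOn g K := by
  intro x hx y hy hxy
  by_contra hne
  obtain ⟨O, hO, hOi⟩ := hloc x hx
  obtain ⟨ε, hε, hεO⟩ := Metric.nhds_basis_closedBall.mem_iff.1 hO
  have hd : 0 < dist y x := dist_pos.2 (Ne.symm hne)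
  -- The sphere of radius ρ about x separates x from y and lies where g is injective on K, so its
  -- part in K has an image at positive distance from g x.
  set ρ := min ε (dist y x / 2) with hρ
  have hρ0 : 0 < ρ := lt_min hε (by linarith)
  have hρε : ρ ≤ ε := min_le_left _ _
  have hρd : ρ < dist y x := (min_le_right _ _).trans_lt (by linarith)
  have hcl : IsClosed (g '' (K ∩ sphere x ρ)) :=
    ((hK.inter_right isClosed_sphere).image_of_continuousOn (hg.mono inter_subset_left)).isClosed
  have hnot : g x ∉ g '' (K ∩ sphere x ρ) := by
    rintro ⟨w, ⟨hwK, hws⟩, hwx⟩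
    have hws' : dist w x = ρ := hws
    have hwO : w ∈ O := hεO (by rw [mem_closedBall, hws']; exact hρε)
    have := hOi ⟨hwK, hwO⟩ ⟨hx, mem_of_mem_nhds hO⟩ hwx
    rw [this, dist_self] at hws'
    exact hρ0.ne hws'
  obtain ⟨τ, hτ, hτs⟩ := Metric.isOpen_iff.1 hcl.isOpen_compl _ hnot
  -- Its preimage in the interior is connected and comes arbitrarily close to both x and y, so it
  -- would have to cross the sphere that it avoids.
  have hVc : IsPreconnected (V ∩ ball (g x) τ) := (hV.inter (convex_ball _ _)).isPreconnected
  have hM : IsPreconnected (interior K ∩ g ⁻¹' (V ∩ ball (g x) τ)) := by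
    have h1 : Function.Injective fun p : interior K => g p := fun p q hpq =>
      Subtype.ext (hinj p.2 q.2 hpq)
    have h2 : IsOpenMap fun p : interior K => g p := by
      rw [isOpenMap_iff_nhds_le]
      intro p S hS
      rw [Filter.mem_map, nhds_subtype_eq_comap, Filter.mem_comap] at hS
      obtain ⟨S', hS', hSS'⟩ := hS
      refine mem_of_superset (hopen p p.2 (S' ∩ interior K)
        (inter_mem hS' (isOpen_interior.mem_nhds p.2))) ?_
      rintro _ ⟨q, ⟨hq, hqi⟩, rfl⟩
      exact hSS' (show (⟨q, hqi⟩ : interior K) ∈ Subtype.val ⁻¹' S' from hq)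
    have h3 := hVc.preimage_of_isOpenMap h1 h2 (by
      rintro q ⟨hq, -⟩
      rw [← himg] at hq
      obtain ⟨p, hp, rfl⟩ := hq
      exact ⟨⟨p, hp⟩, rfl⟩)
    have h4 := h3.image _ continuous_subtype_val.continuousOn
    convert h4 using 1
    ext p
    constructor
    · rintro ⟨hp, hp'⟩
      exact ⟨⟨p, hp⟩, hp', rfl⟩
    · rintro ⟨p, hp, rfl⟩
      exact ⟨p.2, hp⟩
  have hclose : ∀ w ∈ K, g w = g x → ∀ S ∈ 𝓝 w,
      ((interior K ∩ g ⁻¹' (V ∩ ball (g x) τ)) ∩ S).Nonempty := by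
    intro w hw hwx S hS
    have h1 : ∀ᶠ p in 𝓝[K] w, g p ∈ ball (g x) τ := by
      refine (hg w hw).eventually ?_
      rw [hwx]
      exact ball_mem_nhds _ hτ
    rw [eventually_nhdsWithin_iff] at h1
    obtain ⟨p, ⟨hpS, hp⟩, hpi⟩ := mem_closure_iff_nhds.1 (hKi hw) _ (inter_mem hS h1)
    exact ⟨p, ⟨hpi, by rw [← himg]; exact mem_image_of_mem g hpi, hp (interior_subset hpi)⟩, hpS⟩
  obtain ⟨w, ⟨hwi, -, hwb⟩, hw1, hw2⟩ := hM (ball x ρ) (closedBall x ρ)ᶜ isOpen_ball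
    isClosed_closedBall.isOpen_compl (by
      rintro w ⟨hwi, -, hwb⟩
      rcases lt_trichotomy (dist w x) ρ with h1 | h1 | h1
      · exact Or.inl h1
      · exact absurd ⟨w, ⟨interior_subset hwi, h1⟩, rfl⟩ (hτs hwb)
      · exact Or.inr fun h2 => absurd h1 (not_lt.2 h2))
    (hclose x hx rfl _ (ball_mem_nhds x hρ0))
    (hclose y hy hxy.symm _ (isClosed_closedBall.isOpen_compl.mem_nhds fun h2 =>
      absurd hρd (not_lt.2 h2)))
  exact hw2 (ball_subset_closedBall hw1)

namespace IsCompetitor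

variable {r h φ₁ φ₂ : ℝ} {f : Plane → Space} {K : Set Plane} (H : IsCompetitor r h φ₁ φ₂ f K)
  {σ ψ : Plane → ℝ} (P : IsSignedPolar f K σ ψ) {ψ₁ ψ₂ : ℝ}
  (h₁ : ∀ x ∈ endPoints r f K h, ψ x = ψ₁) (h₂ : ∀ x ∈ endPoints r f K 0, ψ x = ψ₂)

include H

theorem fderiv_continuousOn : ContinuousOn (fderiv ℝ f) K := by
  obtain ⟨U, hU, hKU, hf⟩ := H.immersed.contDiff
  exact (hf.continuousOn_fderiv_of_isOpen hU le_rfl).mono hKU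

theorem coordDeriv_continuousOn (i : Fin 3) (v : Plane) :
    ContinuousOn (fun x => coordDeriv f x i v) K := by
  have h1 : ContinuousOn (fun x => fderiv ℝ f x v) K := H.fderiv_continuousOn.clm_apply
    continuousOn_const
  exact (EuclideanSpace.proj i : Space →L[ℝ] ℝ).continuous.comp_continuousOn h1

theorem areaElement_continuousOn : ContinuousOn (areaElement f) K := by
  have h1 : ∀ v, ContinuousOn (fun x => fderiv ℝ f x v) K := fun v =>
    H.fderiv_continuousOn.clm_apply continuousOn_const
  unfold areaElement
  exact Real.continuous_sqrt.comp_continuousOn ((((h1 _).norm.pow 2).mul ((h1 _).norm.pow 2)).sub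
    ((ContinuousOn.inner (𝕜 := ℝ) (h1 _) (h1 _)).pow 2))

include P

theorem radiusDeriv_ne_zero {x : Plane} (hx : x ∈ K) (hxA : x ∉ axisPoints f K) :
    radiusDeriv f ψ x ≠ 0 := by
  intro h0
  have hpos : 0 < radiusSq f x :=
    lt_of_le_of_ne (radiusSq_nonneg f x) fun h => hxA ⟨hx, h.symm⟩
  refine H.radiusSqDeriv_ne_zero hx hpos ?_
  have : radiusSqDeriv f x = (2 * σ x) • radiusDeriv f ψ x := by
    unfold radiusSqDeriv radiusDeriv
    rw [P.coord_zero x hx, P.coord_one x hx, smul_add, smul_smul, smul_smul, mul_assoc, mul_assoc]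
  rw [this, h0, smul_zero]

/-- Otherwise a vector in the kernel of dσ is killed by the arc and height differentials as well,
against the immersion property. -/
theorem not_wedge_eq_zero {x : Plane} (hx : x ∈ K) (hxA : x ∉ axisPoints f K)
    (h1 : wedge (radiusDeriv f ψ x) (arcDeriv f ψ x) = 0)
    (h2 : wedge (radiusDeriv f ψ x) (coordDeriv f x 2) = 0) : False := by
  have hne := H.radiusDeriv_ne_zero P hx hxA
  obtain ⟨w, hw, hw0⟩ := exists_ne_zero_apply_eq_zero (radiusDeriv f ψ x)
  have e1 := apply_eq_zero_of_wedge_eq_zero h1 hne hw0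
  have e2 := apply_eq_zero_of_wedge_eq_zero h2 hne hw0
  have hsc := Real.sin_sq_add_cos_sq (ψ x)
  have e3 : Real.cos (ψ x) * coordDeriv f x 0 w + Real.sin (ψ x) * coordDeriv f x 1 w = 0 := by
    simpa [radiusDeriv] using hw0
  have e4 : -Real.sin (ψ x) * coordDeriv f x 0 w + Real.cos (ψ x) * coordDeriv f x 1 w = 0 := by
    simpa [arcDeriv] using e1
  refine hw (H.eq_zero_of_coordDeriv hx ?_ ?_ e2)
  · linear_combination Real.cos (ψ x) * e3 - Real.sin (ψ x) * e4 - coordDeriv f x 0 w * hsc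
  · linear_combination Real.sin (ψ x) * e3 + Real.cos (ψ x) * e4 - coordDeriv f x 1 w * hsc

theorem areaElement_pos {x : Plane} (hx : x ∈ K) (hxA : x ∉ axisPoints f K) :
    0 < areaElement f x := by
  rw [areaElement_eq f ψ x]
  refine Real.sqrt_pos.2 (lt_of_le_of_ne (by positivity) fun h0 => ?_)
  have e1 := sq_nonneg (wedge (radiusDeriv f ψ x) (arcDeriv f ψ x))
  have e2 := sq_nonneg (wedge (radiusDeriv f ψ x) (coordDeriv f x 2))
  have e3 := sq_nonneg (wedge (arcDeriv f ψ x) (coordDeriv f x 2))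
  exact H.not_wedge_eq_zero P hx hxA (pow_eq_zero_iff two_ne_zero |>.1 (by linarith))
    (pow_eq_zero_iff two_ne_zero |>.1 (by linarith))

include h₁ h₂

/-- If the area is minimal then the angle is an affine function of the height, infinitesimally. -/
theorem arcDeriv_eq (harea : area f K ≤ profileArea r h (ψ₁ - ψ₂)) {x : Plane}
    (hx : x ∈ interior K) (hxA : x ∉ axisPoints f K) :
    h • arcDeriv f ψ x = (σ x * (ψ₁ - ψ₂)) • coordDeriv f x 2 := by
  set α := ψ₁ - ψ₂ with hα
  set E := interior K \ axisPoints f K with hE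
  have hEo : IsOpen E := H.isOpen_interior_diff
  have hEK : E ⊆ K := sdiff_subset.trans interior_subset
  obtain ⟨h3, h4⟩ := H.profileArea_le_lintegral P hEo.measurableSet
    Subset.rfl (H.calibratedRegion_subset P h₁ h₂)
  -- Together with the pointwise bound `h4` this forces the Jacobian to equal the area element
  -- almost everywhere.
  have hle : ∫⁻ x in E, ENNReal.ofReal (areaElement f x) ≤
      ∫⁻ x in E, ENNReal.ofReal |(fderiv ℝ (calibration h α f σ ψ) x).det| :=
    ((lintegral_mono_set hEK).trans harea).trans h3
  have hm : AEMeasurable (fun x => ENNReal.ofReal (areaElement f x)) (volume.restrict E) :=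
    ENNReal.measurable_ofReal.comp_aemeasurable
      ((H.areaElement_continuousOn.mono hEK).aemeasurable hEo.measurableSet)
  have hae := ae_eq_of_ae_le_of_lintegral_le
    (ae_restrict_of_forall_mem hEo.measurableSet fun x hx => ENNReal.ofReal_le_ofReal (h4 x hx))
    (ne_top_of_le_ne_top (profileArea_ne_top r h α)
      ((setLIntegral_mono' hEo.measurableSet fun x hx => ENNReal.ofReal_le_ofReal (h4 x hx)).trans
        ((lintegral_mono_set hEK).trans harea))) hm hle
  have hae2 : ∀ᵐ x ∂volume.restrict E, wedge (arcDeriv f ψ x) (coordDeriv f x 2) = 0 ∧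
      h * wedge (radiusDeriv f ψ x) (arcDeriv f ψ x) =
        σ x * α * wedge (radiusDeriv f ψ x) (coordDeriv f x 2) := by
    filter_upwards [hae, ae_restrict_mem hEo.measurableSet] with y hy hyE
    obtain ⟨G', hG, hle, heq⟩ := H.abs_det_le_areaElement P α hyE.1 hyE.2
    refine heq ?_
    rw [hG.fderiv] at hy
    exact (ENNReal.ofReal_eq_ofReal_iff (abs_nonneg _) ((abs_nonneg _).trans hle)).1 hy
  have hD : ∀ (i : Fin 3) (v : Plane), ContinuousOn (fun x => coordDeriv f x i v) E := fun i v =>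
    (H.coordDeriv_continuousOn i v).mono hEK
  have hcψ : ContinuousOn (fun x => Real.cos (ψ x)) E :=
    Real.continuous_cos.comp_continuousOn (P.cont_angle.mono hEK)
  have hsψ : ContinuousOn (fun x => Real.sin (ψ x)) E :=
    Real.continuous_sin.comp_continuousOn (P.cont_angle.mono hEK)
  have hR : ∀ v, ContinuousOn (fun x => radiusDeriv f ψ x v) E := fun v =>
    (hcψ.mul (hD 0 v)).add (hsψ.mul (hD 1 v))
  have hA : ∀ v, ContinuousOn (fun x => arcDeriv f ψ x v) E := fun v =>
    (hsψ.neg.mul (hD 0 v)).add (hcψ.mul (hD 1 v))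
  -- The equality conditions involve continuous functions on an open set, so they hold at every
  -- point of it.
  have hEq1 := Measure.eqOn_open_of_ae_eq (μ := volume)
    (f := fun x => wedge (arcDeriv f ψ x) (coordDeriv f x 2)) (g := fun _ => (0 : ℝ))
    (hae2.mono fun x hx => hx.1) hEo
    (((hA _).mul (hD 2 _)).sub ((hA _).mul (hD 2 _))) continuousOn_const
  have hEq2 := Measure.eqOn_open_of_ae_eq (μ := volume)
    (f := fun x => h * wedge (radiusDeriv f ψ x) (arcDeriv f ψ x))
    (g := fun x => σ x * α * wedge (radiusDeriv f ψ x) (coordDeriv f x 2))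
    (hae2.mono fun x hx => hx.2) hEo
    (continuousOn_const.mul (((hR _).mul (hA _)).sub ((hR _).mul (hA _))))
    (((P.cont_radius.mono hEK).mul continuousOn_const).mul
      (((hR _).mul (hD 2 _)).sub ((hR _).mul (hD 2 _))))
  have e1 : wedge (arcDeriv f ψ x) (coordDeriv f x 2) = 0 := hEq1 ⟨hx, hxA⟩
  have e2 : h * wedge (radiusDeriv f ψ x) (arcDeriv f ψ x) =
      σ x * α * wedge (radiusDeriv f ψ x) (coordDeriv f x 2) := hEq2 ⟨hx, hxA⟩
  have hhp := H.h_pos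
  have hne : wedge (radiusDeriv f ψ x) (coordDeriv f x 2) ≠ 0 := by
    intro h0
    rw [h0, mul_zero] at e2
    exact H.not_wedge_eq_zero P (interior_subset hx) hxA
      ((mul_eq_zero.1 e2).resolve_left hhp.ne') h0
  rw [← sub_eq_zero]
  refine eq_zero_of_wedge_eq_zero hne ?_ ?_
  · have : wedge (radiusDeriv f ψ x) (h • arcDeriv f ψ x - (σ x * α) • coordDeriv f x 2) =
        h * wedge (radiusDeriv f ψ x) (arcDeriv f ψ x) -
          σ x * α * wedge (radiusDeriv f ψ x) (coordDeriv f x 2) := by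
      simp only [wedge, _root_.sub_apply, _root_.smul_apply, smul_eq_mul]
      ring
    rw [this, e2, sub_self]
  · have : wedge (h • arcDeriv f ψ x - (σ x * α) • coordDeriv f x 2) (coordDeriv f x 2) =
        h * wedge (arcDeriv f ψ x) (coordDeriv f x 2) := by
      simp only [wedge, _root_.sub_apply, _root_.smul_apply, smul_eq_mul]
      ring
    rw [this, e1, mul_zero]

theorem pitch_hasFDerivAt_of_not_mem (harea : area f K ≤ profileArea r h (ψ₁ - ψ₂)) {x : Plane}
    (hx : x ∈ interior K) (hxA : x ∉ axisPoints f K) :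
    HasFDerivAt (fun y => h * ψ y - (ψ₁ - ψ₂) * f y 2) (0 : Plane →L[ℝ] ℝ) x := by
  have hxK := interior_subset hx
  have hσ : σ x ≠ 0 := radius_ne_zero P ⟨hxK, hxA⟩
  have h3 := ((H.angle_hasFDerivAt P hx hxA).const_mul h).sub
    ((H.coord_hasStrictFDerivAt hxK 2).hasFDerivAt.const_mul (ψ₁ - ψ₂))
  refine h3.congr_fderiv ?_
  rw [smul_comm h, H.arcDeriv_eq P h₁ h₂ harea hx hxA, smul_smul, ← mul_assoc,
    inv_mul_cancel₀ hσ, one_mul, sub_self]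

/-- Near an axis point take height and a horizontal coordinate as a chart. Axis points lie on the
line where the latter vanishes, so hψ - αz is constant on each side; the constants agree by
continuity. -/
theorem pitch_hasFDerivAt (harea : area f K ≤ profileArea r h (ψ₁ - ψ₂)) {x : Plane}
    (hx : x ∈ interior K) :
    HasFDerivAt (fun y => h * ψ y - (ψ₁ - ψ₂) * f y 2) (0 : Plane →L[ℝ] ℝ) x := by
  by_cases hxA : x ∉ axisPoints f K
  · exact H.pitch_hasFDerivAt_of_not_mem P h₁ h₂ harea hx hxA
  rw [not_not] at hxA
  set ζ : Plane → ℝ := fun y => h * ψ y - (ψ₁ - ψ₂) * f y 2 with hζ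
  have hζc : ContinuousOn ζ K :=
    (continuousOn_const.mul P.cont_angle).sub (continuousOn_const.mul (H.coord_continuousOn 2))
  obtain ⟨i, hi, hind⟩ := H.exists_axis_chart hxA
  obtain ⟨N, δ, hN, hxN, hNW, hδ, hbij, hopen, hconn⟩ :=
    exists_chart (H.coord_hasStrictFDerivAt hxA.1 2) (H.coord_hasStrictFDerivAt hxA.1 i)
      hind (isOpen_interior.mem_nhds hx)
  have hNA : ∀ y ∈ N, f y i ≠ 0 → y ∉ axisPoints f K := by
    intro y hy hyi hyA
    have := radiusSq_eq_zero hyA.2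
    rcases hi with rfl | rfl
    exacts [hyi this.1, hyi this.2]
  have hx0 : f x i = 0 := by
    have := radiusSq_eq_zero hxA.2
    rcases hi with rfl | rfl
    exacts [this.1, this.2]
  have hconst : ∀ g : ℝ × ℝ →L[ℝ] ℝ, (∀ q : ℝ × ℝ, g q < 0 → q.2 ≠ 0) →
      ∃ c, ∀ y ∈ N, g (f y 2, f y i) < 0 → ζ y = c := by
    intro g hg
    have h3 := hconn _ inter_subset_left (isPreconnected_ball_inter_halfspace g 0)
    have hfc : ContinuousOn (fun y => (f y 2, f y i)) N :=
      ((H.coord_continuousOn 2).mono (hNW.trans interior_subset)).prodMk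
        ((H.coord_continuousOn i).mono (hNW.trans interior_subset))
    have h4 : IsOpen (N ∩ (fun y => (f y 2, f y i)) ⁻¹' (ball (f x 2, f x i) δ ∩ {q | g q < 0})) :=
      hfc.isOpen_inter_preimage hN
        (isOpen_ball.inter (isOpen_lt g.continuous continuous_const))
    have hd : ∀ y ∈ N ∩ (fun y => (f y 2, f y i)) ⁻¹' (ball (f x 2, f x i) δ ∩ {q | g q < 0}),
        HasFDerivAt ζ (0 : Plane →L[ℝ] ℝ) y := by
      rintro y ⟨hyN, -, hyg⟩
      exact H.pitch_hasFDerivAt_of_not_mem P h₁ h₂ harea (hNW hyN) (hNA y hyN (hg _ hyg))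
    obtain ⟨c, hc⟩ := h4.exists_is_const_of_fderiv_eq_zero h3
      (fun y hy => (hd y hy).differentiableAt.differentiableWithinAt)
      (fun y hy => (hd y hy).fderiv)
    exact ⟨c, fun y hy hyg => hc y ⟨hy, hbij.mapsTo hy, hyg⟩⟩
  obtain ⟨c₁, hc₁⟩ := hconst (-ContinuousLinearMap.snd ℝ ℝ ℝ) (by
    intro q hq hq0
    simp [hq0] at hq)
  obtain ⟨c₂, hc₂⟩ := hconst (ContinuousLinearMap.snd ℝ ℝ ℝ) (by
    intro q hq hq0
    simp [hq0] at hq)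
  have hlim : ∀ y ∈ N, f y i = 0 → ζ y = c₁ ∧ ζ y = c₂ := by
    intro y hy hy0
    have hyc : ContinuousAt ζ y := hζc.continuousAt (mem_of_superset (hN.mem_nhds hy)
      (hNW.trans interior_subset))
    have hside : ∀ O ∈ 𝓝 y, (∃ w ∈ O ∩ N, 0 < f w i) ∧ ∃ w ∈ O ∩ N, f w i < 0 := by
      intro O hO
      have h2 := (hopen _ inter_subset_right (isOpen_interior.inter hN)).mem_nhds
        (mem_image_of_mem _ (⟨mem_interior_iff_mem_nhds.2 hO, hy⟩ : y ∈ interior O ∩ N))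
      obtain ⟨ε, hε, h3⟩ := mem_nhds_prod_exists_pos h2
      constructor
      · obtain ⟨w, hw, hwe⟩ := (h3 (ε / 2) (by rw [abs_of_pos] <;> linarith)).1
        have : f w i = f y i + ε / 2 := (Prod.ext_iff.1 hwe).2
        exact ⟨w, ⟨interior_subset hw.1, hw.2⟩, by rw [this, hy0]; linarith⟩
      · obtain ⟨w, hw, hwe⟩ := (h3 (-(ε / 2)) (by rw [abs_neg, abs_of_pos] <;> linarith)).1
        have : f w i = f y i + -(ε / 2) := (Prod.ext_iff.1 hwe).2
        exact ⟨w, ⟨interior_subset hw.1, hw.2⟩, by rw [this, hy0]; linarith⟩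
    constructor
    · by_contra hne
      obtain ⟨w, ⟨hwO, hwN⟩, hw0⟩ := (hside _ (hyc.eventually_ne hne)).1
      exact hwO (hc₁ w hwN (by simpa using hw0))
    · by_contra hne
      obtain ⟨w, ⟨hwO, hwN⟩, hw0⟩ := (hside _ (hyc.eventually_ne hne)).2
      exact hwO (hc₂ w hwN (by simpa using hw0))
  have hcc : c₁ = c₂ := (hlim x hxN hx0).1.symm.trans (hlim x hxN hx0).2
  have hev : ζ =ᶠ[𝓝 x] fun _ => c₁ := by
    filter_upwards [hN.mem_nhds hxN] with y hy
    rcases lt_trichotomy (f y i) 0 with h3 | h3 | h3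
    · rw [hcc]; exact hc₂ y hy (by simpa using h3)
    · exact (hlim y hy h3).1
    · exact hc₁ y hy (by simpa using h3)
  exact (hasFDerivAt_const c₁ x).congr_of_eventuallyEq hev

/-- If the area is minimal then the angle is an affine function of the height. -/
theorem angle_eq (harea : area f K ≤ profileArea r h (ψ₁ - ψ₂)) {x : Plane} (hx : x ∈ K) :
    ψ x = ψ₂ + (ψ₁ - ψ₂) / h * f x 2 := by
  set ζ : Plane → ℝ := fun y => h * ψ y - (ψ₁ - ψ₂) * f y 2 with hζ
  have hζc : ContinuousOn ζ K :=
    (continuousOn_const.mul P.cont_angle).sub (continuousOn_const.mul (H.coord_continuousOn 2))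
  have hd : ∀ y ∈ interior K, HasFDerivAt ζ (0 : Plane →L[ℝ] ℝ) y := fun y hy =>
    H.pitch_hasFDerivAt P h₁ h₂ harea hy
  obtain ⟨c, hc⟩ := isOpen_interior.exists_is_const_of_fderiv_eq_zero H.isPreconnected_interior
    (fun y hy => (hd y hy).differentiableAt.differentiableWithinAt) (fun y hy => (hd y hy).fderiv)
  have hcK : ∀ y ∈ K, ζ y = c := by
    intro y hy
    have hcl : IsClosed (K ∩ ζ ⁻¹' {c}) :=
      hζc.preimage_isClosed_of_isClosed H.isClosed isClosed_singleton
    have hsub : interior K ⊆ K ∩ ζ ⁻¹' {c} := fun w hw => ⟨interior_subset hw, hc w hw⟩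
    exact (closure_minimal hsub hcl (H.subset_closure_interior hy)).2
  -- The constant is read off at a point over the bottom diameter, where ψ = ψ₂ and z = 0.
  have hbot : IsEnd h φ₁ φ₂ 0 φ₂ := Or.inr ⟨rfl, rfl⟩
  obtain ⟨p, -, -⟩ := H.existsUnique_axis_endPoint P hbot
  have hp := hcK p (H.frontier_subset p.2.1)
  have hxc := hcK x hx
  have hpz : f p 2 = 0 := p.2.2.1
  simp only [hζ] at hp hxc
  rw [hpz, h₂ p p.2] at hp
  have hhp := H.h_pos
  field_simp
  linarith

theorem eq_helicoidMap (harea : area f K ≤ profileArea r h (ψ₁ - ψ₂)) {x : Plane} (hx : x ∈ K) :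
    f x = helicoidMap ψ₂ ((ψ₁ - ψ₂) / h) !₂[σ x, f x 2] := by
  have hψ := H.angle_eq P h₁ h₂ harea hx
  ext i
  fin_cases i
  · simp [helicoidMap, P.coord_zero x hx, hψ]
  · simp [helicoidMap, P.coord_one x hx, hψ]
  · simp [helicoidMap]

/-- If the area is minimal then radius and height are local coordinates inside `K`. -/
theorem exists_param_chart (harea : area f K ≤ profileArea r h (ψ₁ - ψ₂)) {x : Plane}
    (hx : x ∈ interior K) {W : Set Plane} (hW : W ∈ 𝓝 x) :
    ∃ (N : Set Plane) (δ : ℝ), IsOpen N ∧ x ∈ N ∧ N ⊆ W ∩ interior K ∧ 0 < δ ∧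
      BijOn (fun y => (σ y, f y 2)) N (ball (σ x, f x 2) δ) := by
  have hxK := interior_subset hx
  set ω := (ψ₁ - ψ₂) / h with hω
  -- At axis points σ has so far been shown to be continuous only; g agrees with it on K and is
  -- visibly differentiable.
  set g : Plane → ℝ := fun y => helicoidParam ψ₂ ω (f y) 0 with hg
  have hgσ : ∀ y ∈ K, helicoidParam ψ₂ ω (f y) = !₂[σ y, f y 2] := by
    intro y hy
    conv_lhs => rw [H.eq_helicoidMap P h₁ h₂ harea hy]
    exact helicoidParam_helicoidMap _ _ _
  have hgσ0 : ∀ y ∈ K, g y = σ y := by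
    intro y hy
    simp [hg, hgσ y hy]
  have hL : HasStrictFDerivAt (fun y => helicoidParam ψ₂ ω (f y)) _ x :=
    (((contDiff_helicoidParam ψ₂ ω).contDiffAt).hasStrictFDerivAt one_ne_zero).comp x
      (H.hasStrictFDerivAt hxK)
  set L' := (fderiv ℝ (helicoidParam ψ₂ ω) (f x)).comp (fderiv ℝ f x) with hL'
  have hg' : HasStrictFDerivAt g ((EuclideanSpace.proj 0 : Plane →L[ℝ] ℝ).comp L') x :=
    ((EuclideanSpace.proj 0 : Plane →L[ℝ] ℝ).hasStrictFDerivAt).comp x hL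
  have hz' : HasStrictFDerivAt (fun y => f y 2)
      ((EuclideanSpace.proj 1 : Plane →L[ℝ] ℝ).comp L') x :=
    ((EuclideanSpace.proj 1 : Plane →L[ℝ] ℝ).hasStrictFDerivAt).comp x hL
  have hcomp : HasFDerivAt (fun y => helicoidMap ψ₂ ω (helicoidParam ψ₂ ω (f y)))
      ((fderiv ℝ (helicoidMap ψ₂ ω) (helicoidParam ψ₂ ω (f x))).comp L') x :=
    HasFDerivAt.comp x (((contDiff_helicoidMap ψ₂ ω).differentiable one_ne_zero _).hasFDerivAt)
      hL.hasFDerivAt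
  have heq : fderiv ℝ f x =
      (fderiv ℝ (helicoidMap ψ₂ ω) (helicoidParam ψ₂ ω (f x))).comp L' := by
    refine (H.hasStrictFDerivAt hxK).hasFDerivAt.unique (hcomp.congr_of_eventuallyEq ?_)
    filter_upwards [mem_interior_iff_mem_nhds.1 hx] with y hy
    rw [hgσ y hy]
    exact H.eq_helicoidMap P h₁ h₂ harea hy
  have hind : ∀ v, (EuclideanSpace.proj 0 : Plane →L[ℝ] ℝ).comp L' v = 0 →
      (EuclideanSpace.proj 1 : Plane →L[ℝ] ℝ).comp L' v = 0 → v = 0 := by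
    intro v hv0 hv1
    have hv : L' v = 0 := by
      ext i
      fin_cases i
      exacts [hv0, hv1]
    apply H.immersed.immersion x hxK
    rw [map_zero, heq, ContinuousLinearMap.comp_apply, hv, map_zero]
  obtain ⟨N, δ, hN, hxN, hNW, hδ, hbij, -, -⟩ :=
    exists_chart hg' hz' hind (inter_mem hW (isOpen_interior.mem_nhds hx))
  refine ⟨N, δ, hN, hxN, hNW, hδ, ?_⟩
  rw [hgσ0 x hxK] at hbij
  refine hbij.congr fun y hy => ?_
  simp only [hgσ0 y (interior_subset (hNW hy).2)]

/-- If x and y share their parameters, a neighbourhood M of x can be dropped: the calibrating map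
depends only on σ and z now, and a neighbourhood of y covers the same values. What remains already
has the full profile area, so M has area zero, although the area element is positive off the axis.
-/
theorem param_injOn_interior (harea : area f K ≤ profileArea r h (ψ₁ - ψ₂)) :
    InjOn (fun y => (σ y, f y 2)) (interior K) := by
  intro x hx y hy hxy
  by_contra hne
  set α := ψ₁ - ψ₂ with hα
  have hxy1 : σ x = σ y := (Prod.ext_iff.1 hxy).1
  have hxy2 : f x 2 = f y 2 := (Prod.ext_iff.1 hxy).2
  obtain ⟨U, V, hU, hV, hxU, hyV, hUV⟩ := t2_separation hne
  obtain ⟨N, δ, hN, hyN, hNW, hδ, hbij⟩ := H.exists_param_chart P h₁ h₂ harea hy (hV.mem_nhds hyV)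
  have hcont : ContinuousOn (fun w => (σ w, f w 2)) (interior K) :=
    (P.cont_radius.mono interior_subset).prodMk ((H.coord_continuousOn 2).mono interior_subset)
  set M := U ∩ (interior K ∩ (fun w => (σ w, f w 2)) ⁻¹' ball (σ y, f y 2) δ) with hM
  have hMo : IsOpen M :=
    hU.inter (hcont.isOpen_inter_preimage isOpen_interior isOpen_ball)
  have hxM : x ∈ M := by
    refine ⟨hxU, hx, ?_⟩
    rw [mem_preimage, hxy1, hxy2]
    exact mem_ball_self hδ
  set E := interior K \ axisPoints f K with hE
  have hEo : IsOpen E := H.isOpen_interior_diff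
  have hEK : E ⊆ K := sdiff_subset.trans interior_subset
  have hcov : calibratedRegion r h ψ₁ ψ₂ ⊆ calibration h α f σ ψ '' (E \ M) := by
    intro p hp
    obtain ⟨w, hwE, rfl⟩ := H.calibratedRegion_subset P h₁ h₂ hp
    by_cases hwM : w ∈ M
    · obtain ⟨w', hw', hww'⟩ := hbij.surjOn hwM.2.2
      have e1 : σ w' = σ w := (Prod.ext_iff.1 hww').1
      have e2 : f w' 2 = f w 2 := (Prod.ext_iff.1 hww').2
      have hwi' : w' ∈ interior K := (hNW hw').2
      have hwK : w ∈ K := hEK hwE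
      have hwK' : w' ∈ K := interior_subset hwi'
      have e3 : ψ w' = ψ w := by
        rw [H.angle_eq P h₁ h₂ harea hwK', H.angle_eq P h₁ h₂ harea hwK, e2]
      refine ⟨w', ⟨⟨hwi', fun hA => ?_⟩, fun hM' => ?_⟩, ?_⟩
      · have h3 := P.sq_eq hwK'
        rw [hA.2, e1, P.sq_eq hwK] at h3
        exact hwE.2 ⟨hwK, h3⟩
      · exact Set.disjoint_left.1 hUV hM'.1 (hNW hw').1
      · unfold calibration helixCoord
        rw [e1, e2, e3]
    · exact ⟨w, ⟨hwE, hwM⟩, rfl⟩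
  obtain ⟨h3, h4⟩ := H.profileArea_le_lintegral P (hEo.measurableSet.diff hMo.measurableSet)
    sdiff_subset hcov
  have h5 : profileArea r h α ≤ ∫⁻ x in E \ M, ENNReal.ofReal (areaElement f x) :=
    h3.trans (setLIntegral_mono' (hEo.measurableSet.diff hMo.measurableSet) fun x hx =>
      ENNReal.ofReal_le_ofReal (h4 x hx))
  have h6 : (∫⁻ x in E ∩ M, ENNReal.ofReal (areaElement f x)) +
      ∫⁻ x in E \ M, ENNReal.ofReal (areaElement f x) ≤ profileArea r h α := by
    rw [lintegral_inter_add_sdiff _ _ hMo.measurableSet]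
    exact (lintegral_mono_set hEK).trans harea
  have h7 : ∫⁻ x in E ∩ M, ENNReal.ofReal (areaElement f x) = 0 := by
    have h8 := profileArea_ne_top r h α
    by_contra h0
    have h9 : profileArea r h α < profileArea r h α := by
      calc profileArea r h α < (∫⁻ x in E ∩ M, ENNReal.ofReal (areaElement f x)) +
            profileArea r h α := by
            rw [add_comm]
            exact ENNReal.lt_add_right h8 h0
        _ ≤ _ := (add_le_add_right h5 _).trans h6
    exact lt_irrefl _ h9
  have hEM : IsOpen (E ∩ M) := hEo.inter hMo
  have h10 : volume (E ∩ M) = 0 := by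
    have hm : AEMeasurable (fun x => ENNReal.ofReal (areaElement f x))
        (volume.restrict (E ∩ M)) :=
      ENNReal.measurable_ofReal.comp_aemeasurable
        ((H.areaElement_continuousOn.mono (inter_subset_left.trans hEK)).aemeasurable
          hEM.measurableSet)
    rw [setLIntegral_eq_zero_iff' hEM.measurableSet hm] at h7
    rw [measure_eq_zero_iff_ae_notMem]
    filter_upwards [h7] with w hw hwm
    have h13 := H.areaElement_pos P (hEK hwm.1) hwm.1.2
    exact h13.not_ge (ENNReal.ofReal_eq_zero.1 (hw hwm))
  have h12 : (E ∩ M).Nonempty := by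
    obtain ⟨w, hwM, hwK, hwA⟩ := mem_closure_iff_nhds.1
      (H.subset_closure_diff_axisPoints (interior_subset hx)) M (hMo.mem_nhds hxM)
    exact ⟨w, ⟨hwM.2.1, hwA⟩, hwM⟩
  exact (hEM.measure_pos volume h12).ne' h10

end IsCompetitor

/-- An injective L expands distances by at least 1/C, and near x the map differs from L by a
Lipschitz error of half that constant. -/
theorem exists_injOn_of_hasStrictFDerivAt {f : Plane → Space} {L : Plane →L[ℝ] Space} {x : Plane}
    (hf : HasStrictFDerivAt f L x) (hL : Function.Injective L) : ∃ O ∈ 𝓝 x, InjOn f O := by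
  obtain ⟨C, hC, hCL⟩ := L.toLinearMap.exists_antilipschitzWith
    (LinearMap.ker_eq_bot.2 hL)
  obtain ⟨O, hO, hap⟩ := hf.approximates_deriv_on_nhds (c := C⁻¹ / 2) (Or.inr (by positivity))
  refine ⟨O, hO, fun y hy z hz hyz => ?_⟩
  have h1 := hap y hy z hz
  rw [hyz, sub_self, zero_sub, norm_neg] at h1
  have h2 : ‖y - z‖ ≤ C * ‖L (y - z)‖ := by
    have := hCL.le_mul_dist y z
    rw [dist_eq_norm, dist_eq_norm] at this
    rw [map_sub]
    exact this
  have hC' : (0 : ℝ) < C := hC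
  have h3 : ‖y - z‖ ≤ C * ((C : ℝ)⁻¹ / 2 * ‖y - z‖) :=
    h2.trans (mul_le_mul_of_nonneg_left (by exact_mod_cast h1) hC'.le)
  have h4 : (C : ℝ) * ((C : ℝ)⁻¹ / 2 * ‖y - z‖) = ‖y - z‖ / 2 := by
    field_simp
  rw [h4] at h3
  have h5 : ‖y - z‖ = 0 := le_antisymm (by linarith) (norm_nonneg _)
  exact sub_eq_zero.1 (norm_eq_zero.1 h5)

/-! ### Radius and height as global parameters of a minimizer -/

namespace IsCompetitor

variable {r h φ₁ φ₂ : ℝ} {f : Plane → Space} {K : Set Plane} (H : IsCompetitor r h φ₁ φ₂ f K)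
  {σ ψ : Plane → ℝ} (P : IsSignedPolar f K σ ψ) {ψ₁ ψ₂ : ℝ}
  (h₁ : ∀ x ∈ endPoints r f K h, ψ x = ψ₁) (h₂ : ∀ x ∈ endPoints r f K 0, ψ x = ψ₂)

include H P

theorem param_continuousOn : ContinuousOn (fun y => (σ y, f y 2)) K :=
  P.cont_radius.prodMk (H.coord_continuousOn 2)

include h₁ h₂

/-- With ψ affine in z, the second calibrating coordinate at fixed s is a strictly increasing affine
function of the height. So the covered slices of the calibrated region give all heights in (0, h)
for s ≠ 0, and compactness of K gives the closed rectangle. -/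
theorem param_surjOn (harea : area f K ≤ profileArea r h (ψ₁ - ψ₂)) :
    SurjOn (fun y => (σ y, f y 2)) K (Icc (-r) r ×ˢ Icc 0 h) := by
  have hr := H.r_pos
  have hhp := H.h_pos
  set α := ψ₁ - ψ₂ with hα
  have hcl : IsClosed ((fun y => (σ y, f y 2)) '' K) :=
    (H.isCompact.image_of_continuousOn (H.param_continuousOn P)).isClosed
  have hsub : (Ioo (-r) 0 ∪ Ioo 0 r) ×ˢ Ioo 0 h ⊆ (fun y => (σ y, f y 2)) '' K := by
    rintro ⟨s, y⟩ ⟨hs, hy⟩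
    have hs1 : s ∈ Ioo (-r) r \ {0} := by
      rcases hs with ⟨h3, h4⟩ | ⟨h3, h4⟩
      · exact ⟨⟨h3, by simp only at *; linarith⟩, fun h5 => absurd h4 (by simp_all)⟩
      · exact ⟨⟨by simp only at *; linarith, h4⟩, fun h5 => absurd h3 (by simp_all)⟩
    have hy1 : 0 < y := hy.1
    have hy2 : y < h := hy.2
    have hl := helixLength_pos hhp α s
    have hinv : 0 < (helixLength h α s)⁻¹ := inv_pos.2 hl
    have hmono : ∀ t, (helixLength h α s)⁻¹ * (s ^ 2 * α * (ψ₂ + α / h * t) + h * t) =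
        helixBound h α 0 ψ₂ s + (helixLength h α s)⁻¹ * (s ^ 2 * α ^ 2 / h + h) * t := by
      intro t
      unfold helixBound
      ring
    have hcoef : 0 < (helixLength h α s)⁻¹ * (s ^ 2 * α ^ 2 / h + h) := by positivity
    have htop : helixBound h α h ψ₁ s =
        (helixLength h α s)⁻¹ * (s ^ 2 * α * (ψ₂ + α / h * h) + h * h) := by
      unfold helixBound
      rw [div_mul_cancel₀ _ hhp.ne', hα]
      ring
    have hp : (!₂[s, (helixLength h α s)⁻¹ * (s ^ 2 * α * (ψ₂ + α / h * y) + h * y)] : Plane) ∈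
        calibratedRegion r h ψ₁ ψ₂ := by
      refine ⟨?_, ?_, ?_⟩
      · simpa using hs1
      · change helixBound h α 0 ψ₂ s < _
        simp only [Matrix.cons_val_one, Matrix.cons_val_zero]
        rw [hmono]
        have := mul_pos hcoef hy1
        linarith
      · change _ < helixBound h α h ψ₁ s
        simp only [Matrix.cons_val_one, Matrix.cons_val_zero]
        rw [htop, hmono, hmono]
        have := mul_lt_mul_of_pos_left hy2 hcoef
        linarith
    obtain ⟨w, hw, hwp⟩ := H.calibratedRegion_subset P h₁ h₂ hp
    have hwK : w ∈ K := interior_subset hw.1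
    have e0 : σ w = s := by
      rw [← calibration_zero h α f σ ψ w, hwp]
      simp
    have e1 : helixCoord h α f σ ψ w =
        (helixLength h α s)⁻¹ * (s ^ 2 * α * (ψ₂ + α / h * y) + h * y) := by
      rw [← calibration_one h α f σ ψ w, hwp]
      simp
    rw [helixCoord, e0, H.angle_eq P h₁ h₂ harea hwK] at e1
    refine ⟨w, hwK, Prod.ext e0 ?_⟩
    have e2 : (helixLength h α s)⁻¹ * (s ^ 2 * α ^ 2 / h + h) * f w 2 =
        (helixLength h α s)⁻¹ * (s ^ 2 * α ^ 2 / h + h) * y := by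
      have a1 := hmono (f w 2)
      have a2 := hmono y
      linarith
    exact mul_left_cancel₀ hcoef.ne' e2
  have hclos := hcl.closure_subset_iff.2 hsub
  rw [closure_prod_eq, closure_union, closure_Ioo (by linarith), closure_Ioo hr.ne,
    closure_Ioo hhp.ne, Icc_union_Icc_eq_Icc (by linarith) hr.le] at hclos
  exact hclos

/-- Heights 0 and h are not taken inside because the parameter map is open there; conversely, every
frontier point has height 0 or h or lies on the side surface. -/
theorem param_image_interior (harea : area f K ≤ profileArea r h (ψ₁ - ψ₂)) :
    (fun y => (σ y, f y 2)) '' interior K = Ioo (-r) r ×ˢ Ioo 0 h := by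
  refine Subset.antisymm ?_ ?_
  · rintro _ ⟨x, hx, rfl⟩
    have hxK := interior_subset hx
    refine ⟨?_, ?_⟩
    · have h3 := H.radiusSq_lt_of_mem_interior hx
      rw [← P.sq_eq hxK] at h3
      exact abs_lt_of_sq_lt_sq' h3 H.r_pos.le
    · obtain ⟨N, δ, -, -, hN, hδ, hbij⟩ := H.exists_param_chart P h₁ h₂ harea hx univ_mem
      have hmem : ∀ t, |t| < δ → f x 2 + t ∈ Icc 0 h := by
        intro t ht
        obtain ⟨y, hy, hyt⟩ := hbij.surjOn (show (σ x, f x 2 + t) ∈ ball (σ x, f x 2) δ by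
          rw [mem_ball, Prod.dist_eq]
          simp [ht])
        have h4 : f y 2 = f x 2 + t := (Prod.ext_iff.1 hyt).2
        rw [← h4]
        exact H.height_mem (interior_subset (hN hy).2)
      have h5 := hmem (δ / 2) (by rw [abs_of_pos (by linarith)]; linarith)
      have h6 := hmem (-(δ / 2)) (by rw [abs_neg, abs_of_pos (by linarith)]; linarith)
      exact ⟨by linarith [h6.1], by linarith [h5.2]⟩
  · rintro ⟨s, y⟩ ⟨hs, hy⟩
    obtain ⟨x, hx, hxe⟩ := H.param_surjOn P h₁ h₂ harea
      (show (s, y) ∈ Icc (-r) r ×ˢ Icc 0 h from ⟨Ioo_subset_Icc_self hs, Ioo_subset_Icc_self hy⟩)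
    refine ⟨x, mem_interior hx fun hxf => ?_, hxe⟩
    have e0 : σ x = s := (Prod.ext_iff.1 hxe).1
    have e1 : f x 2 = y := (Prod.ext_iff.1 hxe).2
    have hs1 : -r < s := hs.1
    have hs2 : s < r := hs.2
    have hy1 : 0 < y := hy.1
    have hy2 : y < h := hy.2
    rcases H.frontier_cases hxf with h3 | h3 | h3
    · linarith [h3.1]
    · linarith [h3.1]
    · rw [← P.sq_eq hx, e0] at h3
      have := sq_lt_sq' hs1 hs2
      linarith

theorem param_injOn (harea : area f K ≤ profileArea r h (ψ₁ - ψ₂)) :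
    InjOn (fun y => (σ y, f y 2)) K := by
  refine injOn_of_injOn_interior H.isCompact H.subset_closure_interior (H.param_continuousOn P)
    ((convex_Ioo (-r) r).prod (convex_Ioo 0 h)) (H.param_image_interior P h₁ h₂ harea)
    (H.param_injOn_interior P h₁ h₂ harea) ?_ ?_
  · intro x hx O hO
    obtain ⟨N, δ, -, -, hN, hδ, hbij⟩ := H.exists_param_chart P h₁ h₂ harea hx hO
    refine mem_of_superset (ball_mem_nhds _ hδ) ?_
    rw [← hbij.image_eq]
    exact image_mono fun y hy => (hN hy).1
  · intro x hx
    obtain ⟨O, hO, hinj⟩ := exists_injOn_of_hasStrictFDerivAt (H.hasStrictFDerivAt hx)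
      (H.immersed.immersion x hx)
    refine ⟨O, hO, fun y hy z hz hyz => hinj hy.2 hz.2 ?_⟩
    have e0 : σ y = σ z := (Prod.ext_iff.1 hyz).1
    have e1 : f y 2 = f z 2 := (Prod.ext_iff.1 hyz).2
    rw [H.eq_helicoidMap P h₁ h₂ harea hy.1, H.eq_helicoidMap P h₁ h₂ harea hz.1, e0, e1]

/-- A surface of minimal area parametrizes a compact helicoid. -/
theorem bijOn_compactHelicoid (harea : area f K ≤ profileArea r h (ψ₁ - ψ₂)) :
    BijOn f K (compactHelicoid r h ψ₂ (ψ₁ - ψ₂)) := by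
  have hb : BijOn (fun y => (!₂[σ y, f y 2] : Plane)) K (parameterRectangle r h) := by
    refine ⟨fun y hy => ⟨?_, ?_⟩, fun y hy z hz hyz => ?_, fun p hp => ?_⟩
    · have h3 := H.radiusSq_le hy
      rw [← P.sq_eq hy] at h3
      simpa using abs_le_of_sq_le_sq' h3 H.r_pos.le
    · simpa using H.height_mem hy
    · refine H.param_injOn P h₁ h₂ harea hy hz (Prod.ext ?_ ?_)
      · simpa using congrArg (fun q : Plane => q 0) hyz
      · simpa using congrArg (fun q : Plane => q 1) hyz
    · obtain ⟨y, hy, hyp⟩ := H.param_surjOn P h₁ h₂ harea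
        (show (p 0, p 1) ∈ Icc (-r) r ×ˢ Icc 0 h from hp)
      refine ⟨y, hy, ?_⟩
      have e0 : σ y = p 0 := (Prod.ext_iff.1 hyp).1
      have e1 : f y 2 = p 1 := (Prod.ext_iff.1 hyp).2
      ext i
      fin_cases i
      · simpa using e0
      · simpa using e1
  exact ((helicoidMap_bijOn H.r_pos h ψ₂ (ψ₁ - ψ₂)).comp hb).congr fun y hy =>
    (H.eq_helicoidMap P h₁ h₂ harea hy).symm

end IsCompetitor

/-! ### The area of a surface congruent to the helicoid -/

/-- A differentiable function that vanishes on a set has zero derivative almost everywhere there. -/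
theorem ae_eq_zero_of_hasFDerivAt {K : Set Plane} (hK : MeasurableSet K) {u : Plane → ℝ}
    {u' : Plane → Plane →L[ℝ] ℝ} (hu : ∀ x ∈ K, HasFDerivAt u (u' x) x)
    (h0 : ∀ x ∈ K, u x = 0) : ∀ᵐ x ∂volume.restrict K, u' x = 0 := by
  -- On K the zero map approximates u with error constant 0, which bounds the derivative at almost
  -- every point of K.
  have hap : ApproximatesLinearOn (fun x => u x • (EuclideanSpace.single 0 1 : Plane))
      (0 : Plane →L[ℝ] Plane) K 0 := by
    intro x hx y hy
    simp [h0 x hx, h0 y hy]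
  filter_upwards [hap.norm_fderiv_sub_le volume hK
    (fun x => (u' x).smulRight (EuclideanSpace.single 0 1 : Plane))
    (fun x hx => ((hu x hx).smul_const _).hasFDerivWithinAt)] with x hx
  have h1 : (u' x).smulRight (EuclideanSpace.single 0 1 : Plane) = 0 := by
    rwa [sub_zero, nonpos_iff_eq_zero, nnnorm_eq_zero] at hx
  ext v
  have h2 := congrArg (fun L : Plane →L[ℝ] Plane => L v 0) h1
  simpa using h2

theorem gram_linear_combination (u v : Space) (a b c d : ℝ) :
    ‖a • u + b • v‖ ^ 2 * ‖c • u + d • v‖ ^ 2 - inner ℝ (a • u + b • v) (c • u + d • v) ^ 2 =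
      (a * d - b * c) ^ 2 * (‖u‖ ^ 2 * ‖v‖ ^ 2 - inner ℝ u v ^ 2) := by
  have h1 : inner ℝ v u = inner ℝ u v := real_inner_comm _ _
  rw [← real_inner_self_eq_norm_sq, ← real_inner_self_eq_norm_sq, ← real_inner_self_eq_norm_sq,
    ← real_inner_self_eq_norm_sq]
  simp only [inner_add_left, inner_add_right, real_inner_smul_left, real_inner_smul_right, h1]
  ring

theorem clm_det_eq (A : Plane →L[ℝ] Plane) :
    A.det = A (EuclideanSpace.single 0 1) 0 * A (EuclideanSpace.single 1 1) 1 -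
      A (EuclideanSpace.single 0 1) 1 * A (EuclideanSpace.single 1 1) 0 := by
  rw [ContinuousLinearMap.det, ← LinearMap.det_toMatrix (EuclideanSpace.basisFun (Fin 2) ℝ).toBasis,
    Matrix.det_fin_two]
  simp [LinearMap.toMatrix_apply]
  ring

theorem clm_comp_apply_eq (B : Plane →L[ℝ] Space) (v : Plane) :
    B v = v 0 • B (EuclideanSpace.single 0 1) + v 1 • B (EuclideanSpace.single 1 1) := by
  rw [← map_smul, ← map_smul, ← map_add]
  congr 1
  ext i
  fin_cases i <;> simp

/-- The area formula for the area element of a reparametrized and moved surface. -/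
theorem areaElement_eq_abs_det_mul {f F : Plane → Space} {x y : Plane} {A : Plane →L[ℝ] Plane}
    (g : Space ≃ₗᵢ[ℝ] Space) (hA : ∀ v, g (fderiv ℝ f x v) = fderiv ℝ F y (A v)) :
    areaElement f x = |A.det| * areaElement F y := by
  unfold areaElement
  simp only
  rw [← g.norm_map, ← g.norm_map (fderiv ℝ f x (EuclideanSpace.single 1 1)), ← g.inner_map_map,
    hA, hA, clm_comp_apply_eq (fderiv ℝ F y) (A (EuclideanSpace.single 0 1)),
    clm_comp_apply_eq (fderiv ℝ F y) (A (EuclideanSpace.single 1 1)), gram_linear_combination,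
    ← clm_det_eq, Real.sqrt_mul (sq_nonneg _), Real.sqrt_sq_eq_abs]

theorem helicoidMap_helicoidParam {φ ω : ℝ} {p : Space} (hp : p ∈ helicoid φ ω) :
    helicoidMap φ ω (helicoidParam φ ω p) = p := by
  obtain ⟨x, rfl⟩ := hp
  rw [helicoidParam_helicoidMap]

/-- Φ, the helicoid parameters of g ∘ f, maps K bijectively onto the rectangle, and the area formula
for Φ turns one area integral into the other. -/
theorem IsCompetitor.area_eq_of_congruentTo {r h φ₁ φ₂ : ℝ} {f : Plane → Space} {K : Set Plane}
    (H : IsCompetitor r h φ₁ φ₂ f K) {φ θ : ℝ} (hc : CongruentTo f K (compactHelicoid r h φ θ)) :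
    area f K = helicoidArea r h φ θ := by
  obtain ⟨g, hg⟩ := hc
  set ω := θ / h with hω
  set T := g.toRealAffineIsometryEquiv with hT
  set L : Space →L[ℝ] Space := T.linearIsometryEquiv.toContinuousLinearEquiv.toContinuousLinearMap
    with hL
  have hgd : ∀ p, HasFDerivAt g L p := by
    intro p
    have h1 : HasFDerivAt (fun q => L q + (g 0 : Space)) L p := L.hasFDerivAt.add_const _
    refine h1.congr_of_eventuallyEq (Eventually.of_forall fun q => ?_)
    have h2 := T.map_vadd 0 q
    simpa [hT, hL] using h2
  set Φ : Plane → Plane := fun x => helicoidParam φ ω (g (f x)) with hΦ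
  set Φ' : Plane → Plane →L[ℝ] Plane := fun x =>
    (fderiv ℝ (helicoidParam φ ω) (g (f x))).comp (L.comp (fderiv ℝ f x)) with hΦ'
  have hgf : ∀ x ∈ K, HasFDerivAt (fun y => g (f y)) (L.comp (fderiv ℝ f x)) x := fun x hx =>
    HasFDerivAt.comp x (hgd (f x)) (H.hasStrictFDerivAt hx).hasFDerivAt
  have hΦd : ∀ x ∈ K, HasFDerivAt Φ (Φ' x) x := fun x hx =>
    HasFDerivAt.comp x
      (((contDiff_helicoidParam φ ω).differentiable one_ne_zero _).hasFDerivAt) (hgf x hx)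
  have hinv : ∀ x ∈ K, helicoidMap φ ω (Φ x) = g (f x) := fun x hx =>
    helicoidMap_helicoidParam (hg.mapsTo hx).1
  have hFd : ∀ x ∈ K, HasFDerivAt (fun y => helicoidMap φ ω (Φ y))
      ((fderiv ℝ (helicoidMap φ ω) (Φ x)).comp (Φ' x)) x := fun x hx =>
    HasFDerivAt.comp x
      (((contDiff_helicoidMap φ ω).differentiable one_ne_zero _).hasFDerivAt) (hΦd x hx)
  have hKm : MeasurableSet K := H.isClosed.measurableSet
  -- The identity g ∘ f = helicoid ∘ Φ is known on K only. Comparing derivatives almost everywhere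
  -- on K avoids any discussion of the size of its boundary.
  have hae : ∀ i : Fin 3, ∀ᵐ x ∂volume.restrict K,
      (EuclideanSpace.proj i : Space →L[ℝ] ℝ).comp (L.comp (fderiv ℝ f x) -
        (fderiv ℝ (helicoidMap φ ω) (Φ x)).comp (Φ' x)) = 0 := by
    intro i
    refine ae_eq_zero_of_hasFDerivAt hKm (u := fun y => (EuclideanSpace.proj i : Space →L[ℝ] ℝ)
      (g (f y) - helicoidMap φ ω (Φ y))) (fun x hx => ?_) fun x hx => ?_
    · exact (EuclideanSpace.proj i : Space →L[ℝ] ℝ).hasFDerivAt.comp x ((hgf x hx).sub (hFd x hx))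
    · rw [hinv x hx, sub_self, map_zero]
  have hbij : BijOn Φ K (parameterRectangle r h) := by
    have h1 : EqOn (helicoidMap φ ω ∘ Φ) (g ∘ f) K := hinv
    refine ⟨fun x hx => ?_, fun x hx y hy hxy => ?_, fun p hp => ?_⟩
    · obtain ⟨p, hp, hpx⟩ := (helicoidMap_bijOn H.r_pos h φ θ).surjOn (hg.mapsTo hx)
      have : Φ x = p := by
        change helicoidParam φ ω ((g ∘ f) x) = p
        rw [← hpx, helicoidParam_helicoidMap]
      rwa [this]
    · exact hg.injOn hx hy (by rw [← h1 hx, ← h1 hy]; exact congrArg (helicoidMap φ ω) hxy)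
    · obtain ⟨x, hx, hxp⟩ := hg.surjOn ((helicoidMap_bijOn H.r_pos h φ θ).mapsTo hp)
      refine ⟨x, hx, ?_⟩
      change helicoidParam φ ω ((g ∘ f) x) = p
      rw [hxp, helicoidParam_helicoidMap]
  unfold helicoidArea area
  rw [← hbij.image_eq, lintegral_image_eq_lintegral_abs_det_fderiv_mul volume hKm
    (fun x hx => (hΦd x hx).hasFDerivWithinAt) hbij.injOn]
  refine lintegral_congr_ae ?_
  filter_upwards [hae 0, hae 1, hae 2] with x h0 h1 h2
  rw [← ENNReal.ofReal_mul (abs_nonneg _)]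
  congr 1
  refine areaElement_eq_abs_det_mul T.linearIsometryEquiv fun v => ?_
  have hz : (L.comp (fderiv ℝ f x) - (fderiv ℝ (helicoidMap φ ω) (Φ x)).comp (Φ' x)) v = 0 := by
    ext i
    fin_cases i
    · exact congrArg (fun M : Plane →L[ℝ] ℝ => M v) h0
    · exact congrArg (fun M : Plane →L[ℝ] ℝ => M v) h1
    · exact congrArg (fun M : Plane →L[ℝ] ℝ => M v) h2
  exact sub_eq_zero.1 hz

/-! ### Congruent helicoids -/

/-- A rotation by kπ maps each ruling to itself, multiplying the signed radius by (-1)^k. -/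
theorem helicoid_subset_add_int_mul_pi (φ ω : ℝ) (k : ℤ) :
    helicoid φ ω ⊆ helicoid (φ + k * Real.pi) ω := by
  rintro _ ⟨x, rfl⟩
  have hsq : ((-1 : ℝ) ^ k) * (-1) ^ k = 1 := by
    rw [← zpow_add₀ (by norm_num), ← two_mul, zpow_mul]
    norm_num
  refine ⟨!₂[(-1) ^ k * x 0, x 1], ?_⟩
  have e : φ + k * Real.pi + ω * x 1 = φ + ω * x 1 + k * Real.pi := by ring
  ext i
  fin_cases i
  · simp [helicoidMap, e, Real.cos_add_int_mul_pi]
    linear_combination x 0 * Real.cos (φ + ω * x 1) * hsq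
  · simp [helicoidMap, e, Real.sin_add_int_mul_pi]
    linear_combination x 0 * Real.sin (φ + ω * x 1) * hsq
  · simp [helicoidMap]

theorem compactHelicoid_add_int_mul_pi (r h φ θ : ℝ) (k : ℤ) :
    compactHelicoid r h (φ + k * Real.pi) θ = compactHelicoid r h φ θ := by
  have h1 := helicoid_subset_add_int_mul_pi (φ + k * Real.pi) (θ / h) (-k)
  rw [Int.cast_neg, neg_mul, add_neg_cancel_right] at h1
  unfold compactHelicoid
  rw [h1.antisymm (helicoid_subset_add_int_mul_pi φ (θ / h) k)]

/-- The reflection in the vertical plane with direction `φ`. -/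
noncomputable def verticalReflection (φ : ℝ) : Space ≃ᵢ Space :=
  IsometryEquiv.mk'
    (fun p => !₂[Real.cos (2 * φ) * p 0 + Real.sin (2 * φ) * p 1,
      Real.sin (2 * φ) * p 0 - Real.cos (2 * φ) * p 1, p 2])
    (fun p => !₂[Real.cos (2 * φ) * p 0 + Real.sin (2 * φ) * p 1,
      Real.sin (2 * φ) * p 0 - Real.cos (2 * φ) * p 1, p 2])
    (fun p => by
      have hsc := Real.sin_sq_add_cos_sq (2 * φ)
      ext i
      fin_cases i
      · simp
        linear_combination p 0 * hsc
      · simp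
        linear_combination p 1 * hsc
      · simp)
    (Isometry.of_dist_eq fun p q => by
      have hsc := Real.sin_sq_add_cos_sq (2 * φ)
      rw [EuclideanSpace.dist_eq, EuclideanSpace.dist_eq]
      congr 1
      simp only [Fin.sum_univ_three, Real.dist_eq, sq_abs]
      simp
      linear_combination ((p 0 - q 0) ^ 2 + (p 1 - q 1) ^ 2) * hsc)

theorem verticalReflection_apply (φ : ℝ) (p : Space) :
    verticalReflection φ p = !₂[Real.cos (2 * φ) * p 0 + Real.sin (2 * φ) * p 1,
      Real.sin (2 * φ) * p 0 - Real.cos (2 * φ) * p 1, p 2] := rfl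

theorem verticalReflection_helicoidMap (φ ω : ℝ) (x : Plane) :
    verticalReflection φ (helicoidMap φ ω x) = helicoidMap φ (-ω) x := by
  have e : φ + -ω * x 1 = 2 * φ - (φ + ω * x 1) := by ring
  rw [verticalReflection_apply]
  ext i
  fin_cases i
  · simp only [helicoidMap, e, Real.cos_sub]
    simp
    ring
  · simp only [helicoidMap, e, Real.sin_sub]
    simp
    ring
  · simp [helicoidMap]

theorem bijOn_verticalReflection {r : ℝ} (hr : 0 < r) (h φ θ : ℝ) :
    BijOn (verticalReflection φ) (compactHelicoid r h φ (-θ)) (compactHelicoid r h φ θ) := by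
  have e : EqOn (verticalReflection φ ∘ helicoidMap φ (-θ / h)) (helicoidMap φ (θ / h))
      (parameterRectangle r h) := fun x _ => by
    rw [Function.comp_apply, verticalReflection_helicoidMap, ← neg_div, neg_neg]
  have h1 := helicoidMap_bijOn hr h φ (-θ)
  have h2 := helicoidMap_bijOn hr h φ θ
  refine ⟨?_, (verticalReflection φ).injective.injOn, ?_⟩
  · intro p hp
    obtain ⟨x, hx, rfl⟩ := h1.surjOn hp
    have := e hx
    rw [Function.comp_apply] at this
    rw [this]
    exact h2.mapsTo hx
  · intro p hp
    obtain ⟨x, hx, rfl⟩ := h2.surjOn hp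
    exact ⟨_, h1.mapsTo hx, e hx⟩

/-- An angle of absolute value at most π/2 is of least absolute value in its class modulo π, since
|mπ| ≥ π ≥ 2|θ| for m ≠ 0. -/
theorem abs_le_abs_add_int_mul_pi {θ : ℝ} (hθ : |θ| ≤ Real.pi / 2) (m : ℤ) :
    |θ| ≤ |θ + m * Real.pi| := by
  rcases eq_or_ne m 0 with rfl | hm
  · simp
  have hpi := Real.pi_pos
  have h1 : (1 : ℝ) ≤ |(m : ℝ)| := by exact_mod_cast Int.one_le_abs hm
  have h2 : Real.pi ≤ |(m : ℝ) * Real.pi| := by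
    rw [abs_mul, abs_of_pos hpi]
    nlinarith
  have h3 : |(m : ℝ) * Real.pi| ≤ |θ + m * Real.pi| + |θ| := by
    have := abs_sub (θ + m * Real.pi) θ
    rwa [add_sub_cancel_left] at this
  linarith

end HelicoidCylinder

/-! ### The theorem -/

theorem theorem1p1 (r h : ℝ) (hr : 0 < r) (hh : 0 < h)
    -- directions of the diameters `d₁` (top) and `d₂` (bottom), which are not parallel
    (φ₁ φ₂ : ℝ) (hnp : ∀ k : ℤ, φ₁ - φ₂ ≠ k * Real.pi)
    -- `H_C` turns from `d₂` to `d₁` by an angle `θ` of absolute value at most `π / 2`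
    (θ : ℝ) (hθ : |θ| ≤ Real.pi / 2) (hθd : ∃ k : ℤ, φ₁ - φ₂ = θ + k * Real.pi)
    (f : Plane → Space) (K : Set Plane) (hf : IsImmersedDisk f K)
    (hC : f '' K ⊆ solidCylinder r h)
    (hbd : f '' frontier K ⊆ diameter r h φ₁ ∪ diameter r 0 φ₂ ∪ sideSurface r h)
    (haxis : axis h ⊆ f '' K)
    (htr : TransversalToCylinders r f K) :
    helicoidArea r h φ₂ θ ≤ area f K ∧
      (area f K = helicoidArea r h φ₂ θ ↔ CongruentTo f K (compactHelicoid r h φ₂ θ)) := by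
  have H : IsCompetitor r h φ₁ φ₂ f K := ⟨hr, hh, hf, hC, hbd, haxis, htr⟩
  obtain ⟨σ, ψ, hσ, hψ, hp⟩ := H.exists_signed_polar
  have P : IsSignedPolar f K σ ψ := ⟨hσ, hψ, fun x hx => (hp x hx).1, fun x hx => (hp x hx).2⟩
  obtain ⟨ψ₁, ⟨k₁, hk₁⟩, h₁⟩ := H.exists_end_angle P (Or.inl ⟨rfl, rfl⟩)
  obtain ⟨ψ₂, ⟨k₂, hk₂⟩, h₂⟩ := H.exists_end_angle P (Or.inr ⟨rfl, rfl⟩)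
  obtain ⟨k, hk⟩ := hθd
  have hα : ψ₁ - ψ₂ = θ + (k + k₁ - k₂ : ℤ) * Real.pi := by
    rw [hk₁, hk₂]
    push_cast
    linear_combination hk
  have habs : |θ| ≤ |ψ₁ - ψ₂| := by
    rw [hα]
    exact abs_le_abs_add_int_mul_pi hθ _
  have hle := H.profileArea_le_area P h₁ h₂
  rw [helicoidArea_eq hh]
  refine ⟨(profileArea_mono r h habs).trans hle, fun heq => ?_, fun hc => ?_⟩
  -- A larger turn would make the profile area, a lower bound for the area, strictly larger than
  -- that of H_C.
  · have habs' : |ψ₁ - ψ₂| = |θ| := by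
      refine habs.antisymm' (not_lt.1 fun hlt => ?_)
      exact absurd (hle.trans heq.le) (profileArea_strictMono hr hh hlt).not_ge
    have hb := H.bijOn_compactHelicoid P h₁ h₂ (heq.le.trans (profileArea_mono r h habs))
    rw [hk₂, compactHelicoid_add_int_mul_pi, ← hk₂] at hb
    -- The opposite sign matters only for |θ| = π/2; the reflection in the vertical plane through d₂
    -- then reverses the sense of rotation.
    rcases abs_eq_abs.1 habs' with h3 | h3
    · rw [h3] at hb
      exact ⟨IsometryEquiv.refl _, hb⟩
    · rw [h3] at hb
      exact ⟨verticalReflection φ₂, (bijOn_verticalReflection hr h φ₂ θ).comp hb⟩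
  · rw [H.area_eq_of_congruentTo hc, helicoidArea_eq hh]
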